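/- **Conventions.** A *monoid* is a commutative monoid $M$ that is finitely generated, integral, saturated and sharp; $M\subset M^{\mathrm{gp}}$, and for $x,y\in M^{\mathrm{gp}}$ we write $x\le y$ if $y-x\in M$. Its dual cone is $M^\vee=(\mathrm{Hom}(M,\mathbb R_{\ge0}),\mathrm{Hom}(M,\mathbb Z))$. A *graph* $\Gamma$ is a finite connected multigraph (loops allowed) with $n\ge 1$ numbered legs; $\mathcal E(\Gamma)$ is the set of oriented edges. A *flow* is a map $s:\mathcal E(\Gamma)\to\mathbb Z$ with $s(\bar e)=-s(e)$, where $\bar e$ is $e$ with reversed orientation; edges with $s=0$ are *contracted edges* of $s$. A flow is *acyclic* if, after contracting these edges, the orientation with $s>0$ has no oriented cycle. $H_1(\Gamma)$ is the group of flows $\gamma$ such that for every vertex $v$ the values of $\gamma$ on the oriented edges pointing to $v$ add up to $0$; for $\ell\in\mathbb R^{E(\Gamma)}$ put $\langle s,\gamma\rangle_\ell=\frac12\sum_{e\in\mathcal E(\Gamma)}s(e)\gamma(e)\ell_e$. A *tropical curve over $M$* is a graph with edge lengths $\ell_e\in M\setminus\{0\}$. A *piecewise linear (PL) function* on it is a map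 $\alpha:V(\Gamma)\to M^{\mathrm{gp}}$ such that for every oriented edge $e$ from $v$ to $w$ we have $\alpha(w)-\alpha(v)=s_\alpha(e)\,\ell_e$ with an integer $s_\alpha(e)$, the slope. An *equidimensional lift* of $\Gamma$ consists of a subdivision $\Gamma'\to\Gamma$, a combinatorial line $X$ (vertices $v_0<\dots<v_k$, one edge joining each $v_i$ to $v_{i+1}$), and a map $\Gamma'\to X$ sending vertices to vertices and each edge onto a vertex or an edge. It is *stable* if every vertex of $X$ is the image of a vertex of $\Gamma$ and edges of $\Gamma$ that map to a vertex of $X$ are not subdivided. **The functors.** The following are stacks (functors to groupoids) on the category of monoids: * $\Sigma_{\mathbf{Div}}(M)$: pairs $(\Gamma,\alpha)$ of a tropical curve over $M$ and a PL function that is $0$ at the vertex carrying the first leg; * $\Sigma_{\mathbf{Ord}}(M)$: those $(\Gamma,\alpha)$ for which the values $\alpha(v)$ are totally ordered by $\le$; * $\Sigma_{\mathbf{Rub}}(M)$: pairs $(\Gamma,\alpha)$ in $\Sigma_{\mathbf{Div}}(M)$ with a stable equidimensional lift of $\alpha$: a stable equidimensional lift $\Gamma'\to X$ of $\Gamma$;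 lengths in $M\setminus\{0\}$ on the edges of $\Gamma'$ such that the lengths of the pieces of each edge $e$ of $\Gamma$ add up to $\ell_e$; and elements $\gamma_0<\dots<\gamma_k$ of $M^{\mathrm{gp}}$ (the positions of the vertices of $X$) such that the composite $V(\Gamma')\to V(X)\to M^{\mathrm{gp}}$ restricts to $\alpha$ on $V(\Gamma)$ and has on each piece of an edge of $\Gamma$ the slope of $\alpha$ on that edge. Isomorphisms are isomorphisms of graphs respecting all the data. A homomorphism $M\to N$ acts by applying it to all lengths and values and contracting the edges whose length becomes $0$. **The cone stacks.** Let $\mathbf{CombDiv}$ be the category of pairs $(\Gamma,s)$ of a graph and an acyclic flow; $\mathbf{CombOrd}$ that of triples $(\Gamma,s,\kappa)$ where $\kappa$ is an ordering of $V(\Gamma)$ extending $s$, that is, a total preorder (ties allowed) that increases strictly along edges with $s>0$ and in which end points of contracted edges are tied; and $\mathbf{CombRub}$ that of $(\Gamma,s)$ with a stable equidimensional lift $\Gamma'\to X$ that is strictly increasing along the pieces of edges with $s>0$ and constant on contracted edges. Morphisms are edge contractions (including isomorphisms) compatible with $s$, and respectively with $\kappa$ (the map on vertices is monotone) or with the lift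 (together with compatible contractions of $\Gamma'$ and $X$). To the objects assign the cones, with the integral structures induced from $\mathbb Z^{E(\Gamma)}$, $\mathbb Z^{E(\Gamma)}$ and $\mathbb Z^{E(\Gamma')}\times\mathbb Z^{E(X)}$: * $\sigma_{(\Gamma,s)}=\{\ell\in\mathbb R_{\ge0}^{E(\Gamma)}:\langle s,\gamma\rangle_\ell=0\ \text{for all }\gamma\in H_1(\Gamma)\}$; * $\sigma_{(\Gamma,s,\kappa)}$: the $\ell\in\sigma_{(\Gamma,s)}$ such that, for a $\kappa$-minimal vertex $v_0$ and oriented paths $P_{v_0\to w}$, $\sum_{e\in P_{v_0\to w}}s(e)\ell_e\le\sum_{e\in P_{v_0\to w'}}s(e)\ell_e$ whenever $w\le_\kappa w'$; * $\sigma_{(\Gamma,s,\Gamma'\to X)}$: the $(\ell_e,\ell_f)\in\mathbb R_{\ge0}^{E(\Gamma')}\times\mathbb R_{\ge0}^{E(X)}$ with $s(e)\ell_e=\ell_f$ for every edge $e$ of $\Gamma'$ mapping onto an edge $f$ of $X$ ($e$ oriented along $X$, and $s$ pulled back to $\Gamma'$). A morphism induces the inclusion of the locus where the contracted edges have length $0$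 (for $\mathbf{CombOrd}$, together with the inequalities of the target). Let $\Sigma'_{\mathbf{Div}},\Sigma'_{\mathbf{Ord}},\Sigma'_{\mathbf{Rub}}$ be the colimits of these diagrams of cones, in stacks over the category of cones. **Theorem.** In each of the three cases the cones are strictly convex rational polyhedral cones glued along faces, so that $\Sigma'_{\mathbf{Div}},\Sigma'_{\mathbf{Ord}},\Sigma'_{\mathbf{Rub}}$ are cone stacks, and they represent $\Sigma_{\mathbf{Div}},\Sigma_{\mathbf{Ord}},\Sigma_{\mathbf{Rub}}$ respectively: there are equivalences of groupoids $$\Sigma'_{\mathbf{Div}}(M^\vee)\simeq\Sigma_{\mathbf{Div}}(M),\qquad \Sigma'_{\mathbf{Ord}}(M^\vee)\simeq\Sigma_{\mathbf{Ord}}(M),\qquad \Sigma'_{\mathbf{Rub}}(M^\vee)\simeq\Sigma_{\mathbf{Rub}}(M),$$ natural in the monoid $M$. -/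

import Mathlib

open CategoryTheory

noncomputable section

namespace TropModuli

/-! ## Monoids and cones -/

/-- The associated group `M^gp`. -/
abbrev Gp (M : Type) [AddCommMonoid M] : Type := Algebra.GrothendieckAddGroup M

/-- The canonical map `M → M^gp`. -/
abbrev toGp {M : Type} [AddCommMonoid M] : M →+ Gp M := Algebra.GrothendieckAddGroup.of

/-- The map `M^gp → N^gp` induced by `M → N`. -/
def gpMap {M N : Type} [AddCommMonoid M] [AddCommMonoid N] (φ : M →+ N) : Gp M →+ Gp N :=
  Algebra.GrothendieckAddGroup.lift (toGp.comp φ)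

@[simp] theorem gpMap_toGp {M N : Type} [AddCommMonoid M] [AddCommMonoid N] (φ : M →+ N) (m : M) :
    gpMap φ (toGp m) = toGp (φ m) :=
  DFunLike.congr_fun (Algebra.GrothendieckAddGroup.lift.symm_apply_apply (toGp.comp φ)) m

theorem gp_hom_ext {M G : Type} [AddCommMonoid M] [AddCommGroup G] {f g : Gp M →+ G}
    (h : ∀ m : M, f (toGp m) = g (toGp m)) : f = g := by
  apply Algebra.GrothendieckAddGroup.lift.symm.injective
  ext m
  exact h m

@[simp] theorem gpMap_id {M : Type} [AddCommMonoid M] (x : Gp M) :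
    gpMap (AddMonoidHom.id M) x = x := by
  have h : gpMap (AddMonoidHom.id M) = AddMonoidHom.id (Gp M) :=
    gp_hom_ext fun m => by rw [gpMap_toGp]; rfl
  rw [h]; rfl

theorem gpMap_comp {M N P : Type} [AddCommMonoid M] [AddCommMonoid N] [AddCommMonoid P]
    (ψ : N →+ P) (φ : M →+ N) (x : Gp M) : gpMap (ψ.comp φ) x = gpMap ψ (gpMap φ x) := by
  have h : gpMap (ψ.comp φ) = (gpMap ψ).comp (gpMap φ) :=
    gp_hom_ext fun m => by
      rw [gpMap_toGp, AddMonoidHom.comp_apply (gpMap ψ), gpMap_toGp, gpMap_toGp]; rfl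
  rw [h]; rfl

/-- Sharp, finitely generated, integral, saturated commutative monoids (written additively). -/
structure Mon : Type 1 where
  carrier : Type
  [monoid : AddCommMonoid carrier]
  fg : AddMonoid.FG carrier
  integral : ∀ a b c : carrier, a + b = a + c → b = c
  saturated : ∀ (x : Gp carrier) (n : ℕ), 0 < n →
    n • x ∈ Set.range (toGp : carrier →+ Gp carrier) →
    x ∈ Set.range (toGp : carrier →+ Gp carrier)
  sharp : ∀ a b : carrier, a + b = 0 → a = 0

instance : CoeSort Mon Type := ⟨Mon.carrier⟩

instance (M : Mon) : AddCommMonoid M := M.monoid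

/-- The category of monoids, with all monoid homomorphisms. -/
instance : Category Mon where
  Hom M N := M →+ N
  id M := AddMonoidHom.id M
  comp f g := AddMonoidHom.comp g f

/-- The monoid homomorphism underlying a morphism of `Mon`. -/
def Mon.toHom {M N : Mon} (f : M ⟶ N) : M →+ N := f

/-- The partial order on `M^gp`: `x ≤ y` if `y - x ∈ M`. -/
def Mon.GpLE (M : Mon) (x y : Gp M) : Prop := y - x ∈ Set.range (toGp : M →+ Gp M)

/-- A cone with integral structure: a convex cone in a real vector space with a subgroup of
integral points.  It is a rational polyhedral cone if it satisfies
`Cone.IsRationalPolyhedral`. -/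
structure Cone : Type 1 where
  V : Type
  [grp : AddCommGroup V]
  [mod : Module ℝ V]
  cone : PointedCone ℝ V
  lattice : AddSubgroup V

instance (C : Cone) : AddCommGroup C.V := C.grp
instance (C : Cone) : Module ℝ C.V := C.mod

/-- The cone is strictly convex and is the intersection of finitely many half spaces
`λ ≥ 0`, with `λ` integral with respect to a full lattice. -/
structure Cone.IsRationalPolyhedral (C : Cone) : Prop where
  isLattice : ∃ (n : ℕ) (b : Module.Basis (Fin n) ℝ C.V),
    C.lattice = AddSubgroup.closure (Set.range b)
  polyhedral : ∃ F : Finset (C.V →ₗ[ℝ] ℝ),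
    (∀ f ∈ F, ∀ x ∈ C.lattice, ∃ n : ℤ, f x = n) ∧ ∀ x, x ∈ C.cone ↔ ∀ f ∈ F, 0 ≤ f x
  strictlyConvex : ∀ x ∈ C.cone, -x ∈ C.cone → x = 0

/-- A morphism of cones: a linear map of cones that preserves integral points. -/
@[ext] structure Cone.Hom (C D : Cone) where
  toLin : C.cone →ₗ[{r : ℝ // 0 ≤ r}] D.cone
  map_lattice : ∀ x : C.cone, (x : C.V) ∈ C.lattice → (toLin x : D.V) ∈ D.lattice

instance : Category Cone where
  Hom C D := Cone.Hom C D
  id C := ⟨LinearMap.id, fun _ h => h⟩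
  comp f g := ⟨g.toLin.comp f.toLin, fun x h => g.map_lattice _ (f.map_lattice x h)⟩

/-- A morphism of cones which is an isomorphism onto a face of its target, with the integral
structure induced from the target. -/
structure Cone.IsFaceInclusion {C D : Cone} (f : C ⟶ D) : Prop where
  injective : Function.Injective (Cone.Hom.toLin f)
  isFace : PointedCone.IsFaceOf
    (Submodule.map D.cone.subtype (LinearMap.range (Cone.Hom.toLin f)) : PointedCone ℝ D.V) D.cone
  lattice : ∀ x : C.cone, (Cone.Hom.toLin f x : D.V) ∈ D.lattice → (x : C.V) ∈ C.lattice

/-- The dual cone `M^∨ = (Hom(M, ℝ≥0), Hom(M, ℤ))`, inside `Hom(M, ℝ)`. -/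
def dualCone (M : Mon) : Cone where
  V := M →+ ℝ
  cone :=
    { carrier := {x | ∀ m, 0 ≤ x m}
      add_mem' := fun hx hy m => add_nonneg (hx m) (hy m)
      zero_mem' := fun _ => le_refl _
      smul_mem' := fun c _ hx m => mul_nonneg c.2 (hx m) }
  lattice :=
    { carrier := {x | ∀ m, ∃ n : ℤ, x m = n}
      add_mem' := fun {x y} hx hy m => by
        obtain ⟨a, ha⟩ := hx m
        obtain ⟨b, hb⟩ := hy m
        exact ⟨a + b, by simp [ha, hb]⟩
      zero_mem' := fun _ => ⟨0, by simp⟩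
      neg_mem' := fun {x} hx m => by
        obtain ⟨a, ha⟩ := hx m
        exact ⟨-a, by simp [ha]⟩ }

/-- A monoid homomorphism `M → N` induces `N^∨ → M^∨` by composition. -/
def dualMap {M N : Mon} (φ : M ⟶ N) : dualCone N ⟶ dualCone M where
  toLin :=
    { toFun := fun x => ⟨AddMonoidHom.comp (x.1 : N →+ ℝ) (Mon.toHom φ),
        fun m => x.2 (Mon.toHom φ m)⟩
      map_add' := fun _ _ => rfl
      map_smul' := fun _ _ => rfl }
  map_lattice := fun _ h m => h (Mon.toHom φ m)

/-- The duality functor from monoids to cones. -/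
def dual : Mon ⥤ Coneᵒᵖ where
  obj M := Opposite.op (dualCone M)
  map φ := Quiver.Hom.op (dualMap φ)
  map_id _ := rfl
  map_comp _ _ := rfl

/-! ## Gluing cones to stacks -/

/-- The category of pairs of an index `i` and a morphism of cones `τ ⟶ σ i`; its morphisms are the
morphisms of indices compatible with the morphisms from `τ`. -/
abbrev Points {I : Type 1} [Category.{0} I] (σ : I ⥤ Cone) (τ : Coneᵒᵖ) : Type 1 :=
  (σ ⋙ coyoneda.obj τ).Elements

/-- Precomposition with a morphism of cones. -/
def Points.map {I : Type 1} [Category.{0} I] (σ : I ⥤ Cone) {τ τ' : Coneᵒᵖ} (g : τ ⟶ τ') :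
    Points σ τ ⥤ Points σ τ' :=
  NatTrans.mapElements (Functor.whiskerLeft σ (coyoneda.map g))

theorem Points.map_id {I : Type 1} [Category.{0} I] (σ : I ⥤ Cone) (τ : Coneᵒᵖ) :
    Points.map σ (𝟙 τ) = 𝟭 _ := rfl

theorem Points.map_comp {I : Type 1} [Category.{0} I] (σ : I ⥤ Cone) {τ τ' τ'' : Coneᵒᵖ}
    (g : τ ⟶ τ') (h : τ' ⟶ τ'') :
    Points.map σ (g ≫ h) = Points.map σ g ⋙ Points.map σ h := rfl

/-- The colimit of a diagram of cones `σ`, in stacks over the category of cones: its groupoid of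
`τ`-points is the `2`-colimit of the sets `Hom(τ, σ i)` in groupoids, that is, the free groupoid
on the category of pairs of an index `i` and a morphism of cones `τ ⟶ σ i`. -/
def colimStack {I : Type 1} [Category.{0} I] (σ : I ⥤ Cone) : Coneᵒᵖ ⥤ Grpd.{1, 1} where
  obj τ := Grpd.of (FreeGroupoid (Points σ τ))
  map g := FreeGroupoid.map (Points.map σ g)
  map_id τ := (congrArg FreeGroupoid.map (Points.map_id σ τ)).trans (FreeGroupoid.map_id _)
  map_comp f g :=
    (congrArg FreeGroupoid.map (Points.map_comp σ f g)).trans (FreeGroupoid.map_comp _ _)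

/-- The morphism of cones given by a linear map of the ambient spaces. -/
def Cone.homOfLinear {C D : Cone} (f : C.V →ₗ[ℝ] D.V) (hc : ∀ x ∈ C.cone, f x ∈ D.cone)
    (hl : ∀ x ∈ C.lattice, f x ∈ D.lattice) : C ⟶ D where
  toLin :=
    { toFun := fun x => ⟨f x.1, hc _ x.2⟩
      map_add' := fun x y => Subtype.ext (map_add f x.1 y.1)
      map_smul' := fun r x => Subtype.ext (map_smul f r.1 x.1) }
  map_lattice := fun x h => hl x.1 h

theorem Cone.homOfLinear_congr {C D : Cone} {f g : C.V →ₗ[ℝ] D.V} {hc hl hc' hl'}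
    (h : ∀ x, f x = g x) :
    Cone.homOfLinear (C := C) (D := D) f hc hl = Cone.homOfLinear g hc' hl' := by
  obtain rfl : f = g := LinearMap.ext h
  rfl

theorem Cone.homOfLinear_id {C : Cone} {f : C.V →ₗ[ℝ] C.V} {hc hl} (h : ∀ x, f x = x) :
    Cone.homOfLinear (C := C) (D := C) f hc hl = 𝟙 C := by
  obtain rfl : f = LinearMap.id := LinearMap.ext h
  rfl

theorem Cone.homOfLinear_comp {C D E : Cone} {f : C.V →ₗ[ℝ] D.V} {g : D.V →ₗ[ℝ] E.V}
    {e : C.V →ₗ[ℝ] E.V} {hc hl hc' hl' hc'' hl''} (h : ∀ x, e x = g (f x)) :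
    Cone.homOfLinear (C := C) (D := E) e hc'' hl'' =
      Cone.homOfLinear (C := C) (D := D) f hc hl ≫
        Cone.homOfLinear (C := D) (D := E) g hc' hl' := by
  obtain rfl : e = g ∘ₗ f := LinearMap.ext h
  rfl

/-- The integral structure `ℤ^ι` of `ℝ^ι`. -/
def intLattice (ι : Type) : AddSubgroup (ι → ℝ) where
  carrier := {x | ∀ i, ∃ n : ℤ, x i = n}
  add_mem' := fun {x y} hx hy i => by
    obtain ⟨a, ha⟩ := hx i
    obtain ⟨b, hb⟩ := hy i
    exact ⟨a + b, by simp [ha, hb]⟩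
  zero_mem' := fun _ => ⟨0, by simp⟩
  neg_mem' := fun {x} hx i => by
    obtain ⟨a, ha⟩ := hx i
    exact ⟨-a, by simp [ha]⟩

/-- Extension by zero along `j`, as a map `ℝ^ι → ℝ^κ`. -/
def extendZero {ι κ : Type} (j : ι → κ) : (ι → ℝ) →ₗ[ℝ] (κ → ℝ) :=
  Function.ExtendByZero.linearMap ℝ j

theorem extendZero_apply {ι κ : Type} {j : ι → κ} (hj : Function.Injective j) (l : ι → ℝ) (i : ι) :
    extendZero j l (j i) = l i := hj.extend_apply l (0 : κ → ℝ) i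

theorem extendZero_apply' {ι κ : Type} {j : ι → κ} (l : ι → ℝ) {k : κ} (h : k ∉ Set.range j) :
    extendZero j l k = 0 := Function.extend_apply' l (0 : κ → ℝ) k h

theorem extendZero_nonneg {ι κ : Type} {j : ι → κ} (hj : Function.Injective j) {l : ι → ℝ}
    (hl : ∀ i, 0 ≤ l i) (k : κ) : 0 ≤ extendZero j l k := by
  by_cases h : k ∈ Set.range j
  · obtain ⟨i, rfl⟩ := h
    rw [extendZero_apply hj]
    exact hl i
  · rw [extendZero_apply' l h]

theorem extendZero_int {ι κ : Type} {j : ι → κ} (hj : Function.Injective j) {l : ι → ℝ}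
    (hl : l ∈ intLattice ι) : extendZero j l ∈ intLattice κ := by
  intro k
  by_cases h : k ∈ Set.range j
  · obtain ⟨i, rfl⟩ := h
    rw [extendZero_apply hj]
    exact hl i
  · exact ⟨0, by rw [extendZero_apply' l h]; simp⟩

theorem extendZero_id {ι : Type} {j : ι → ι} (hj : ∀ i, j i = i) (l : ι → ℝ) :
    extendZero j l = l := by
  obtain rfl : j = fun i => i := funext hj
  ext i
  exact extendZero_apply (j := fun i : ι => i) (fun _ _ h => h) l i

theorem extendZero_comp {ι κ μ : Type} {j : ι → κ} {j' : κ → μ} {j'' : ι → μ}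
    (hj : Function.Injective j) (hj' : Function.Injective j') (h : ∀ i, j'' i = j' (j i))
    (l : ι → ℝ) : extendZero j'' l = extendZero j' (extendZero j l) := by
  obtain rfl : j'' = fun i => j' (j i) := funext h
  ext m
  by_cases hm : m ∈ Set.range j'
  · obtain ⟨k, rfl⟩ := hm
    rw [extendZero_apply hj']
    by_cases hk : k ∈ Set.range j
    · obtain ⟨i, rfl⟩ := hk
      rw [extendZero_apply hj]
      exact extendZero_apply (hj'.comp hj) l i
    · rw [extendZero_apply' l hk]
      exact extendZero_apply' l fun ⟨i, hi⟩ => hk ⟨i, hj' hi⟩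
  · rw [extendZero_apply' _ hm]
    exact extendZero_apply' l fun ⟨i, hi⟩ => hm ⟨j i, hi⟩

/-- A functor `π : S ⥤ Mon`, regarded as the stack on `Mon` whose groupoid of `M`-points is the
fibre of `π` over `M`, is represented by the cone stack glued from the cones `σ`: the stack
`M ↦ (colimit of σ)(M^∨)` is equivalent to `S` over `Mon`. -/
def Represents {I : Type 1} [Category.{0} I] (σ : I ⥤ Cone) {S : Type 1} [Category.{0} S]
    (π : S ⥤ Mon) : Prop :=
  ∃ F : Grothendieck (dual ⋙ colimStack σ ⋙ Grpd.forgetToCat) ⥤ S,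
    F.IsEquivalence ∧ Nonempty (F ⋙ π ≅ Grothendieck.forget _)

/-- The cones `σ i` are rational polyhedral and are glued along faces. -/
def IsConeStackDiagram {I : Type 1} [Category.{0} I] (σ : I ⥤ Cone) : Prop :=
  (∀ i, (σ.obj i).IsRationalPolyhedral) ∧
    ∀ {i j : I} (f : i ⟶ j), Cone.IsFaceInclusion (σ.map f)

/-! ## Graphs, flows and orderings -/

/-- A finite connected graph (loops and multiple edges allowed) with at least one leg.  `D` is the
set of oriented edges, `rev` reverses the orientation, `src` is the starting point; `legs` lists
the vertices which carry the first leg, the second leg, and so on. -/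
structure Graph : Type 1 where
  V : Type
  D : Type
  [finV : Finite V]
  [finD : Finite D]
  rev : D → D
  rev_rev : ∀ d, rev (rev d) = d
  rev_ne : ∀ d, rev d ≠ d
  src : D → V
  connected : ∀ v w, Relation.ReflTransGen (fun a b => ∃ d, src d = a ∧ src (rev d) = b) v w
  legs : List V
  legs_ne : legs ≠ []

namespace Graph

instance (Γ : Graph) : Fintype Γ.V := @Fintype.ofFinite _ Γ.finV
instance (Γ : Graph) : Fintype Γ.D := @Fintype.ofFinite _ Γ.finD

/-- The end point of an oriented edge. -/
def tgt (Γ : Graph) (d : Γ.D) : Γ.V := Γ.src (Γ.rev d)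

/-- The vertex containing the (first) leg. -/
def root (Γ : Graph) : Γ.V := Γ.legs.head Γ.legs_ne

/-- The set of (unoriented) edges. -/
def Edge (Γ : Graph) : Type := Quot fun d d' : Γ.D => d' = Γ.rev d

/-- The edge underlying an oriented edge. -/
def edge (Γ : Graph) (d : Γ.D) : Γ.Edge := Quot.mk _ d

/-- The group of flows. -/
def Flow (Γ : Graph) : AddSubgroup (Γ.D → ℤ) where
  carrier := {s | ∀ d, s (Γ.rev d) = -s d}
  add_mem' := fun hs ht d => by
    rw [Pi.add_apply, Pi.add_apply, hs d, ht d]; ring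
  zero_mem' := fun _ => by simp
  neg_mem' := fun hs d => by rw [Pi.neg_apply, Pi.neg_apply, hs d]

open Classical in
/-- The divisor of a flow: at a vertex `v`, the sum of the values on the oriented edges
towards `v`. -/
def div (Γ : Graph) : Γ.Flow →+ (Γ.V → ℤ) where
  toFun s v := ∑ d with Γ.tgt d = v, s.1 d
  map_zero' := by ext v; simp
  map_add' s t := by ext v; simp [Finset.sum_add_distrib]

/-- The first homology group, as a subgroup of the group of flows. -/
def H1 (Γ : Graph) : AddSubgroup Γ.Flow := Γ.div.ker

/-- The intersection pairing of flows for real edge lengths. -/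
def pairing (Γ : Graph) (s t : Γ.Flow) (l : Γ.Edge → ℝ) : ℝ :=
  (1 / 2) * ∑ d, (s.1 d : ℝ) * (t.1 d : ℝ) * l (Γ.edge d)

/-- A flow is acyclic if there are no oriented cycles after contracting the edges with `s = 0`, for
the orientation with `s > 0`; that is, no edge with `s > 0` lies on a closed path of edges
with `s ≥ 0`. -/
def Acyclic (Γ : Graph) (s : Γ.Flow) : Prop :=
  ∀ d, 0 < s.1 d → ¬ Relation.ReflTransGen
    (fun a b => ∃ d', 0 ≤ s.1 d' ∧ Γ.src d' = a ∧ Γ.tgt d' = b) (Γ.tgt d) (Γ.src d)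

/-- A list of oriented edges is a path from `v` to `w`. -/
def IsPath (Γ : Graph) : List Γ.D → Γ.V → Γ.V → Prop
  | [], v, w => v = w
  | d :: p, v, w => Γ.src d = v ∧ Γ.IsPath p (Γ.tgt d) w

/-- The sum of `s(e) ℓ_e` over an oriented path. -/
def pathSum (Γ : Graph) (s : Γ.Flow) (l : Γ.Edge → ℝ) (p : List Γ.D) : ℝ :=
  (p.map fun d => (s.1 d : ℝ) * l (Γ.edge d)).sum

/-- An edge contraction `Γ → Δ` (up to isomorphism; isomorphisms are the case without contracted
edges).  The oriented edges of `Δ` are identified with the oriented edges of `Γ` that are not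
contracted, and the vertices of `Δ` are the vertices of `Γ` modulo the contracted edges. -/
@[ext] structure Contraction (Γ Δ : Graph) where
  onV : Γ.V → Δ.V
  onD : Δ.D → Γ.D
  onD_inj : Function.Injective onD
  onD_rev : ∀ d, onD (Δ.rev d) = Γ.rev (onD d)
  onV_src : ∀ d, onV (Γ.src (onD d)) = Δ.src d
  onV_surj : Function.Surjective onV
  collapse : ∀ d, d ∉ Set.range onD → onV (Γ.src d) = onV (Γ.tgt d)
  fibre : ∀ v w, onV v = onV w → Relation.ReflTransGen
    (fun a b => ∃ d, d ∉ Set.range onD ∧ Γ.src d = a ∧ Γ.tgt d = b) v w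
  onV_legs : Γ.legs.map onV = Δ.legs

namespace Contraction

variable {Γ Δ Θ : Graph}

theorem onV_tgt (c : Contraction Γ Δ) (d : Δ.D) : c.onV (Γ.tgt (c.onD d)) = Δ.tgt d := by
  rw [tgt, ← c.onD_rev, c.onV_src]; rfl

/-- The identity contraction. -/
def id (Γ : Graph) : Contraction Γ Γ where
  onV v := v
  onD d := d
  onD_inj _ _ h := h
  onD_rev _ := rfl
  onV_src _ := rfl
  onV_surj v := ⟨v, rfl⟩
  collapse d h := absurd ⟨d, rfl⟩ h
  fibre v w h := by cases h; exact .refl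
  onV_legs := List.map_id _

/-- Paths of edges contracted by `c'` lift along `c`. -/
theorem lift_path (c : Contraction Γ Δ) (c' : Contraction Δ Θ) {x y : Δ.V}
    (h : Relation.ReflTransGen
      (fun a b => ∃ d, d ∉ Set.range c'.onD ∧ Δ.src d = a ∧ Δ.tgt d = b) x y) :
    ∀ v w, c.onV v = x → c.onV w = y → Relation.ReflTransGen
      (fun a b => ∃ d, d ∉ Set.range (fun t => c.onD (c'.onD t)) ∧ Γ.src d = a ∧ Γ.tgt d = b)
      v w := by
  have key : ∀ v w, c.onV v = c.onV w → Relation.ReflTransGen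
      (fun a b => ∃ d, d ∉ Set.range (fun t => c.onD (c'.onD t)) ∧ Γ.src d = a ∧ Γ.tgt d = b)
      v w := by
    intro v w hvw
    refine Relation.ReflTransGen.mono ?_ _ _ (c.fibre v w hvw)
    rintro a b ⟨d, hd, h1, h2⟩
    exact ⟨d, fun ⟨t, ht⟩ => hd ⟨_, ht⟩, h1, h2⟩
  induction h with
  | refl => intro v w hv hw; exact key v w (hv.trans hw.symm)
  | tail _ hstep ih =>
    obtain ⟨d, hd, h1, h2⟩ := hstep
    intro v w hv hw
    refine ((ih v (Γ.src (c.onD d)) hv ((c.onV_src d).trans h1)).tail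
      ⟨c.onD d, ?_, rfl, rfl⟩).trans (key _ _ ?_)
    · rintro ⟨t, ht⟩
      exact hd ⟨t, c.onD_inj ht⟩
    · rw [c.onV_tgt, h2, hw]

/-- The composition of contractions. -/
def comp (c : Contraction Γ Δ) (c' : Contraction Δ Θ) : Contraction Γ Θ where
  onV v := c'.onV (c.onV v)
  onD d := c.onD (c'.onD d)
  onD_inj _ _ h := c'.onD_inj (c.onD_inj h)
  onD_rev d := by rw [c'.onD_rev, c.onD_rev]
  onV_src d := by rw [c.onV_src, c'.onV_src]
  onV_surj := c'.onV_surj.comp c.onV_surj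
  collapse d h := by
    by_cases hd : d ∈ Set.range c.onD
    · obtain ⟨t, rfl⟩ := hd
      rw [c.onV_src, c.onV_tgt]
      exact c'.collapse t fun ⟨r, hr⟩ => h ⟨r, by rw [← hr]⟩
    · rw [c.collapse d hd]
  fibre v w h := lift_path c c' (c'.fibre _ _ h) v w rfl rfl
  onV_legs := by rw [← c'.onV_legs, ← c.onV_legs, List.map_map]; rfl

/-- The inclusion `E(Δ) ⊆ E(Γ)`. -/
def onE (c : Contraction Γ Δ) : Δ.Edge → Γ.Edge :=
  Quot.lift (fun d => Γ.edge (c.onD d)) fun d d' h => by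
    subst h
    rw [c.onD_rev]
    exact Quot.sound rfl

theorem onE_edge (c : Contraction Γ Δ) (d : Δ.D) : c.onE (Δ.edge d) = Γ.edge (c.onD d) := rfl

theorem edge_eq {d d' : Γ.D} (h : Γ.edge d = Γ.edge d') : d = d' ∨ d' = Γ.rev d := by
  have h' := Quot.eqvGen_exact h
  clear h
  induction h' with
  | rel x y h => exact .inr h
  | refl => exact .inl rfl
  | symm x y _ ih =>
    rcases ih with h | h
    · exact .inl h.symm
    · exact .inr (by rw [h, Γ.rev_rev])
  | trans x y z _ _ ih1 ih2 =>
    rcases ih1 with h1 | h1 <;> rcases ih2 with h2 | h2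
    · exact .inl (h1.trans h2)
    · exact .inr (by rw [h2, h1])
    · exact .inr (by rw [← h2, h1])
    · exact .inl (by rw [h2, h1, Γ.rev_rev])

theorem onE_inj (c : Contraction Γ Δ) : Function.Injective c.onE := by
  intro x y
  induction x using Quot.ind with | _ d =>
  induction y using Quot.ind with | _ d' =>
  intro h
  rcases edge_eq (h : Γ.edge (c.onD d) = Γ.edge (c.onD d')) with h | h
  · rw [c.onD_inj h]
  · rw [← c.onD_rev] at h
    exact Quot.sound (c.onD_inj h)

theorem edge_mem_range (c : Contraction Γ Δ) {d : Γ.D} :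
    Γ.edge d ∈ Set.range c.onE ↔ d ∈ Set.range c.onD := by
  constructor
  · rintro ⟨x, hx⟩
    induction x using Quot.ind with | _ d' =>
    rcases edge_eq (hx : Γ.edge (c.onD d') = Γ.edge d) with h | h
    · exact ⟨d', h⟩
    · exact ⟨Δ.rev d', by rw [c.onD_rev, h]⟩
  · rintro ⟨d', rfl⟩
    exact ⟨Δ.edge d', rfl⟩

theorem onE_id (e : Γ.Edge) : (Contraction.id Γ).onE e = e := by
  induction e using Quot.ind with | _ d => rfl

theorem onE_comp (c : Contraction Γ Δ) (c' : Contraction Δ Θ) (e : Θ.Edge) :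
    (c.comp c').onE e = c.onE (c'.onE e) := by
  induction e using Quot.ind with | _ d => rfl

/-- Specialization of flows along an edge contraction. -/
def flow (c : Contraction Γ Δ) (s : Γ.Flow) : Δ.Flow :=
  ⟨fun d => s.1 (c.onD d), fun d => by
    have h : s.1 (c.onD (Δ.rev d)) = s.1 (Γ.rev (c.onD d)) := by rw [c.onD_rev]
    exact h.trans (s.2 (c.onD d))⟩

/-- The edge lengths on `Γ` obtained from edge lengths on `Δ` by giving length zero to the
contracted edges. -/
def lengths (c : Contraction Γ Δ) : (Δ.Edge → ℝ) →ₗ[ℝ] (Γ.Edge → ℝ) := extendZero c.onE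

theorem lengths_onD (c : Contraction Γ Δ) (l : Δ.Edge → ℝ) (d : Δ.D) :
    c.lengths l (Γ.edge (c.onD d)) = l (Δ.edge d) := extendZero_apply c.onE_inj l (Δ.edge d)

theorem lengths_contracted (c : Contraction Γ Δ) (l : Δ.Edge → ℝ) {d : Γ.D}
    (h : d ∉ Set.range c.onD) : c.lengths l (Γ.edge d) = 0 :=
  extendZero_apply' l fun h' => h (c.edge_mem_range.1 h')

open Classical in
theorem flow_mem_H1 (c : Contraction Γ Δ) {g : Γ.Flow} (hg : g ∈ Γ.H1) : c.flow g ∈ Δ.H1 := by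
  have hg' : ∀ v, ∑ d with Γ.tgt d = v, g.1 d = 0 := fun v => congrFun hg v
  change Δ.div (c.flow g) = 0
  ext w
  change ∑ d with Δ.tgt d = w, g.1 (c.onD d) = 0
  have h1 : ∑ d with c.onV (Γ.tgt d) = w, g.1 d = 0 := by
    have := Finset.sum_fiberwise_of_maps_to (s := Finset.univ.filter fun d => c.onV (Γ.tgt d) = w)
      (t := Finset.univ.filter fun v => c.onV v = w) (g := Γ.tgt)
      (by simp) (fun d => g.1 d)
    rw [← this]
    refine Finset.sum_eq_zero fun v hv => ?_
    rw [Finset.filter_filter, ← hg' v]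
    refine Finset.sum_congr (Finset.filter_congr fun d _ => ?_) fun _ _ => rfl
    rw [Finset.mem_filter] at hv
    constructor
    · exact fun h => h.2
    · exact fun h => ⟨by rw [h, hv.2], h⟩
  have h2 : ∑ d with (c.onV (Γ.tgt d) = w ∧ d ∉ Set.range c.onD), g.1 d = 0 := by
    refine Finset.sum_involution (fun d _ => Γ.rev d) ?_ ?_ ?_ ?_
    · intro d _
      rw [g.2 d, add_neg_cancel]
    · intro d _ _
      exact Γ.rev_ne d
    · intro d hd
      rw [Finset.mem_filter] at hd ⊢
      have hr : Γ.rev d ∉ Set.range c.onD := by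
        rintro ⟨t, ht⟩
        exact hd.2.2 ⟨Δ.rev t, by rw [c.onD_rev, ht, Γ.rev_rev]⟩
      refine ⟨Finset.mem_univ _, ?_, hr⟩
      have : Γ.tgt (Γ.rev d) = Γ.src d := congrArg Γ.src (Γ.rev_rev d)
      rw [this, c.collapse d hd.2.2, hd.2.1]
    · intro d _
      exact Γ.rev_rev d
  have h3 : ∑ d with (c.onV (Γ.tgt d) = w ∧ d ∈ Set.range c.onD), g.1 d =
      ∑ d with Δ.tgt d = w, g.1 (c.onD d) := by
    symm
    refine Finset.sum_bij (fun d _ => c.onD d) ?_ (fun _ _ _ _ h => c.onD_inj h) ?_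
      fun _ _ => rfl
    · intro d hd
      rw [Finset.mem_filter] at hd ⊢
      exact ⟨Finset.mem_univ _, by rw [c.onV_tgt, hd.2], d, rfl⟩
    · intro d hd
      rw [Finset.mem_filter] at hd
      obtain ⟨_, h, t, rfl⟩ := hd
      exact ⟨t, by rw [Finset.mem_filter]; exact ⟨Finset.mem_univ _, by rw [← c.onV_tgt, h]⟩, rfl⟩
  have h4 := Finset.sum_filter_add_sum_filter_not
    (Finset.univ.filter fun d => c.onV (Γ.tgt d) = w) (fun d => d ∈ Set.range c.onD) fun d => g.1 d
  rw [Finset.filter_filter, Finset.filter_filter, h2, add_zero, h1, h3] at h4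
  exact h4

theorem pairing_lengths (c : Contraction Γ Δ) (s t : Γ.Flow) (l : Δ.Edge → ℝ) :
    Γ.pairing s t (c.lengths l) = Δ.pairing (c.flow s) (c.flow t) l := by
  rw [pairing, pairing]
  congr 1
  symm
  refine Fintype.sum_of_injective c.onD c.onD_inj _ _ ?_ ?_
  · intro d hd
    rw [c.lengths_contracted l hd, mul_zero]
  · intro d
    rw [c.lengths_onD]
    rfl

theorem exists_path (c : Contraction Γ Δ) (s : Γ.Flow) (l : Δ.Edge → ℝ) (p : List Γ.D) :
    ∀ {v w}, Γ.IsPath p v w → ∃ q, Δ.IsPath q (c.onV v) (c.onV w) ∧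
      Δ.pathSum (c.flow s) l q = Γ.pathSum s (c.lengths l) p := by
  induction p with
  | nil => rintro v w ⟨⟩; exact ⟨[], rfl, rfl⟩
  | cons d p ih =>
    rintro v w ⟨rfl, hp⟩
    obtain ⟨q, hq, hs⟩ := ih hp
    by_cases hd : d ∈ Set.range c.onD
    · obtain ⟨t, rfl⟩ := hd
      refine ⟨t :: q, ⟨(c.onV_src t).symm, by rwa [c.onV_tgt] at hq⟩, ?_⟩
      simp only [pathSum, List.map_cons, List.sum_cons] at hs ⊢
      rw [hs, c.lengths_onD]
      rfl
    · refine ⟨q, by rwa [c.collapse d hd], ?_⟩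
      simp only [pathSum, List.map_cons, List.sum_cons] at hs ⊢
      rw [hs, c.lengths_contracted l hd, mul_zero, zero_add]

end Contraction

theorem pairing_add (Γ : Graph) (s t : Γ.Flow) (l l' : Γ.Edge → ℝ) :
    Γ.pairing s t (l + l') = Γ.pairing s t l + Γ.pairing s t l' := by
  simp only [pairing, Pi.add_apply, mul_add, Finset.sum_add_distrib]

theorem pairing_smul (Γ : Graph) (s t : Γ.Flow) (r : ℝ) (l : Γ.Edge → ℝ) :
    Γ.pairing s t (r • l) = r * Γ.pairing s t l := by
  simp only [pairing, Pi.smul_apply, smul_eq_mul, Finset.mul_sum]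
  exact Finset.sum_congr rfl fun _ _ => by ring

theorem pathSum_add (Γ : Graph) (s : Γ.Flow) (l l' : Γ.Edge → ℝ) (p : List Γ.D) :
    Γ.pathSum s (l + l') p = Γ.pathSum s l p + Γ.pathSum s l' p := by
  simp only [pathSum, Pi.add_apply, mul_add, List.sum_map_add]

theorem pathSum_smul (Γ : Graph) (s : Γ.Flow) (r : ℝ) (l : Γ.Edge → ℝ) (p : List Γ.D) :
    Γ.pathSum s (r • l) p = r * Γ.pathSum s l p := by
  simp only [pathSum, Pi.smul_apply, smul_eq_mul, ← List.sum_map_mul_left]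
  congr 1
  exact List.map_congr_left fun _ _ => by ring

end Graph

/-! ## The cone stack of graphs with an acyclic flow -/

/-- A graph with an acyclic flow. -/
structure CombDiv : Type 1 where
  Γ : Graph
  s : Γ.Flow
  acyclic : Γ.Acyclic s

/-- An edge contraction compatible with the flows. -/
@[ext] structure CombDiv.Hom (x y : CombDiv) where
  c : Graph.Contraction x.Γ y.Γ
  flow : c.flow x.s = y.s

instance : Category CombDiv where
  Hom x y := CombDiv.Hom x y
  id x := ⟨Graph.Contraction.id x.Γ, rfl⟩
  comp f g := ⟨f.c.comp g.c, by rw [← g.flow, ← f.flow]; rfl⟩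

/-- The cone of all `ℓ ∈ ℝ≥0^E(Γ)` with `⟨s, γ⟩_ℓ = 0` for all `γ ∈ H₁(Γ)`, with the integral
structure of `ℤ^E(Γ)`. -/
def CombDiv.cone (x : CombDiv) : Cone where
  V := x.Γ.Edge → ℝ
  cone :=
    { carrier := {l | (∀ e, 0 ≤ l e) ∧ ∀ g ∈ x.Γ.H1, x.Γ.pairing x.s g l = 0}
      add_mem' := fun {l l'} h h' => ⟨fun e => add_nonneg (h.1 e) (h'.1 e), fun g hg => by
        rw [Graph.pairing_add, h.2 g hg, h'.2 g hg, add_zero]⟩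
      zero_mem' := ⟨fun _ => le_refl _, fun g _ => by simp [Graph.pairing]⟩
      smul_mem' := fun r l h => ⟨fun e => mul_nonneg r.2 (h.1 e), fun g hg => by
        have := Graph.pairing_smul x.Γ x.s g r.1 l
        rw [h.2 g hg, mul_zero] at this
        exact this⟩ }
  lattice := intLattice x.Γ.Edge

theorem CombDiv.lengths_mem {x y : CombDiv} (f : CombDiv.Hom x y) (l : y.Γ.Edge → ℝ)
    (hl : l ∈ y.cone.cone) : f.c.lengths l ∈ x.cone.cone := by
  refine ⟨extendZero_nonneg f.c.onE_inj hl.1, fun g hg => ?_⟩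
  rw [f.c.pairing_lengths, f.flow]
  exact hl.2 _ (f.c.flow_mem_H1 hg)

/-- The diagram of the cones `σ_(Γ,s)`; a contraction induces the inclusion of the locus where the
contracted edges have length zero. -/
def CombDiv.cones : CombDivᵒᵖ ⥤ Cone where
  obj x := x.unop.cone
  map f := Cone.homOfLinear (C := CombDiv.cone _) (D := CombDiv.cone _)
    (Graph.Contraction.lengths (CombDiv.Hom.c f.unop)) (CombDiv.lengths_mem f.unop)
    fun _ h => extendZero_int (Graph.Contraction.onE_inj _) h
  map_id _ := Cone.homOfLinear_id fun l => extendZero_id Graph.Contraction.onE_id l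
  map_comp f g := Cone.homOfLinear_comp fun l =>
    extendZero_comp (Graph.Contraction.onE_inj _) (Graph.Contraction.onE_inj _)
      (Graph.Contraction.onE_comp (CombDiv.Hom.c g.unop) (CombDiv.Hom.c f.unop)) l

/-! ## The cone stack of graphs with an ordering -/

/-- A graph with an acyclic flow and an ordering extending it.  Different vertices may have the
same position in the ordering, so it is a total preorder: it is strictly increasing along edges
with `s > 0`, and the end points of contracted edges have the same position. -/
structure CombOrd : Type 1 where
  base : CombDiv
  le : base.Γ.V → base.Γ.V → Prop
  le_trans : ∀ u v w, le u v → le v w → le u w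
  le_total : ∀ v w, le v w ∨ le w v
  flow_pos : ∀ d, 0 < base.s.1 d →
    le (base.Γ.src d) (base.Γ.tgt d) ∧ ¬ le (base.Γ.tgt d) (base.Γ.src d)
  flow_zero : ∀ d, base.s.1 d = 0 → le (base.Γ.src d) (base.Γ.tgt d)

/-- An edge contraction compatible with the flows and the orderings. -/
@[ext] structure CombOrd.Hom (x y : CombOrd) where
  base : x.base ⟶ y.base
  mono : ∀ v w, x.le v w → y.le (base.c.onV v) (base.c.onV w)

instance : Category CombOrd where
  Hom x y := CombOrd.Hom x y
  id x := ⟨𝟙 x.base, fun _ _ h => h⟩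
  comp f g := ⟨f.base ≫ g.base, fun v w h => g.mono _ _ (f.mono v w h)⟩

/-- The inequalities defining the cone of an ordering: for a minimal vertex `v₀`, the values
at `w` and `w'` of the function with slopes `s` starting at `v₀` satisfy the inequality
prescribed by the ordering. -/
def CombOrd.Inequalities (x : CombOrd) (l : x.base.Γ.Edge → ℝ) : Prop :=
  ∀ v₀, (∀ u, x.le v₀ u) → ∀ w w' p q, x.base.Γ.IsPath p v₀ w → x.base.Γ.IsPath q v₀ w' →
    x.le w w' → x.base.Γ.pathSum x.base.s l p ≤ x.base.Γ.pathSum x.base.s l q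

/-- The cone of all `ℓ` in the cone of the flow satisfying the inequalities of the ordering. -/
def CombOrd.cone (x : CombOrd) : Cone where
  V := x.base.Γ.Edge → ℝ
  cone :=
    { carrier := {l | l ∈ x.base.cone.cone ∧ x.Inequalities l}
      add_mem' := fun {l l'} h h' => ⟨add_mem h.1 h'.1, fun v₀ hv w w' p p' hp hp' hw => by
        rw [Graph.pathSum_add, Graph.pathSum_add]
        exact add_le_add (h.2 v₀ hv w w' p p' hp hp' hw) (h'.2 v₀ hv w w' p p' hp hp' hw)⟩
      zero_mem' := ⟨zero_mem x.base.cone.cone, fun v₀ hv w w' p p' hp hp' hw => by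
        simp [Graph.pathSum]⟩
      smul_mem' := fun r l h => ⟨x.base.cone.cone.smul_mem r.2 h.1,
        fun v₀ hv w w' p p' hp hp' hw => by
          have := mul_le_mul_of_nonneg_left (h.2 v₀ hv w w' p p' hp hp' hw) r.2
          rw [← Graph.pathSum_smul, ← Graph.pathSum_smul] at this
          exact this⟩ }
  lattice := intLattice x.base.Γ.Edge

theorem CombOrd.lengths_mem {x y : CombOrd} (f : CombOrd.Hom x y) (l : y.base.Γ.Edge → ℝ)
    (hl : l ∈ y.cone.cone) : (CombDiv.Hom.c f.base).lengths l ∈ x.cone.cone := by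
  refine ⟨CombDiv.lengths_mem f.base l hl.1, fun v₀ hv w w' p p' hp hp' hw => ?_⟩
  obtain ⟨q, hq, h⟩ := f.base.c.exists_path x.base.s l p hp
  obtain ⟨q', hq', h'⟩ := f.base.c.exists_path x.base.s l p' hp'
  rw [f.base.flow] at h h'
  rw [← h, ← h']
  refine hl.2 _ (fun u => ?_) _ _ q q' hq hq' (f.mono _ _ hw)
  obtain ⟨u, rfl⟩ := f.base.c.onV_surj u
  exact f.mono _ _ (hv u)

/-- The diagram of the cones `σ_(Γ,s,κ)`. -/
def CombOrd.cones : CombOrdᵒᵖ ⥤ Cone where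
  obj x := x.unop.cone
  map f := Cone.homOfLinear (C := CombOrd.cone _) (D := CombOrd.cone _)
    (Graph.Contraction.lengths (CombDiv.Hom.c (CombOrd.Hom.base f.unop)))
    (CombOrd.lengths_mem f.unop)
    fun _ h => extendZero_int (Graph.Contraction.onE_inj _) h
  map_id _ := Cone.homOfLinear_id fun l => extendZero_id Graph.Contraction.onE_id l
  map_comp f g := Cone.homOfLinear_comp fun l =>
    extendZero_comp (Graph.Contraction.onE_inj _) (Graph.Contraction.onE_inj _)
      (Graph.Contraction.onE_comp (CombDiv.Hom.c (CombOrd.Hom.base g.unop))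
        (CombDiv.Hom.c (CombOrd.Hom.base f.unop))) l

/-! ## Subdivisions and equidimensional lifts -/

/-- `Γ'` is a subdivision of `Γ`: vertices of `Γ` are vertices of `Γ'`, and every oriented edge
of `Γ'` lies on an oriented edge of `Γ`.  Near a vertex of `Γ` nothing changes; a vertex of `Γ'`
which is not a vertex of `Γ` (an exceptional vertex) is an interior point of an edge of `Γ`: exactly
two oriented edges leave it, along the two orientations of that edge.  (As `Γ'` is
connected, the oriented edges of `Γ'` over `d` form a path from the start of `d` to its end.) -/
structure Subdivision (Γ' Γ : Graph) where
  ι : Γ.V → Γ'.V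
  ι_inj : Function.Injective ι
  π : Γ'.D → Γ.D
  π_rev : ∀ d, π (Γ'.rev d) = Γ.rev (π d)
  star : ∀ v, Set.BijOn π {d | Γ'.src d = ι v} {d | Γ.src d = v}
  exceptional : ∀ v, v ∉ Set.range ι → ∃ d₁ d₂, d₁ ≠ d₂ ∧ {d | Γ'.src d = v} = {d₁, d₂} ∧
    π d₂ = Γ.rev (π d₁)
  legs : Γ.legs.map ι = Γ'.legs

/-- The pullback of a flow to a subdivision. -/
def Subdivision.flow {Γ' Γ : Graph} (S : Subdivision Γ' Γ) (s : Γ.Flow) : Γ'.Flow :=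
  ⟨fun d => s.1 (S.π d), fun d => by
    have h : s.1 (S.π (Γ'.rev d)) = s.1 (Γ.rev (S.π d)) := by rw [S.π_rev]
    exact h.trans (s.2 (S.π d))⟩

/-- A stable equidimensional map from a subdivision `Γ'` of `Γ` to a combinatorial line `X` with
vertices `0 < 1 < ⋯ < k` and edges `f_i` from `i` to `i + 1`: vertices map to vertices, and edges
map into a vertex or an edge.  Stability means that every vertex of `X` is the image of a vertex
of `Γ`, and that `Γ'` is minimal, so that edges of `Γ` mapping to a vertex of `X` are not
subdivided. -/
structure EquidimLift (Γ : Graph) : Type 1 where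
  Γ' : Graph
  sub : Subdivision Γ' Γ
  k : ℕ
  β : Γ'.V → Fin (k + 1)
  cell : ∀ d, (β (Γ'.tgt d) : ℕ) ≤ β (Γ'.src d) + 1
  stable : ∀ i, ∃ v, β (sub.ι v) = i
  minimal : ∀ d₁ d₂, sub.π d₁ = sub.π d₂ → β (Γ'.src d₁) = β (Γ'.tgt d₁) → d₁ = d₂

/-- A contraction of the combinatorial line with `k` edges onto the one with `m` edges. -/
@[ext] structure LineContraction (k m : ℕ) where
  onV : Fin (k + 1) → Fin (m + 1)
  onE : Fin m → Fin k
  onV_mono : Monotone onV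
  onV_surj : Function.Surjective onV
  onV_castSucc : ∀ j, onV (onE j).castSucc = j.castSucc
  onV_succ : ∀ j, onV (onE j).succ = j.succ
  collapse : ∀ i, i ∉ Set.range onE → onV i.castSucc = onV i.succ

namespace LineContraction

/-- The identity. -/
def id (k : ℕ) : LineContraction k k where
  onV i := i
  onE j := j
  onV_mono := monotone_id
  onV_surj i := ⟨i, rfl⟩
  onV_castSucc _ := rfl
  onV_succ _ := rfl
  collapse i h := absurd ⟨i, rfl⟩ h

/-- The composition. -/
def comp {k m n : ℕ} (q : LineContraction k m) (q' : LineContraction m n) :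
    LineContraction k n where
  onV i := q'.onV (q.onV i)
  onE j := q.onE (q'.onE j)
  onV_mono := q'.onV_mono.comp q.onV_mono
  onV_surj := q'.onV_surj.comp q.onV_surj
  onV_castSucc j := by rw [q.onV_castSucc, q'.onV_castSucc]
  onV_succ j := by rw [q.onV_succ, q'.onV_succ]
  collapse i h := by
    by_cases hi : i ∈ Set.range q.onE
    · obtain ⟨j, rfl⟩ := hi
      rw [q.onV_castSucc, q.onV_succ]
      exact q'.collapse j fun ⟨r, hr⟩ => h ⟨r, by rw [← hr]⟩
    · rw [q.collapse i hi]

theorem onE_inj {k m : ℕ} (q : LineContraction k m) : Function.Injective q.onE := by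
  intro i j h
  have h1 := q.onV_castSucc i
  rw [h, q.onV_castSucc j] at h1
  exact (Fin.castSucc_injective m h1).symm

end LineContraction

/-- A morphism of equidimensional lifts over an edge contraction: compatible contractions
of the subdivision and of the line. -/
@[ext] structure EquidimLift.Hom {Γ Δ : Graph} (c : Graph.Contraction Γ Δ) (A : EquidimLift Γ)
    (B : EquidimLift Δ) where
  c' : Graph.Contraction A.Γ' B.Γ'
  q : LineContraction A.k B.k
  onV_ι : ∀ v, c'.onV (A.sub.ι v) = B.sub.ι (c.onV v)
  π_onD : ∀ d, A.sub.π (c'.onD d) = c.onD (B.sub.π d)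
  β_onV : ∀ v, B.β (c'.onV v) = q.onV (A.β v)

/-- The identity of an equidimensional lift. -/
def EquidimLift.Hom.id {Γ : Graph} (A : EquidimLift Γ) :
    EquidimLift.Hom (Graph.Contraction.id Γ) A A where
  c' := Graph.Contraction.id A.Γ'
  q := LineContraction.id A.k
  onV_ι _ := rfl
  π_onD _ := rfl
  β_onV _ := rfl

/-- The composition of morphisms of equidimensional lifts. -/
def EquidimLift.Hom.comp {Γ Δ Θ : Graph} {c : Graph.Contraction Γ Δ} {c₁ : Graph.Contraction Δ Θ}
    {A : EquidimLift Γ} {B : EquidimLift Δ} {C : EquidimLift Θ} (f : EquidimLift.Hom c A B)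
    (g : EquidimLift.Hom c₁ B C) : EquidimLift.Hom (c.comp c₁) A C where
  c' := f.c'.comp g.c'
  q := f.q.comp g.q
  onV_ι v := (congrArg g.c'.onV (f.onV_ι v)).trans (g.onV_ι _)
  π_onD d := (f.π_onD _).trans (congrArg c.onD (g.π_onD d))
  β_onV v := (g.β_onV _).trans (congrArg g.q.onV (f.β_onV v))

/-! ## The cone stack of graphs with an equidimensional lift -/

/-- A graph with an acyclic flow and a stable equidimensional lift extending the flow: on the
subdivision, the map to the line is strictly increasing along edges with `s > 0` and constant on
contracted edges. -/
structure CombRub : Type 1 where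
  base : CombDiv
  lift : EquidimLift base.Γ
  flow_pos : ∀ d, 0 < (lift.sub.flow base.s).1 d →
    lift.β (lift.Γ'.src d) < lift.β (lift.Γ'.tgt d)
  flow_zero : ∀ d, (lift.sub.flow base.s).1 d = 0 →
    lift.β (lift.Γ'.src d) = lift.β (lift.Γ'.tgt d)

/-- An edge contraction compatible with the flows and the equidimensional lifts. -/
@[ext] structure CombRub.Hom (x y : CombRub) where
  base : x.base ⟶ y.base
  lift : EquidimLift.Hom base.c x.lift y.lift

instance : Category CombRub where
  Hom x y := CombRub.Hom x y
  id x := ⟨𝟙 x.base, EquidimLift.Hom.id x.lift⟩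
  comp f g := ⟨f.base ≫ g.base, f.lift.comp g.lift⟩

/-- The equations `s(e) ℓ_e = ℓ_f` for every edge `e` of the subdivision mapping onto an edge `f` of
the line. -/
def CombRub.Equations (x : CombRub) (l : (x.lift.Γ'.Edge → ℝ) × (Fin x.lift.k → ℝ)) : Prop :=
  ∀ (d : x.lift.Γ'.D) (i : Fin x.lift.k), x.lift.β (x.lift.Γ'.src d) = i.castSucc →
    x.lift.β (x.lift.Γ'.tgt d) = i.succ →
    ((x.lift.sub.flow x.base.s).1 d : ℝ) * l.1 (x.lift.Γ'.edge d) = l.2 i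

/-- The cone in `ℝ≥0^E(Γ') × ℝ≥0^E(X)` defined by the equations `s(e) ℓ_e = ℓ_f`. -/
def CombRub.cone (x : CombRub) : Cone where
  V := (x.lift.Γ'.Edge → ℝ) × (Fin x.lift.k → ℝ)
  cone :=
    { carrier := {l | (∀ e, 0 ≤ l.1 e) ∧ (∀ i, 0 ≤ l.2 i) ∧ x.Equations l}
      add_mem' := fun {l l'} h h' => ⟨fun e => add_nonneg (h.1 e) (h'.1 e),
        fun i => add_nonneg (h.2.1 i) (h'.2.1 i), fun d i h1 h2 => by
          have e1 := h.2.2 d i h1 h2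
          have e2 := h'.2.2 d i h1 h2
          change _ * (l.1 _ + l'.1 _) = l.2 i + l'.2 i
          rw [mul_add, e1, e2]⟩
      zero_mem' := ⟨fun _ => le_refl _, fun _ => le_refl _, fun d i _ _ => by simp⟩
      smul_mem' := fun r l h => ⟨fun e => mul_nonneg r.2 (h.1 e),
        fun i => mul_nonneg r.2 (h.2.1 i), fun d i h1 h2 => by
          have e1 := h.2.2 d i h1 h2
          change _ * (r.1 * l.1 _) = r.1 * l.2 i
          rw [← e1]; ring⟩ }
  lattice := (intLattice x.lift.Γ'.Edge).prod (intLattice (Fin x.lift.k))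

/-- The lengths obtained by giving length zero to the contracted edges. -/
def CombRub.lengths {x y : CombRub} (f : CombRub.Hom x y) :
    ((y.lift.Γ'.Edge → ℝ) × (Fin y.lift.k → ℝ)) →ₗ[ℝ]
      ((x.lift.Γ'.Edge → ℝ) × (Fin x.lift.k → ℝ)) :=
  LinearMap.prodMap f.lift.c'.lengths (extendZero f.lift.q.onE)

theorem CombRub.flow_eq_zero (x : CombRub) {d : x.lift.Γ'.D}
    (h : x.lift.β (x.lift.Γ'.src d) = x.lift.β (x.lift.Γ'.tgt d)) :
    (x.lift.sub.flow x.base.s).1 d = 0 := by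
  rcases lt_trichotomy ((x.lift.sub.flow x.base.s).1 d) 0 with h0 | h0 | h0
  · have h1 := x.flow_pos (x.lift.Γ'.rev d) (by
      rw [(x.lift.sub.flow x.base.s).2 d]; exact neg_pos.2 h0)
    have h2 : x.lift.Γ'.tgt (x.lift.Γ'.rev d) = x.lift.Γ'.src d :=
      congrArg x.lift.Γ'.src (x.lift.Γ'.rev_rev d)
    rw [h2] at h1
    exact absurd h (ne_of_gt h1)
  · exact h0
  · exact absurd h (ne_of_lt (x.flow_pos d h0))

theorem CombRub.lengths_mem {x y : CombRub} (f : CombRub.Hom x y)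
    (l : (y.lift.Γ'.Edge → ℝ) × (Fin y.lift.k → ℝ)) (hl : l ∈ y.cone.cone) :
    CombRub.lengths f l ∈ x.cone.cone := by
  refine ⟨extendZero_nonneg f.lift.c'.onE_inj hl.1, extendZero_nonneg f.lift.q.onE_inj hl.2.1,
    fun d i h1 h2 => ?_⟩
  change _ * f.lift.c'.lengths l.1 (x.lift.Γ'.edge d) = extendZero f.lift.q.onE l.2 i
  by_cases hd : d ∈ Set.range f.lift.c'.onD
  · obtain ⟨t, rfl⟩ := hd
    have e1 := f.lift.β_onV (x.lift.Γ'.src (f.lift.c'.onD t))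
    have e2 := f.lift.β_onV (x.lift.Γ'.tgt (f.lift.c'.onD t))
    rw [f.lift.c'.onV_src, h1] at e1
    rw [f.lift.c'.onV_tgt, h2] at e2
    have hs : (x.lift.sub.flow x.base.s).1 (f.lift.c'.onD t) = (y.lift.sub.flow y.base.s).1 t := by
      rw [← f.base.flow]
      exact congrArg x.base.s.1 (f.lift.π_onD t)
    rw [hs, f.lift.c'.lengths_onD]
    by_cases hi : i ∈ Set.range f.lift.q.onE
    · obtain ⟨j, rfl⟩ := hi
      rw [extendZero_apply f.lift.q.onE_inj]
      exact hl.2.2 t j (e1.trans (f.lift.q.onV_castSucc j)) (e2.trans (f.lift.q.onV_succ j))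
    · rw [extendZero_apply' _ hi, y.flow_eq_zero (by rw [e1, e2, f.lift.q.collapse i hi])]
      simp
  · have hi : i ∉ Set.range f.lift.q.onE := by
      rintro ⟨j, rfl⟩
      have e1 := f.lift.β_onV (x.lift.Γ'.src d)
      rw [f.lift.c'.collapse d hd, f.lift.β_onV, h1, h2, f.lift.q.onV_castSucc,
        f.lift.q.onV_succ] at e1
      exact absurd e1.symm (ne_of_lt (Fin.castSucc_lt_succ))
    rw [f.lift.c'.lengths_contracted _ hd, extendZero_apply' _ hi, mul_zero]

/-- The diagram of the cones `σ_(Γ,s,Γ' → X)`. -/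
def CombRub.cones : CombRubᵒᵖ ⥤ Cone where
  obj x := x.unop.cone
  map f := Cone.homOfLinear (C := CombRub.cone _) (D := CombRub.cone _)
    (CombRub.lengths f.unop) (CombRub.lengths_mem f.unop)
    fun _ h => ⟨extendZero_int (Graph.Contraction.onE_inj _) h.1,
      extendZero_int (LineContraction.onE_inj _) h.2⟩
  map_id _ := Cone.homOfLinear_id fun l => Prod.ext
    (extendZero_id Graph.Contraction.onE_id l.1) (extendZero_id (fun _ => rfl) l.2)
  map_comp f g := Cone.homOfLinear_comp fun l => Prod.ext
    (extendZero_comp (Graph.Contraction.onE_inj _) (Graph.Contraction.onE_inj _)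
      (Graph.Contraction.onE_comp (CombRub.Hom.lift g.unop).c' (CombRub.Hom.lift f.unop).c') l.1)
    (extendZero_comp (LineContraction.onE_inj _) (LineContraction.onE_inj _) (fun _ => rfl) l.2)

/-! ## Tropical curves with a piecewise linear function -/

/-- A point of `Σ_Div` over a monoid `M`: a tropical curve metrized by `M` and a piecewise linear
function on it which vanishes at the vertex containing the leg. -/
structure SigmaDiv : Type 1 where
  M : Mon
  Γ : Graph
  len : Γ.Edge → M
  len_ne : ∀ e, len e ≠ 0
  α : Γ.V → Gp M
  slope : ∀ d, ∃ n : ℤ, α (Γ.tgt d) - α (Γ.src d) = n • toGp (len (Γ.edge d))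
  root : α Γ.root = 0

/-- A morphism over `φ : M → N`: an identification of the target with the tropical curve (and
function) obtained from the source by applying `φ` to the lengths and the values and contracting
the edges whose length becomes zero.  Over an identity these are the isomorphisms of graphs
which respect the lengths and the functions. -/
@[ext] structure SigmaDiv.Hom (X Y : SigmaDiv) where
  φ : X.M ⟶ Y.M
  c : Graph.Contraction X.Γ Y.Γ
  len_onD : ∀ d, Mon.toHom φ (X.len (X.Γ.edge (c.onD d))) = Y.len (Y.Γ.edge d)
  len_contracted : ∀ d, d ∉ Set.range c.onD → Mon.toHom φ (X.len (X.Γ.edge d)) = 0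
  value : ∀ v, Y.α (c.onV v) = gpMap (Mon.toHom φ) (X.α v)

theorem comp_len_contracted {M N P : Mon} (φ : M ⟶ N) (ψ : N ⟶ P) {Γ Δ Θ : Graph}
    (c : Graph.Contraction Γ Δ) (c₁ : Graph.Contraction Δ Θ) {l : Γ.Edge → M} {l₁ : Δ.Edge → N}
    (h : ∀ d, Mon.toHom φ (l (Γ.edge (c.onD d))) = l₁ (Δ.edge d))
    (h' : ∀ d, d ∉ Set.range c.onD → Mon.toHom φ (l (Γ.edge d)) = 0)
    (h₁ : ∀ d, d ∉ Set.range c₁.onD → Mon.toHom ψ (l₁ (Δ.edge d)) = 0) :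
    ∀ d, d ∉ Set.range (c.comp c₁).onD → Mon.toHom (φ ≫ ψ) (l (Γ.edge d)) = 0 := by
  intro d hd
  change Mon.toHom ψ (Mon.toHom φ _) = 0
  by_cases hc : d ∈ Set.range c.onD
  · obtain ⟨t, rfl⟩ := hc
    rw [h]
    exact h₁ t fun ⟨r, hr⟩ => hd ⟨r, congrArg c.onD hr⟩
  · rw [h' d hc, map_zero]

instance : Category SigmaDiv where
  Hom X Y := SigmaDiv.Hom X Y
  id X :=
    { φ := 𝟙 X.M
      c := Graph.Contraction.id X.Γ
      len_onD := fun _ => rfl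
      len_contracted := fun d h => absurd ⟨d, rfl⟩ h
      value := fun v => (gpMap_id (X.α v)).symm }
  comp f g :=
    { φ := f.φ ≫ g.φ
      c := f.c.comp g.c
      len_onD := fun d => (congrArg (Mon.toHom g.φ) (f.len_onD _)).trans (g.len_onD d)
      len_contracted := comp_len_contracted _ _ _ _ f.len_onD f.len_contracted g.len_contracted
      value := fun v => by
        refine (g.value _).trans ?_
        rw [f.value v]
        exact (gpMap_comp (Mon.toHom g.φ) (Mon.toHom f.φ) _).symm }

/-- The structure morphism of `Σ_Div`: its fibre over `M` is the groupoid `Σ_Div(M)`. -/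
def SigmaDiv.proj : SigmaDiv ⥤ Mon where
  obj X := X.M
  map f := SigmaDiv.Hom.φ f

/-- The values of the piecewise linear function are totally ordered. -/
def SigmaDiv.IsOrdered : ObjectProperty SigmaDiv :=
  fun X => ∀ v w, X.M.GpLE (X.α v) (X.α w) ∨ X.M.GpLE (X.α w) (X.α v)

/-- The stack `Σ_Ord` of tropical curves with a piecewise linear function with totally ordered
values. -/
abbrev SigmaOrd : Type 1 := SigmaDiv.IsOrdered.FullSubcategory

/-- The structure morphism of `Σ_Ord`. -/
def SigmaOrd.proj : SigmaOrd ⥤ Mon := SigmaDiv.IsOrdered.ι ⋙ SigmaDiv.proj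

open Classical in
/-- A point of `Σ_Rub` over a monoid `M`: a point of `Σ_Div`, a stable equidimensional lift, edge
lengths making `Γ'` a subdivision of the tropical curve, and a tropical line with vertices
`ι_X(v_i) = γ i` and edge lengths `lenX i = γ (i + 1) - γ i`, such that the composition
of `Γ' → X` and `ι_X` is the lift of `α` to `Γ'`: it has the values of `α` at the vertices of `Γ`
and the slopes of `α` along the edges of `Γ'`. -/
structure SigmaRub : Type 1 where
  base : SigmaDiv
  lift : EquidimLift base.Γ
  len' : lift.Γ'.Edge → base.M
  len'_ne : ∀ e, len' e ≠ 0
  len'_sum : ∀ d, ∑ d' with lift.sub.π d' = d, len' (lift.Γ'.edge d') = base.len (base.Γ.edge d)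
  γ : Fin (lift.k + 1) → Gp base.M
  lenX : Fin lift.k → base.M
  lenX_ne : ∀ i, lenX i ≠ 0
  γ_step : ∀ i, γ i.succ - γ i.castSucc = toGp (lenX i)
  value : ∀ v, γ (lift.β (lift.sub.ι v)) = base.α v
  slope : ∀ (d : lift.Γ'.D) (n : ℤ),
    base.α (base.Γ.tgt (lift.sub.π d)) - base.α (base.Γ.src (lift.sub.π d)) =
      n • toGp (base.len (base.Γ.edge (lift.sub.π d))) →
    γ (lift.β (lift.Γ'.tgt d)) - γ (lift.β (lift.Γ'.src d)) = n • toGp (len' (lift.Γ'.edge d))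

/-- A morphism over `φ : M → N`: a morphism of the underlying points of `Σ_Div`, with compatible
contractions of the subdivision and of the line, which contract exactly the edges whose length
becomes zero. -/
@[ext] structure SigmaRub.Hom (X Y : SigmaRub) where
  base : X.base ⟶ Y.base
  lift : EquidimLift.Hom base.c X.lift Y.lift
  len'_onD : ∀ d, Mon.toHom base.φ (X.len' (X.lift.Γ'.edge (lift.c'.onD d))) =
    Y.len' (Y.lift.Γ'.edge d)
  len'_contracted : ∀ d, d ∉ Set.range lift.c'.onD →
    Mon.toHom base.φ (X.len' (X.lift.Γ'.edge d)) = 0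
  lenX_onE : ∀ i, Mon.toHom base.φ (X.lenX (lift.q.onE i)) = Y.lenX i
  lenX_contracted : ∀ i, i ∉ Set.range lift.q.onE → Mon.toHom base.φ (X.lenX i) = 0
  value : ∀ i, Y.γ (lift.q.onV i) = gpMap (Mon.toHom base.φ) (X.γ i)

instance : Category SigmaRub where
  Hom X Y := SigmaRub.Hom X Y
  id X :=
    { base := 𝟙 X.base
      lift := EquidimLift.Hom.id X.lift
      len'_onD := fun _ => rfl
      len'_contracted := fun d h => absurd ⟨d, rfl⟩ h
      lenX_onE := fun _ => rfl
      lenX_contracted := fun i h => absurd ⟨i, rfl⟩ h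
      value := fun i => (gpMap_id (X.γ i)).symm }
  comp f g :=
    { base := f.base ≫ g.base
      lift := f.lift.comp g.lift
      len'_onD := fun d => (congrArg (Mon.toHom g.base.φ) (f.len'_onD _)).trans (g.len'_onD d)
      len'_contracted := comp_len_contracted _ _ _ _ f.len'_onD f.len'_contracted g.len'_contracted
      lenX_onE := fun i => (congrArg (Mon.toHom g.base.φ) (f.lenX_onE _)).trans (g.lenX_onE i)
      lenX_contracted := fun i hi => by
        change Mon.toHom g.base.φ (Mon.toHom f.base.φ _) = 0
        by_cases hc : i ∈ Set.range f.lift.q.onE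
        · obtain ⟨j, rfl⟩ := hc
          rw [f.lenX_onE]
          exact g.lenX_contracted j fun ⟨r, hr⟩ => hi ⟨r, congrArg f.lift.q.onE hr⟩
        · rw [f.lenX_contracted i hc, map_zero]
      value := fun i => by
        refine (g.value _).trans ?_
        rw [f.value i]
        exact (gpMap_comp (Mon.toHom g.base.φ) (Mon.toHom f.base.φ) _).symm }

/-- The structure morphism of `Σ_Rub`. -/
def SigmaRub.proj : SigmaRub ⥤ Mon where
  obj X := X.base.M
  map f := SigmaDiv.Hom.φ (SigmaRub.Hom.base f)

end TropModuli
end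

/-! Over the dual cone of a monoid `M`, the colimit of a diagram of cones is the free groupoid on
the category of points: pairs of an index and a morphism from the dual cone to the cone of that
index. The theorem says that this groupoid consists of the tropical objects over `M`. Three
ingredients give this.

Duality. An element of `M^gp` that is nonnegative at every integral point of the dual cone lies in
`M`: this is Farkas' lemma over the rationals followed by saturation (`Mon.mem_range_toGp`). Hence
an integral, linear, nonnegative function on the dual cone is evaluation at an element of `M`
(`Mon.exists_eq_eval`), and a morphism from the dual cone to one of the cones is a system of lengths
in `M`, zero allowed, satisfying the relations of that cone. For the cone of a flow, vanishing of
the pairing with `H1` means that path sums depend only on the end points, so that there is a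
piecewise linear function with slopes `s` (`Graph.exists_isPL`, `Graph.IsPL.pairVal_eq_zero`). For
an ordering, the inequalities say that this function is monotone. For an equidimensional lift, the
equations say that the positions on the line pull back to such a function.

Normal form. Contracting exactly the edges of length zero turns a point of a cone into a tropical
curve `X`, so each point receives an arrow from the tautological point of some `X`. All lengths of
`X` are nonzero, hence a contraction that reaches `X` through edges of length zero factors uniquely
through any other contraction of such edges. In other words, every arrow of the category of points
acts bijectively on the arrows out of a tautological point.

Free groupoids. If all arrows act bijectively on the arrows out of `q`, then `Hom(q, -)` extends to
the free groupoid and no new arrows out of `q` appear there (`homMk_bijective`). The functor from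
tropical objects to the glued stack is therefore fully faithful, and by the normal form it is
essentially surjective. `PointFunctor.IsGood` collects what has to be verified, and
`PointFunctor.IsGood.represents` draws the conclusion.

The gluing maps are face inclusions because the image of the smaller cone is the vanishing locus of
linear forms that are nonnegative on the larger one: the lengths of contracted edges and, for
orderings, the differences of values at vertices that become tied.

The laborious point is that contracting the edges of length zero in a stable equidimensional lift
gives such a lift again (`CombRub.contractSub`, `CombRub.contractLift`). The pieces of an edge are
never listed in order. Instead, differences of a function telescope over them
(`Subdivision.sum_pieces`), and indicator functions then show that an edge crosses each level at
most once, and that an edge whose ends stay apart has a piece leaving the class of its start. The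
invariant `CombRub.Near` describes which vertices are merged with a given vertex of the graph. -/

open CategoryTheory

noncomputable section

namespace TropModuli

/-! ## Separation and duality for monoids -/

/-- Farkas' lemma over an ordered field, without topology. -/
theorem farkas {F W : Type*} [Field F] [LinearOrder F] [IsStrictOrderedRing F] [AddCommGroup W]
    [Module F W] : ∀ {n : ℕ} (a : Fin n → W →ₗ[F] F) (b : W →ₗ[F] F),
    (∀ x, (∀ i, 0 ≤ a i x) → 0 ≤ b x) → ∃ u : Fin n → F, (∀ i, 0 ≤ u i) ∧ b = ∑ i, u i • a i
  | 0, a, b, h => by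
    refine ⟨Fin.elim0, fun i => i.elim0, ?_⟩
    ext x
    have h1 := h x fun i => i.elim0
    have h2 := h (-x) fun i => i.elim0
    rw [map_neg] at h2
    simp only [Finset.univ_eq_empty, Finset.sum_empty, LinearMap.zero_apply]
    linarith
  | n + 1, a, b, h => by
    -- Induction on the number of functionals. If the last inequality is redundant, it receives
    -- coefficient zero.
    by_cases h0 : ∀ x, (∀ i : Fin n, 0 ≤ a i.castSucc x) → 0 ≤ b x
    · obtain ⟨u, hu, hb⟩ := farkas (fun i : Fin n => a i.castSucc) b h0
      refine ⟨Fin.snoc u 0, fun i => ?_, ?_⟩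
      · refine Fin.lastCases ?_ (fun i => ?_) i
        · simp
        · simpa using hu i
      · rw [Fin.sum_univ_castSucc]
        simpa using hb
    · push Not at h0
      obtain ⟨y, hy, hby⟩ := h0
      have hay : a (Fin.last n) y < 0 := by
        by_contra hc
        push Not at hc
        refine absurd (h y fun i => ?_) (not_le.2 hby)
        exact Fin.lastCases hc hy i
      set r := a (Fin.last n) y with hr
      -- The modified functionals vanish at `y`. Their values at `x` are those of the original ones
      -- at the projection of `x` along `y` to the kernel of the last functional, so the hypothesis
      -- applies to them.
      obtain ⟨u, hu, hb⟩ := farkas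
        (fun i : Fin n => a i.castSucc - (a i.castSucc y / r) • a (Fin.last n))
        (b - (b y / r) • a (Fin.last n)) fun x hx => by
          have := h (x - (a (Fin.last n) x / r) • y) fun i => by
            refine Fin.lastCases ?_ (fun i => ?_) i
            · simp only [map_sub, map_smul, smul_eq_mul, ← hr]
              rw [div_mul_cancel₀ _ hay.ne, sub_self]
            · have := hx i
              simp only [LinearMap.sub_apply, LinearMap.smul_apply, smul_eq_mul, map_sub,
                map_smul] at this ⊢
              convert this using 2
              field_simp
          simp only [LinearMap.sub_apply, LinearMap.smul_apply, smul_eq_mul, map_sub,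
            map_smul] at this ⊢
          convert this using 2
          field_simp
      -- The last coefficient collects the multiples of the last functional that were subtracted. It
      -- is nonnegative because `b y` and `r` are negative while the other functionals are
      -- nonnegative at `y`.
      refine ⟨Fin.snoc u (b y / r - ∑ i, u i * (a i.castSucc y / r)), fun i => ?_, ?_⟩
      · refine Fin.lastCases ?_ (fun i => ?_) i
        · simp only [Fin.snoc_last]
          have h1 : 0 ≤ b y / r := div_nonneg_of_nonpos hby.le hay.le
          have h2 : ∑ i, u i * (a i.castSucc y / r) ≤ 0 := Finset.sum_nonpos fun i _ =>
            mul_nonpos_of_nonneg_of_nonpos (hu i) (div_nonpos_of_nonneg_of_nonpos (hy i) hay.le)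
          linarith
        · simpa using hu i
      · rw [Fin.sum_univ_castSucc]
        simp only [Fin.snoc_castSucc, Fin.snoc_last]
        ext x
        have hx := DFunLike.congr_fun hb x
        simp only [LinearMap.sub_apply, LinearMap.smul_apply, smul_eq_mul, LinearMap.sum_apply,
          LinearMap.add_apply, mul_sub, Finset.sum_sub_distrib, sub_mul, Finset.sum_mul] at hx ⊢
        simp only [mul_assoc] at hx ⊢
        linarith

/-- A homomorphism to `ℝ` extends to the associated group. -/
def gpEval {M : Type} [AddCommMonoid M] (h : M →+ ℝ) : Gp M →+ ℝ :=
  Algebra.GrothendieckAddGroup.lift h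

@[simp] theorem gpEval_toGp {M : Type} [AddCommMonoid M] (h : M →+ ℝ) (m : M) :
    gpEval h (toGp m) = h m :=
  DFunLike.congr_fun (Algebra.GrothendieckAddGroup.lift.symm_apply_apply h) m

theorem gp_exists {M : Type} [AddCommMonoid M] (x : Gp M) :
    ∃ a b : M, x = toGp a - toGp b := by
  induction x using AddLocalization.ind with | _ y
  refine ⟨y.1, y.2, ?_⟩
  rw [eq_sub_iff_add_eq]
  change AddLocalization.mk _ _ + AddLocalization.mk _ _ = AddLocalization.mk _ _
  rw [AddLocalization.mk_add, AddLocalization.mk_eq_mk_iff, AddLocalization.r_iff_exists]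
  exact ⟨0, by simp [add_comm]⟩

/-- Integral points of the dual cone: homomorphisms to `ℝ≥0` with integral values. -/
structure IsIntegralPoint {M : Type} [AddCommMonoid M] (f : M →+ ℝ) : Prop where
  nonneg : ∀ m, 0 ≤ f m
  integral : ∀ m, ∃ n : ℤ, f m = n

namespace Mon

variable (M : Mon)

instance : IsCancelAdd M where
  add_left_cancel a _ _ h := M.integral a _ _ h
  add_right_cancel a b c h := M.integral a b c (by
    change b + a = c + a at h
    rw [add_comm a b, add_comm a c, h])

theorem toGp_injective : Function.Injective (toGp : M →+ Gp M) :=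
  Algebra.GrothendieckAddGroup.of_injective

theorem toGp_eq_zero {m : M} : toGp m = 0 ↔ m = 0 :=
  ⟨fun h => M.toGp_injective (h.trans (map_zero _).symm), fun h => by rw [h, map_zero]⟩

theorem gpLE_refl (x : Gp M) : M.GpLE x x := ⟨0, by simp⟩

variable {M}

theorem gpLE_trans {x y z : Gp M} (h : M.GpLE x y) (h' : M.GpLE y z) : M.GpLE x z := by
  obtain ⟨a, ha⟩ := h
  obtain ⟨b, hb⟩ := h'
  exact ⟨a + b, by rw [map_add, ha, hb]; abel⟩

theorem gpLE_antisymm {x y : Gp M} (h : M.GpLE x y) (h' : M.GpLE y x) : x = y := by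
  obtain ⟨a, ha⟩ := h
  obtain ⟨b, hb⟩ := h'
  have : a + b = 0 := M.toGp_injective (by rw [map_add, ha, hb, map_zero]; abel)
  rw [M.sharp a b this, map_zero] at ha
  exact (sub_eq_zero.1 ha.symm).symm

/-- If a positive multiple of `x` vanishes, saturation puts both `x` and `-x` into `M`, and
sharpness leaves only zero. -/
instance : IsAddTorsionFree (Gp M) where
  nsmul_right_injective n hn := by
    refine (injective_iff_map_eq_zero (nsmulAddMonoidHom n : Gp M →+ Gp M)).2 fun x hx => ?_
    change n • x = 0 at hx
    have hp := Nat.pos_of_ne_zero hn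
    refine gpLE_antisymm ?_ ?_
    · have := M.saturated (-x) n hp (by rw [smul_neg, hx]; exact ⟨0, by simp⟩)
      rwa [GpLE, zero_sub]
    · have := M.saturated x n hp (by rw [hx]; exact ⟨0, by simp⟩)
      rwa [GpLE, sub_zero]

variable (M)

theorem exists_generators : ∃ (n : ℕ) (g : Fin n → M), AddSubmonoid.closure (Set.range g) = ⊤ := by
  obtain ⟨S, hS⟩ := M.fg.1
  refine ⟨S.card, fun i => (S.equivFin.symm i : M), ?_⟩
  rw [← hS]
  congr 1
  ext x
  constructor
  · rintro ⟨i, rfl⟩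
    exact (S.equivFin.symm i).2
  · intro hx
    exact ⟨S.equivFin ⟨x, hx⟩, by simp⟩

instance : Module.Finite ℤ (Gp M) := by
  obtain ⟨n, g, hg⟩ := M.exists_generators
  refine ⟨Submodule.fg_def.2 ⟨Set.range fun i => toGp (g i), Set.finite_range _, ?_⟩⟩
  rw [eq_top_iff]
  have key : ∀ m : M, toGp m ∈ Submodule.span ℤ (Set.range fun i => toGp (g i)) := by
    intro m
    have hm : m ∈ AddSubmonoid.closure (Set.range g) := by rw [hg]; trivial
    induction hm using AddSubmonoid.closure_induction with
    | mem x hx =>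
      obtain ⟨i, rfl⟩ := hx
      exact Submodule.subset_span ⟨i, rfl⟩
    | zero => rw [map_zero]; exact zero_mem _
    | add x y _ _ hx hy => rw [map_add]; exact add_mem hx hy
  intro x _
  obtain ⟨a, b, rfl⟩ := gp_exists x
  exact sub_mem (key a) (key b)

instance : Module.Free ℤ (Gp M) := inferInstance

variable {M}

/-- An element of `M^gp` which is nonnegative on the integral points of the dual cone lies
in `M`. -/
theorem mem_range_toGp (x : Gp M)
    (h : ∀ f : M →+ ℝ, IsIntegralPoint f → 0 ≤ gpEval f x) :
    x ∈ Set.range (toGp : M →+ Gp M) := by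
  obtain ⟨n, g, hg⟩ := M.exists_generators
  let ev : Gp M → (Gp M →+ ℚ) →ₗ[ℚ] ℚ := fun y =>
    { toFun := fun f => f y, map_add' := fun _ _ => rfl, map_smul' := fun _ _ => rfl }
  -- Farkas is applied over the rationals, on `Hom(M^gp, ℚ)`, so that the multipliers are rational.
  -- A rational functional that is nonnegative on the generators becomes an integral point after
  -- clearing the denominators of its values there.
  obtain ⟨u, hu, hb⟩ := farkas (fun i => ev (toGp (g i))) (ev x) fun f hf => by
    obtain ⟨N, hN⟩ := IsLocalization.exist_integer_multiples_of_finset (nonZeroDivisors ℤ)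
      (Finset.univ.image fun i => f (toGp (g i)))
    have hN0 : (N : ℤ) ≠ 0 := nonZeroDivisors.coe_ne_zero N
    have hgen : ∀ m : M, (∃ z : ℤ, ((N : ℤ) : ℚ) * f (toGp m) = z) ∧ 0 ≤ f (toGp m) := by
      intro m
      have hm : m ∈ AddSubmonoid.closure (Set.range g) := by rw [hg]; trivial
      induction hm using AddSubmonoid.closure_induction with
      | mem y hy =>
        obtain ⟨i, rfl⟩ := hy
        refine ⟨?_, hf i⟩
        obtain ⟨z, hz⟩ := hN (f (toGp (g i))) (by simp)
        refine ⟨z, ?_⟩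
        simpa using hz.symm
      | zero => exact ⟨⟨0, by simp⟩, by simp⟩
      | add y z _ _ hy hz =>
        obtain ⟨⟨a, ha⟩, ha'⟩ := hy
        obtain ⟨⟨b, hb⟩, hb'⟩ := hz
        exact ⟨⟨a + b, by rw [map_add, map_add, mul_add, ha, hb]; simp⟩, by
          rw [map_add, map_add]; exact add_nonneg ha' hb'⟩
    have hA : (0 : ℝ) < |(N : ℤ)| := by exact_mod_cast abs_pos.2 hN0
    let F : Gp M →+ ℝ := ((AddMonoidHom.mulLeft (|(N : ℤ)| : ℝ)).comp
      ((Rat.castHom ℝ).toAddMonoidHom)).comp f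
    have hF : ∀ y, F y = |((N : ℤ) : ℝ)| * (f y : ℝ) := fun y => by simp [F]
    have := h (F.comp toGp) ⟨fun m => by
        rw [AddMonoidHom.comp_apply, hF]
        exact mul_nonneg (abs_nonneg _) (by exact_mod_cast (hgen m).2), fun m => by
        obtain ⟨z, hz⟩ := (hgen m).1
        have hz' : ((N : ℤ) : ℝ) * (f (toGp m) : ℝ) = z := by exact_mod_cast hz
        rw [AddMonoidHom.comp_apply, hF]
        rcases abs_choice ((N : ℤ) : ℝ) with h' | h'
        · exact ⟨z, by rw [h', hz']⟩
        · exact ⟨-z, by rw [h', neg_mul, hz']; simp⟩⟩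
    have e : gpEval (F.comp toGp) x = F x := by
      obtain ⟨a, b, rfl⟩ := gp_exists x
      rw [map_sub, map_sub, gpEval_toGp, gpEval_toGp]
      rfl
    rw [e, hF] at this
    have h2 : (0 : ℝ) ≤ f x := by
      have hA' : (0 : ℝ) < |((N : ℤ) : ℝ)| := by exact_mod_cast abs_pos.2 hN0
      exact nonneg_of_mul_nonneg_right this hA'
    exact_mod_cast h2
  obtain ⟨N, hN⟩ := IsLocalization.exist_integer_multiples_of_finset (nonZeroDivisors ℤ)
    (Finset.univ.image u)
  have hN0 : (N : ℤ) ≠ 0 := nonZeroDivisors.coe_ne_zero N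
  have hc : ∀ i, ∃ c : ℕ, ((N : ℤ).natAbs : ℚ) * u i = c := fun i => by
    obtain ⟨z, hz⟩ := hN (u i) (by simp)
    have hz' : ((N : ℤ) : ℚ) * u i = z := by simpa using hz.symm
    refine ⟨z.natAbs, ?_⟩
    rw [Nat.cast_natAbs, Nat.cast_natAbs, Int.cast_abs, Int.cast_abs, ← hz', abs_mul,
      abs_of_nonneg (hu i)]
  choose c hc using hc
  -- With the denominators of the multipliers cleared, a positive multiple of `x` is a sum of
  -- generators. This identity can be tested by homomorphisms to `ℚ`, because `M^gp` is free.
  refine M.saturated x (N : ℤ).natAbs (Int.natAbs_pos.2 hN0) ⟨∑ i, c i • g i, ?_⟩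
  have hinj : ∀ y z : Gp M, (∀ f : Gp M →+ ℚ, f y = f z) → y = z := by
    intro y z hyz
    refine (Module.Free.chooseBasis ℤ (Gp M)).ext_elem fun i => ?_
    have := hyz ((Int.castAddHom ℚ).comp
      (((Module.Free.chooseBasis ℤ (Gp M)).coord i).toAddMonoidHom))
    simpa using this
  refine hinj _ _ fun f => ?_
  have := DFunLike.congr_fun hb f
  simp only [ev, LinearMap.coe_mk, AddHom.coe_mk, LinearMap.sum_apply, LinearMap.smul_apply,
    smul_eq_mul] at this
  rw [map_nsmul, this, map_sum, map_sum, nsmul_eq_mul, Finset.mul_sum]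
  refine Finset.sum_congr rfl fun i _ => ?_
  rw [map_nsmul, map_nsmul, ← mul_assoc, hc, nsmul_eq_mul]

theorem gp_ext {x y : Gp M} (h : ∀ f : M →+ ℝ, IsIntegralPoint f → gpEval f x = gpEval f y) :
    x = y := by
  refine gpLE_antisymm (mem_range_toGp _ fun f hf => ?_) (mem_range_toGp _ fun f hf => ?_) <;>
  rw [map_sub, h f hf, sub_self]

theorem ext_of_dual {x y : M} (h : ∀ f : M →+ ℝ, IsIntegralPoint f → f x = f y) : x = y :=
  M.toGp_injective (gp_ext fun f hf => by rw [gpEval_toGp, gpEval_toGp, h f hf])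

theorem isIntegralPoint_sum {M : Type} [AddCommMonoid M] {ι : Type*} (s : Finset ι)
    (f : ι → M →+ ℝ) (h : ∀ i, IsIntegralPoint (f i)) : IsIntegralPoint (∑ i ∈ s, f i) := by
  refine ⟨fun m => ?_, fun m => ?_⟩
  · rw [AddMonoidHom.finsetSum_apply]
    exact Finset.sum_nonneg fun i _ => (h i).nonneg m
  · choose z hz using fun i => (h i).integral m
    refine ⟨∑ i ∈ s, z i, ?_⟩
    rw [AddMonoidHom.finsetSum_apply, Int.cast_sum]
    exact Finset.sum_congr rfl fun i _ => hz i

variable (M) in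
/-- There is an integral point in the interior of the dual cone. -/
theorem exists_interior : ∃ f : M →+ ℝ, IsIntegralPoint f ∧ ∀ m : M, m ≠ 0 → 1 ≤ f m := by
  obtain ⟨n, g, hg⟩ := M.exists_generators
  have key : ∀ i, ∃ f : M →+ ℝ, IsIntegralPoint f ∧ (g i ≠ 0 → 1 ≤ f (g i)) := by
    intro i
    by_cases hi : g i = 0
    · exact ⟨0, ⟨fun _ => le_refl _, fun _ => ⟨0, by simp⟩⟩, fun h => absurd hi h⟩
    · by_contra hc
      push Not at hc
      -- If every integral point had value less than one, hence zero, at `g i`, then `-g i` would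
      -- also lie in `M`, against sharpness.
      refine hi (M.toGp_eq_zero.1 (gpLE_antisymm ?_ ?_).symm)
      · exact ⟨g i, by rw [sub_zero]⟩
      · refine mem_range_toGp _ fun f hf => ?_
        rw [zero_sub, map_neg, gpEval_toGp]
        obtain ⟨z, hz⟩ := hf.integral (g i)
        have := (hc f hf).2
        rw [hz] at this ⊢
        have h1 : z < 1 := by exact_mod_cast this
        have h2 : -z ≥ 0 := by omega
        exact_mod_cast h2
  choose f hf hfg using key
  refine ⟨∑ i, f i, isIntegralPoint_sum _ _ hf, fun m => ?_⟩
  have hm : m ∈ AddSubmonoid.closure (Set.range g) := by rw [hg]; trivial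
  induction hm using AddSubmonoid.closure_induction with
  | mem y hy =>
    obtain ⟨i, rfl⟩ := hy
    intro h
    rw [AddMonoidHom.finsetSum_apply]
    exact (hfg i h).trans (Finset.single_le_sum (f := fun j => f j (g i))
      (fun j _ => (hf j).nonneg (g i)) (Finset.mem_univ i))
  | zero => exact fun h => absurd rfl h
  | add y z _ _ hy hz =>
    intro h
    have hn := (isIntegralPoint_sum Finset.univ _ hf).nonneg
    rw [map_add]
    by_cases hy0 : y = 0
    · have := hz fun hz0 => h (by rw [hy0, hz0, add_zero])
      linarith [hn y]
    · linarith [hy hy0, hn z]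

/-- Every homomorphism becomes nonnegative after adding a multiple of an interior point. -/
theorem exists_add_nonneg {u : M →+ ℝ} (hu : ∀ m : M, m ≠ 0 → 1 ≤ u m) (c : M →+ ℝ) :
    ∃ N : ℕ, ∀ m, 0 ≤ (c + N • u) m := by
  obtain ⟨n, g, hg⟩ := M.exists_generators
  obtain ⟨N, hN⟩ := exists_nat_ge (∑ i, |c (g i)|)
  refine ⟨N, fun m => ?_⟩
  have hm : m ∈ AddSubmonoid.closure (Set.range g) := by rw [hg]; trivial
  induction hm using AddSubmonoid.closure_induction with
  | mem y hy =>
    obtain ⟨i, rfl⟩ := hy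
    by_cases h0 : g i = 0
    · rw [h0, map_zero]
    have h1 : |c (g i)| ≤ N := (Finset.single_le_sum (f := fun j => |c (g j)|)
      (fun j _ => abs_nonneg _) (Finset.mem_univ i)).trans hN
    have h2 : (N : ℝ) ≤ N * u (g i) := le_mul_of_one_le_right (Nat.cast_nonneg N) (hu _ h0)
    rw [AddMonoidHom.add_apply, AddMonoidHom.nsmul_apply, nsmul_eq_mul]
    linarith [neg_abs_le (c (g i))]
  | zero => rw [map_zero]
  | add y z _ _ hy hz => rw [map_add]; exact add_nonneg hy hz

/-- Every integral function on the dual cone which is linear and nonnegative is the evaluation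
at an element of the monoid. -/
theorem exists_eq_eval (F : (M →+ ℝ) → ℝ)
    (hadd : ∀ f g : M →+ ℝ, (∀ m, 0 ≤ f m) → (∀ m, 0 ≤ g m) → F (f + g) = F f + F g)
    (hsmul : ∀ (r : ℝ) (f : M →+ ℝ), 0 ≤ r → (∀ m, 0 ≤ f m) → F (r • f) = r * F f)
    (hF : ∀ f : M →+ ℝ, (∀ m, 0 ≤ f m) → 0 ≤ F f)
    (hint : ∀ f : M →+ ℝ, IsIntegralPoint f → ∃ n : ℤ, F f = n) :
    ∃ m : M, ∀ f : M →+ ℝ, (∀ m, 0 ≤ f m) → F f = f m := by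
  obtain ⟨u, hu, hu1⟩ := M.exists_interior
  let b := Module.Free.chooseBasis ℤ (Gp M)
  let c : Module.Free.ChooseBasisIndex ℤ (Gp M) → M →+ ℝ := fun i =>
    ((Int.castAddHom ℝ).comp (b.coord i).toAddMonoidHom).comp toGp
  -- The coordinate functions `c i` need not lie in the dual cone, where alone `F` is controlled.
  -- Adding a multiple of the interior point `u` moves them into it.
  choose N hN using fun i => exists_add_nonneg hu1 (c i)
  let p i := c i + N i • u
  have hp : ∀ i, IsIntegralPoint (p i) := fun i => ⟨hN i, fun m => by
    obtain ⟨z, hz⟩ := hu.integral m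
    refine ⟨b.coord i (toGp m) + N i * z, ?_⟩
    simp only [p, AddMonoidHom.add_apply, AddMonoidHom.nsmul_apply, hz, nsmul_eq_mul]
    push_cast
    rfl⟩
  choose z hz using fun i => hint (p i) (hp i)
  obtain ⟨w, hw⟩ := hint u hu
  have hF0 : F 0 = 0 := by
    have := hadd 0 0 (fun _ => le_refl _) fun _ => le_refl _
    rw [add_zero] at this
    linarith
  have hsum : ∀ (r : Module.Free.ChooseBasisIndex ℤ (Gp M) → ℝ)
      (q : Module.Free.ChooseBasisIndex ℤ (Gp M) → M →+ ℝ) s, (∀ i, 0 ≤ r i) →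
      (∀ i m, 0 ≤ q i m) → F (∑ i ∈ s, r i • q i) = ∑ i ∈ s, r i * F (q i) := by
    intro r q s hr hq
    classical
    induction s using Finset.induction_on with
    | empty => simpa using hF0
    | insert i s hi ih =>
      rw [Finset.sum_insert hi, Finset.sum_insert hi, hadd, ih, hsmul _ _ (hr i) (hq i)]
      · exact fun m => mul_nonneg (hr i) (hq i m)
      · intro m
        rw [AddMonoidHom.finsetSum_apply]
        exact Finset.sum_nonneg fun j _ => mul_nonneg (hr j) (hq j m)
  -- The coefficients are the values that a linear extension of `F` would take at `c i = p i - N i •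
  -- u`.
  let x : Gp M := ∑ i, (z i - N i * w) • b i
  have key : ∀ f : M →+ ℝ, (∀ m, 0 ≤ f m) → F f = gpEval f x := by
    intro f hf
    let r i := gpEval f (b i)
    have hexp : ∀ m, f m = ∑ i, r i * c i m := fun m => by
      have h1 : gpEval f (∑ i, b.repr (toGp m) i • b i) = f m := by
        rw [b.sum_repr, gpEval_toGp]
      rw [← h1, map_sum]
      refine Finset.sum_congr rfl fun i _ => ?_
      rw [map_zsmul, zsmul_eq_mul, mul_comm]
      rfl
    have hr1 : ∀ i, 0 ≤ max (r i) 0 := fun i => le_max_right _ _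
    have hr2 : ∀ i, 0 ≤ max (-r i) 0 := fun i => le_max_right _ _
    have hr : ∀ i, max (r i) 0 - max (-r i) 0 = r i := fun i => by
      rcases le_total 0 (r i) with h | h
      · rw [max_eq_left h, max_eq_right (by linarith), sub_zero]
      · rw [max_eq_right h, max_eq_left (by linarith)]; ring
    -- The expansion of `f` in the `c i`, with all negative terms moved to the other side: both
    -- sides are sums of points of the cone, where `F` is additive.
    have e : (f + ∑ i, max (-r i) 0 • p i) + ∑ i, (max (r i) 0 * N i) • u =
        ∑ i, max (r i) 0 • p i + ∑ i, (max (-r i) 0 * N i) • u := by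
      ext m
      simp only [AddMonoidHom.add_apply, AddMonoidHom.finsetSum_apply]
      rw [hexp m, ← Finset.sum_add_distrib, ← Finset.sum_add_distrib, ← Finset.sum_add_distrib]
      refine Finset.sum_congr rfl fun i _ => ?_
      change r i * c i m + max (-r i) 0 * (c i m + (N i • u) m) + max (r i) 0 * N i * u m =
        max (r i) 0 * (c i m + (N i • u) m) + max (-r i) 0 * N i * u m
      rw [AddMonoidHom.nsmul_apply, nsmul_eq_mul]
      nth_rewrite 1 [← hr i]
      ring
    have hpos : ∀ (t : Module.Free.ChooseBasisIndex ℤ (Gp M) → ℝ)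
        (q : Module.Free.ChooseBasisIndex ℤ (Gp M) → M →+ ℝ), (∀ i, 0 ≤ t i) →
        (∀ i m, 0 ≤ q i m) → ∀ m, 0 ≤ (∑ i, t i • q i) m := fun t q ht hq m => by
      rw [AddMonoidHom.finsetSum_apply]
      exact Finset.sum_nonneg fun j _ => mul_nonneg (ht j) (hq j m)
    have hn1 : ∀ i, 0 ≤ max (r i) 0 * N i := fun i => mul_nonneg (hr1 i) (Nat.cast_nonneg _)
    have hn2 : ∀ i, 0 ≤ max (-r i) 0 * N i := fun i => mul_nonneg (hr2 i) (Nat.cast_nonneg _)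
    have e2 := congrArg F e
    rw [hadd _ _ (fun m => add_nonneg (hf m) (hpos _ _ hr2 hN m))
      (hpos _ (fun _ => u) hn1 fun _ => hu.nonneg), hadd _ _ hf (hpos _ _ hr2 hN),
      hadd _ _ (hpos _ _ hr1 hN) (hpos _ (fun _ => u) hn2 fun _ => hu.nonneg),
      hsum _ _ _ hr1 hN, hsum _ _ _ hr2 hN, hsum _ (fun _ => u) _ hn1 fun _ => hu.nonneg,
      hsum _ (fun _ => u) _ hn2 fun _ => hu.nonneg] at e2
    have e3 : gpEval f x = ∑ i, (max (r i) 0 - max (-r i) 0) * (F (p i) - N i * F u) := by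
      simp only [x, map_sum]
      refine Finset.sum_congr rfl fun i _ => ?_
      rw [map_zsmul, zsmul_eq_mul, hr, hz, hw, mul_comm]
      push_cast
      rfl
    rw [e3]
    simp only [sub_mul, mul_sub, Finset.sum_sub_distrib, ← mul_assoc]
    linarith
  obtain ⟨m, hm⟩ := mem_range_toGp x fun f hf => by
    rw [← key f hf.nonneg]; exact hF f hf.nonneg
  exact ⟨m, fun f hf => by rw [key f hf, ← hm, gpEval_toGp]⟩

end Mon

/-! ## Free groupoids and a criterion for representability -/

section FreeGroupoid

variable {P : Type 1} [Category.{0} P] (q : P)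
  (hq : ∀ {p p' : P} (f : p ⟶ p'), Function.Bijective fun g : q ⟶ p => g ≫ f)

/-- The functor represented by an object `q`, if all morphisms act bijectively on it. -/
def corepCore : P ⥤ Core (Type) where
  obj p := ⟨q ⟶ p⟩
  map f := ⟨(Equiv.ofBijective _ (hq f)).toIso⟩
  map_id p := by
    ext g
    exact Category.comp_id g
  map_comp f f' := by
    ext g
    exact (Category.assoc g f f').symm

/-- The extension of the functor represented by `q` to the free groupoid. -/
def corepFree : FreeGroupoid P ⥤ Type := FreeGroupoid.lift (corepCore q hq) ⋙ Core.inclusion _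

theorem corepFree_map {p p' : P} (f : p ⟶ p') (g : q ⟶ p) :
    (corepFree q hq).map (FreeGroupoid.homMk f) g = g ≫ f := by
  have := FreeGroupoid.lift_map_homMk (corepCore q hq) f
  change ((FreeGroupoid.lift (corepCore q hq)).map (FreeGroupoid.homMk f)).iso.hom g = _
  rw [this]
  rfl

-- The extension of `Hom(q, -)` to the free groupoid, applied to the identity of `q`, recovers `g`
-- from its image. Conversely, an arrow of the free groupoid out of `q` is a zigzag: forward steps
-- are composed, and backward steps are undone by the bijectivity `hq`.
include hq in
theorem homMk_bijective (p : P) :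
    Function.Bijective fun g : q ⟶ p => FreeGroupoid.homMk g := by
  constructor
  · intro g g' h
    have h1 := corepFree_map q hq g (𝟙 q)
    have h2 := corepFree_map q hq g' (𝟙 q)
    rw [Category.id_comp] at h1 h2
    rw [← h1, ← h2]
    exact congrArg (fun t : FreeGroupoid.mk q ⟶ FreeGroupoid.mk p =>
      (corepFree q hq).map t (𝟙 q : q ⟶ q)) h
  · intro h
    refine Localization.induction_structuredArrow (FreeGroupoid.of P) ⊤
      (fun g => ∃ t : q ⟶ g.right, FreeGroupoid.homMk t = g.hom) ?_ ?_ ?_ (StructuredArrow.mk h)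
    · exact ⟨𝟙 q, (FreeGroupoid.of P).map_id q⟩
    · rintro Y₁ Y₂ f φ ⟨t, ht⟩
      refine ⟨t ≫ f, ?_⟩
      change (FreeGroupoid.of P).map (t ≫ f) = φ ≫ (FreeGroupoid.of P).map f
      rw [Functor.map_comp]
      exact congrArg (· ≫ _) ht
    · rintro Y₁ Y₂ w hw φ ⟨t, ht⟩
      obtain ⟨t', ht'⟩ := (hq w).2 t
      refine ⟨t', ?_⟩
      change (FreeGroupoid.of P).map t' = φ ≫ (Localization.isoOfHom _ ⊤ w hw).inv
      rw [Iso.eq_comp_inv, Localization.isoOfHom_hom, ← Functor.map_comp]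
      exact (congrArg (FreeGroupoid.of P).map ht').trans ht

end FreeGroupoid

/-! ### From tropical objects to the glued stack: full faithfulness and essential surjectivity. -/

section Criterion

variable {C : Type 1} [Category.{0} C] (σ : Cᵒᵖ ⥤ Cone) {S : Type 1} [Category.{0} S]
  (π : S ⥤ Mon)

/-- A functor from `S` to the index category of a diagram of cones, together with a compatible
system of points of the cones. -/
structure PointFunctor where
  U : S ⥤ C
  el : ∀ X : S, dualCone (π.obj X) ⟶ σ.obj (Opposite.op (U.obj X))
  compat : ∀ {X Y : S} (f : X ⟶ Y), dualMap (π.map f) ≫ el X = el Y ≫ σ.map (U.map f).op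

variable {σ π} (T : PointFunctor σ π)

theorem groupoid_inv_inv {G : Type 1} [Groupoid.{1} G] {a b : G} (e : a ⟶ b) :
    Groupoid.inv (Groupoid.inv e) = e := by
  rw [Groupoid.inv_eq_inv, Groupoid.inv_eq_inv, IsIso.inv_inv]

/-- Both sides invert the two sides of `h`. The lemma turns commuting squares of contractions into
squares of their formal inverses; in the application `e` is a transport between equal objects. -/
theorem comp_inv_eq_inv_comp_inv {G : Type 1} [Groupoid.{1} G] {a b c d : G} {e : a ⟶ b}
    {e' : b ⟶ a} (he : e ≫ e' = 𝟙 a) {p : c ⟶ b} {q : d ⟶ a} {r : c ⟶ d}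
    (h : p ≫ e' = r ≫ q) : e ≫ Groupoid.inv p = Groupoid.inv q ≫ Groupoid.inv r := by
  have he' : e' = Groupoid.inv e := by
    rw [← Category.id_comp e', ← Groupoid.inv_comp e, Category.assoc, he, Category.comp_id]
  subst he'
  rw [Groupoid.inv_eq_inv, Groupoid.inv_eq_inv, Groupoid.inv_eq_inv] at *
  simp only [← IsIso.inv_comp, ← h]
  simp

/-- The transports occurring in the Grothendieck construction come from identity contractions, so
they can be composed within the category of points. -/
theorem eqToHom_eq_homMk {D : Type 1} [Category.{0} D] {σ : D ⥤ Cone} {τ : Coneᵒᵖ} {i : D}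
    {x x' : τ.unop ⟶ σ.obj i}
    (h : (FreeGroupoid.mk (Functor.elementsMk (σ ⋙ coyoneda.obj τ) i x) :
      FreeGroupoid (Points σ τ)) =
      FreeGroupoid.mk (Functor.elementsMk (σ ⋙ coyoneda.obj τ) i x'))
    (hx : x ≫ σ.map (𝟙 i) = x') :
    eqToHom h = FreeGroupoid.homMk (CategoryOfElements.homMk _ _ (𝟙 i) hx) := by
  have : x = x' := by rw [← hx, σ.map_id, Category.comp_id]
  subst this
  exact ((FreeGroupoid.of _).map_id _).symm

theorem FreeGroupoid_map_inv {P Q : Type 1} [Category.{0} P] [Category.{0} Q] (F : P ⥤ Q)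
    {p p' : P} (f : p ⟶ p') :
    (FreeGroupoid.map F).map (Groupoid.inv (FreeGroupoid.homMk f)) =
      Groupoid.inv (FreeGroupoid.homMk (F.map f)) := by
  rw [Groupoid.inv_eq_inv, Groupoid.inv_eq_inv, Functor.map_inv]
  rfl

namespace PointFunctor

/-- The point of the diagram of cones given by an object of `S`. -/
def point (X : S) : Points σ (dual.obj (π.obj X)) :=
  Functor.elementsMk _ (Opposite.op (T.U.obj X)) (T.el X)

/-- A morphism of `S` induces a morphism of points. -/
def pointMap {X Y : S} (f : X ⟶ Y) :
    T.point Y ⟶ (Points.map σ (dual.map (π.map f))).obj (T.point X) :=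
  CategoryOfElements.homMk _ _ (T.U.map f).op (T.compat f).symm

/-- The object of the Grothendieck construction given by an object of `S`. -/
def grothObj (X : S) : Grothendieck (dual ⋙ colimStack σ ⋙ Grpd.forgetToCat) :=
  ⟨π.obj X, FreeGroupoid.mk (T.point X)⟩

/-- The morphism in the fibre given by a morphism of `S`. -/
def fiberMap {X Y : S} (f : X ⟶ Y) :
    FreeGroupoid.mk ((Points.map σ (dual.map (π.map f))).obj (T.point X)) ⟶
      FreeGroupoid.mk (T.point Y) := Groupoid.inv (FreeGroupoid.homMk (T.pointMap f))

/-- The contraction underlying a morphism gives an arrow of points in the opposite direction, which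
becomes usable only after inversion in the free groupoid. -/
def grothMap {X Y : S} (f : X ⟶ Y) : T.grothObj X ⟶ T.grothObj Y := ⟨π.map f, T.fiberMap f⟩

theorem fiberMap_id (X : S) (h : FreeGroupoid.mk (T.point X) =
      FreeGroupoid.mk ((Points.map σ (dual.map (π.map (𝟙 X)))).obj (T.point X)))
    (h' : FreeGroupoid.mk (T.point X) = FreeGroupoid.mk (T.point X)) :
    eqToHom h ≫ T.fiberMap (𝟙 X) = eqToHom h' := by
  have hx : T.el X ≫ σ.map (𝟙 _) = dualMap (π.map (𝟙 X)) ≫ T.el X := by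
    rw [T.compat, T.U.map_id, op_id]
  have h1 := eqToHom_eq_homMk (τ := dual.obj (π.obj X)) h hx
  rw [fiberMap, Groupoid.inv_eq_inv, IsIso.comp_inv_eq, eqToHom_refl, Category.id_comp]
  refine h1.trans ?_
  congr 1
  apply CategoryOfElements.ext
  exact (congrArg Quiver.Hom.op (T.U.map_id X)).symm

theorem fiberMap_comp {X Y Z : S} (f : X ⟶ Y) (g : Y ⟶ Z)
    (h : FreeGroupoid.mk ((Points.map σ (dual.map (π.map f ≫ π.map g))).obj (T.point X)) =
      FreeGroupoid.mk ((Points.map σ (dual.map (π.map (f ≫ g)))).obj (T.point X)))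
    (h' : FreeGroupoid.mk ((Points.map σ (dual.map (π.map f ≫ π.map g))).obj (T.point X)) =
      (FreeGroupoid.map (Points.map σ (dual.map (π.map g)))).obj
        (FreeGroupoid.mk ((Points.map σ (dual.map (π.map f))).obj (T.point X)))) :
    eqToHom h ≫ T.fiberMap (f ≫ g) = eqToHom h' ≫
      (FreeGroupoid.map (Points.map σ (dual.map (π.map g)))).map (T.fiberMap f) ≫
        T.fiberMap g := by
  have hx : (dualMap (π.map (f ≫ g)) ≫ T.el X) ≫ σ.map (𝟙 _) =
      dualMap (π.map f ≫ π.map g) ≫ T.el X := by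
    rw [σ.map_id, Category.comp_id, π.map_comp]
  have h1 := eqToHom_eq_homMk (τ := dual.obj (π.obj Z)) h.symm hx
  have h3 : T.pointMap (f ≫ g) ≫ (CategoryOfElements.homMk _ _ (𝟙 _) hx :
        (Points.map σ (dual.map (π.map (f ≫ g)))).obj (T.point X) ⟶
          (Points.map σ (dual.map (π.map f ≫ π.map g))).obj (T.point X)) =
      T.pointMap g ≫ (Points.map σ (dual.map (π.map g))).map (T.pointMap f) := by
    apply CategoryOfElements.ext
    change (T.U.map (f ≫ g)).op ≫ 𝟙 _ = (T.U.map g).op ≫ (T.U.map f).op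
    rw [T.U.map_comp, Category.comp_id, op_comp]
  have h4 := ((FreeGroupoid.of (Points σ (dual.obj (π.obj Z)))).map_comp _ _).symm.trans
    ((congrArg (FreeGroupoid.of (Points σ (dual.obj (π.obj Z)))).map h3).trans
      ((FreeGroupoid.of (Points σ (dual.obj (π.obj Z)))).map_comp _ _))
  refine (comp_inv_eq_inv_comp_inv (e := eqToHom h) (e' := eqToHom h.symm) (by simp)
    ((congrArg _ h1).trans h4)).trans ?_
  refine Eq.trans ?_ (Category.id_comp _).symm
  exact congrArg (· ≫ _) (FreeGroupoid_map_inv _ _).symm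

/-- The functor to the Grothendieck construction. -/
def groth : S ⥤ Grothendieck (dual ⋙ colimStack σ ⋙ Grpd.forgetToCat) where
  obj := T.grothObj
  map := T.grothMap
  map_id X := Grothendieck.ext _ _ (π.map_id X) (T.fiberMap_id X _ rfl)
  map_comp f g := Grothendieck.ext _ _ (π.map_comp f g) (T.fiberMap_comp f g _ _)

theorem comp_map_op {X : S} {x y : C} (c : x ⟶ y) (g : y ⟶ T.U.obj X)
    {h : dualCone (π.obj X) ⟶ σ.obj (Opposite.op y)} (hg : T.el X ≫ σ.map g.op = h) :
    h ≫ σ.map c.op = T.el X ≫ σ.map (c ≫ g).op := by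
  rw [op_comp, σ.map_comp, ← hg, Category.assoc]

/-- Conditions under which `S` is represented by the diagram of cones. -/
structure IsGood : Prop where
  full : ∀ {X Y : S} (φ : π.obj X ⟶ π.obj Y) (c : T.U.obj X ⟶ T.U.obj Y),
    dualMap φ ≫ T.el X = T.el Y ≫ σ.map c.op → ∃ f : X ⟶ Y, π.map f = φ ∧ T.U.map f = c
  faithful : ∀ {X Y : S} (f g : X ⟶ Y), π.map f = π.map g → T.U.map f = T.U.map g → f = g
  -- Existence of the normal form: each point receives an arrow from a tautological one.
  surj : ∀ (M : Mon) (x : C) (h : dualCone M ⟶ σ.obj (Opposite.op x)),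
    ∃ (X : S) (i : π.obj X ≅ M) (c : x ⟶ T.U.obj X), h = dualMap i.hom ≫ T.el X ≫ σ.map c.op
  -- Arrows of points act bijectively on arrows out of a tautological point, which is the hypothesis
  -- of `homMk_bijective`.
  factor : ∀ (X : S) {x y : C} (c : x ⟶ y) (d : x ⟶ T.U.obj X)
    (h : dualCone (π.obj X) ⟶ σ.obj (Opposite.op y)),
    h ≫ σ.map c.op = T.el X ≫ σ.map d.op →
      ∃! d' : y ⟶ T.U.obj X, c ≫ d' = d ∧ T.el X ≫ σ.map d'.op = h

end PointFunctor

variable {T} (hT : T.IsGood)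

include hT

theorem PointFunctor.IsGood.bijective (X : S) {p p' : Points σ (dual.obj (π.obj X))} (f : p ⟶ p') :
    Function.Bijective fun g : T.point X ⟶ p => g ≫ f := by
  obtain ⟨⟨y⟩, hy⟩ := p
  obtain ⟨⟨x⟩, hx⟩ := p'
  obtain ⟨⟨c⟩, hc⟩ := f
  change hy ≫ σ.map c.op = hx at hc
  constructor
  · rintro ⟨⟨g⟩, hg⟩ ⟨⟨g'⟩, hg'⟩ h
    have h1 : c ≫ g = c ≫ g' := congrArg (fun t => Quiver.Hom.unop (Subtype.val t)) h
    change T.el X ≫ σ.map g.op = hy at hg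
    change T.el X ≫ σ.map g'.op = hy at hg'
    have := (hT.factor X c (c ≫ g) hy (T.comp_map_op c g hg)).unique
      ⟨rfl, hg⟩ ⟨h1.symm, hg'⟩
    subst this
    rfl
  · rintro ⟨⟨g⟩, hg⟩
    change T.el X ≫ σ.map g.op = hx at hg
    obtain ⟨d, ⟨h1, h2⟩, -⟩ := hT.factor X c g hy (hc.trans hg.symm)
    exact ⟨⟨d.op, h2⟩, Subtype.ext (congrArg Quiver.Hom.op h1)⟩

theorem PointFunctor.IsGood.homMk_bijective (X : S) (p : Points σ (dual.obj (π.obj X))) :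
    Function.Bijective fun g : T.point X ⟶ p => FreeGroupoid.homMk g :=
  TropModuli.homMk_bijective (T.point X) (hT.bijective X) p

theorem PointFunctor.IsGood.grothFaithful : T.groth.Faithful where
  map_injective {X Y f g} h := by
    have h1 : π.map f = π.map g := congrArg Grothendieck.Hom.base h
    -- The contraction is decoded from the fibre component. Decoding over an arbitrary base `φ`
    -- makes this a function of the whole morphism, so that equality of morphisms can be fed into it
    -- without transport.
    let dec' (φ : π.obj X ⟶ π.obj Y) (k : FreeGroupoid.mk ((Points.map σ (dual.map φ)).obj
        (T.point X)) ⟶ FreeGroupoid.mk (T.point Y)) : T.U.obj X ⟶ T.U.obj Y :=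
      ((hT.homMk_bijective Y _).2 (Groupoid.inv k)).choose.val.unop
    let dec (k : T.grothObj X ⟶ T.grothObj Y) : T.U.obj X ⟶ T.U.obj Y := dec' k.base k.fiber
    have hdec : ∀ f : X ⟶ Y, dec (T.grothMap f) = T.U.map f := by
      intro f
      have := ((hT.homMk_bijective Y ((Points.map σ (dual.map (π.map f))).obj (T.point X))).2
        (Groupoid.inv (T.fiberMap f))).choose_spec
      have e : Groupoid.inv (T.fiberMap f) = FreeGroupoid.homMk (T.pointMap f) := groupoid_inv_inv _
      have := (hT.homMk_bijective Y _).1 (this.trans e)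
      exact congrArg (fun t => Quiver.Hom.unop (Subtype.val t)) this
    refine hT.faithful f g h1 ?_
    rw [← hdec, ← hdec]
    exact congrArg dec h

theorem PointFunctor.IsGood.grothFull : T.groth.Full where
  map_surjective {X Y} h := by
    obtain ⟨φ, h⟩ := h
    change FreeGroupoid.mk ((Points.map σ (dual.map φ)).obj (T.point X)) ⟶
      FreeGroupoid.mk (T.point Y) at h
    obtain ⟨g, hg⟩ := (hT.homMk_bijective Y ((Points.map σ (dual.map φ)).obj (T.point X))).2
      (Groupoid.inv h)
    obtain ⟨⟨c⟩, hc⟩ := g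
    obtain ⟨f, rfl, rfl⟩ := hT.full φ c (Eq.symm hc)
    refine ⟨f, ?_⟩
    have e : T.fiberMap f = h := by
      change Groupoid.inv _ = h
      exact (congrArg Groupoid.inv hg).trans (groupoid_inv_inv h)
    exact congrArg (Grothendieck.Hom.mk _) e

theorem PointFunctor.IsGood.grothEssSurj : T.groth.EssSurj where
  mem_essImage Z := by
    obtain ⟨M, z⟩ := Z
    obtain ⟨p, rfl⟩ := (FreeGroupoid.of_obj_bijective (C := Points σ (dual.obj M))).2 z
    obtain ⟨⟨x⟩, h⟩ := p
    obtain ⟨X, i, c, hc⟩ := hT.surj M x h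
    let g : (Points.map σ (dual.map i.hom)).obj (T.point X) ⟶
        Functor.elementsMk (σ ⋙ coyoneda.obj (dual.obj M)) (Opposite.op x) h :=
      CategoryOfElements.homMk _ _ c.op hc.symm
    let e : FreeGroupoid.mk ((Points.map σ (dual.map i.hom)).obj (T.point X)) ≅
        FreeGroupoid.mk (Functor.elementsMk (σ ⋙ coyoneda.obj (dual.obj M)) (Opposite.op x) h) :=
      (Groupoid.isoEquivHom _ _).symm (FreeGroupoid.homMk g)
    exact ⟨X, ⟨Grothendieck.isoMk i e⟩⟩

theorem PointFunctor.IsGood.represents : Represents σ π := by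
  have := hT.grothFaithful
  have := hT.grothFull
  have := hT.grothEssSurj
  have : T.groth.IsEquivalence := {}
  refine ⟨T.groth.inv, inferInstance, ⟨?_⟩⟩
  -- `T.groth` lies over `Mon` by construction, so the counit of the equivalence projects to the
  -- required isomorphism.
  exact Functor.isoWhiskerRight T.groth.asEquivalence.counitIso (Grothendieck.forget _)

end Criterion

/-! ## Piecewise linear functions on graphs -/

namespace Graph

variable {Γ Δ Θ : Graph}

theorem tgt_rev (Γ : Graph) (d : Γ.D) : Γ.tgt (Γ.rev d) = Γ.src d := congrArg Γ.src (Γ.rev_rev d)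

theorem edge_rev (Γ : Graph) (d : Γ.D) : Γ.edge (Γ.rev d) = Γ.edge d :=
  (Quot.sound (r := fun d d' : Γ.D => d' = Γ.rev d) rfl).symm

instance (Γ : Graph) : Finite Γ.Edge := Quot.finite _

theorem edge_surjective (Γ : Graph) (e : Γ.Edge) : ∃ d, Γ.edge d = e := Quot.exists_rep e

theorem IsPath.append {p q : List Γ.D} : ∀ {u v w : Γ.V}, Γ.IsPath p u v → Γ.IsPath q v w →
    Γ.IsPath (p ++ q) u w := by
  induction p with
  | nil => rintro u v w ⟨⟩ h; exact h
  | cons d p ih => rintro u v w ⟨rfl, hp⟩ h; exact ⟨rfl, ih hp h⟩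

theorem isPath_single (d : Γ.D) : Γ.IsPath [d] (Γ.src d) (Γ.tgt d) := ⟨rfl, rfl⟩

theorem exists_isPath (v w : Γ.V) : ∃ p, Γ.IsPath p v w := by
  induction Γ.connected v w with
  | refl => exact ⟨[], rfl⟩
  | tail _ h ih =>
    obtain ⟨p, hp⟩ := ih
    obtain ⟨d, rfl, rfl⟩ := h
    exact ⟨p ++ [d], hp.append (isPath_single d)⟩

/-- A chosen path from the root. -/
def rootPath (Γ : Graph) (v : Γ.V) : List Γ.D := (exists_isPath Γ.root v).choose

theorem rootPath_spec (v : Γ.V) : Γ.IsPath (Γ.rootPath v) Γ.root v :=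
  (exists_isPath Γ.root v).choose_spec

section PL

variable {A : Type*} [AddCommGroup A] (s : Γ.Flow) (l : Γ.Edge → A)

/-- A function on the vertices is piecewise linear with slopes `s` for the edge lengths `l`. -/
def IsPL (α : Γ.V → A) : Prop := ∀ d, α (Γ.tgt d) - α (Γ.src d) = s.1 d • l (Γ.edge d)

/-- The sum of `s(e) ℓ_e` over a path, with lengths in an arbitrary group. -/
def pathVal (p : List Γ.D) : A := (p.map fun d => s.1 d • l (Γ.edge d)).sum

theorem pathVal_append (p q : List Γ.D) : pathVal s l (p ++ q) = pathVal s l p + pathVal s l q := by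
  simp [pathVal]

theorem pathVal_single (d : Γ.D) : pathVal s l [d] = s.1 d • l (Γ.edge d) := by
  simp [pathVal]

theorem pathVal_eq_pathSum (l : Γ.Edge → ℝ) (p : List Γ.D) :
    pathVal s l p = Γ.pathSum s l p := by
  simp [pathVal, pathSum, zsmul_eq_mul]

variable {s l}

theorem IsPL.pathVal {α : Γ.V → A} (h : IsPL s l α) {p : List Γ.D} : ∀ {v w}, Γ.IsPath p v w →
    pathVal s l p = α w - α v := by
  induction p with
  | nil => rintro v w ⟨⟩; simp [Graph.pathVal]
  | cons d p ih =>
    rintro v w ⟨rfl, hp⟩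
    have := ih hp
    have h1 : Graph.pathVal s l (d :: p) = s.1 d • l (Γ.edge d) + Graph.pathVal s l p := by
      simp [Graph.pathVal]
    rw [h1, this, ← h d]
    abel

theorem IsPL.sub_const {α : Γ.V → A} (h : IsPL s l α) (a : A) : IsPL s l fun v => α v - a :=
  fun d => by rw [← h d, sub_sub_sub_cancel_right]

theorem IsPL.map {B : Type*} [AddCommGroup B] {α : Γ.V → A} (h : IsPL s l α) (f : A →+ B) :
    IsPL s (fun e => f (l e)) fun v => f (α v) := fun d => by
  rw [← map_sub, h d, map_zsmul]

theorem isPL_of_rootPath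
    (h : ∀ d, Graph.pathVal s l (Γ.rootPath (Γ.tgt d)) - Graph.pathVal s l (Γ.rootPath (Γ.src d)) =
      s.1 d • l (Γ.edge d)) : IsPL s l fun v => Graph.pathVal s l (Γ.rootPath v) := h

open Classical in
/-- The flow along a single oriented edge. -/
def edgeFlow (d : Γ.D) : Γ.Flow :=
  ⟨fun t => (if t = d then 1 else 0) - (if t = Γ.rev d then 1 else 0), fun t => by
    have h1 : Γ.rev t = d ↔ t = Γ.rev d :=
      ⟨fun h => by rw [← h, Γ.rev_rev], fun h => by rw [h, Γ.rev_rev]⟩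
    have h2 : Γ.rev t = Γ.rev d ↔ t = d :=
      ⟨fun h => by rw [← Γ.rev_rev t, h, Γ.rev_rev], fun h => by rw [h]⟩
    simp only [h1, h2]
    ring⟩

open Classical in
theorem div_edgeFlow (d : Γ.D) (v : Γ.V) :
    Γ.div (edgeFlow d) v = (if v = Γ.tgt d then 1 else 0) - (if v = Γ.src d then 1 else 0) := by
  change ∑ t with Γ.tgt t = v, ((if t = d then (1 : ℤ) else 0) - (if t = Γ.rev d then 1 else 0)) = _
  rw [Finset.sum_sub_distrib, Finset.sum_ite_eq', Finset.sum_ite_eq']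
  simp only [Finset.mem_filter, Finset.mem_univ, true_and, tgt_rev]
  simp only [eq_comm]

/-- The flow along a path. -/
def pathFlow (p : List Γ.D) : Γ.Flow := (p.map edgeFlow).sum

open Classical in
theorem div_pathFlow {p : List Γ.D} : ∀ {v w : Γ.V}, Γ.IsPath p v w → ∀ u,
    Γ.div (pathFlow p) u = (if u = w then 1 else 0) - (if u = v then 1 else 0) := by
  induction p with
  | nil => rintro v w ⟨⟩ u; simp [pathFlow]
  | cons d p ih =>
    rintro v w ⟨rfl, hp⟩ u
    have h1 : pathFlow (d :: p) = edgeFlow d + pathFlow p := by simp [pathFlow]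
    rw [h1, map_add, Pi.add_apply, ih hp, div_edgeFlow]
    ring

variable (s l) in
/-- Twice the intersection pairing, with lengths in an arbitrary group. -/
def pairVal : Γ.Flow →+ A where
  toFun g := ∑ d, (s.1 d * g.1 d) • l (Γ.edge d)
  map_zero' := by simp
  map_add' g g' := by
    rw [← Finset.sum_add_distrib]
    refine Finset.sum_congr rfl fun d _ => ?_
    rw [← add_smul, ← mul_add]
    rfl

theorem pairVal_apply (g : Γ.Flow) : pairVal s l g = ∑ d, (s.1 d * g.1 d) • l (Γ.edge d) := rfl

theorem pairVal_eq_pairing (l : Γ.Edge → ℝ) (g : Γ.Flow) :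
    pairVal s l g = 2 * Γ.pairing s g l := by
  rw [pairVal_apply, pairing]
  simp only [zsmul_eq_mul]
  push_cast
  ring

/-- The factor two arises because both orientations of the edge contribute the same amount. -/
theorem pairVal_edgeFlow (d : Γ.D) : pairVal s l (edgeFlow d) = 2 • s.1 d • l (Γ.edge d) := by
  classical
  rw [pairVal_apply]
  have h : ∀ t, (s.1 t * (edgeFlow d).1 t) • l (Γ.edge t) =
      (if t = d then s.1 t • l (Γ.edge t) else 0) -
        (if t = Γ.rev d then s.1 t • l (Γ.edge t) else 0) := by
    intro t
    change (s.1 t * ((if t = d then 1 else 0) - (if t = Γ.rev d then 1 else 0))) • _ = _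
    split_ifs <;> simp
  rw [Finset.sum_congr rfl fun t _ => h t, Finset.sum_sub_distrib, Finset.sum_ite_eq',
    Finset.sum_ite_eq', if_pos (Finset.mem_univ _), if_pos (Finset.mem_univ _), edge_rev, s.2 d,
    neg_smul, sub_neg_eq_add, two_nsmul]

theorem pairVal_pathFlow (p : List Γ.D) : pairVal s l (pathFlow p) = 2 • pathVal s l p := by
  induction p with
  | nil => simp [pathFlow, Graph.pathVal]
  | cons d p ih =>
    have h1 : pathFlow (d :: p) = edgeFlow d + pathFlow p := by simp [pathFlow]
    have h2 : Graph.pathVal s l (d :: p) = s.1 d • l (Γ.edge d) + Graph.pathVal s l p := by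
      simp [Graph.pathVal]
    rw [h1, map_add, ih, pairVal_edgeFlow, h2, smul_add]

/-- A piecewise linear function exists if the pairing with the first homology vanishes. -/
theorem exists_isPL [IsAddTorsionFree A] (h : ∀ g ∈ Γ.H1, pairVal s l g = 0) :
    IsPL s l fun v => Graph.pathVal s l (Γ.rootPath v) := by
  classical
  refine isPL_of_rootPath fun d => ?_
  -- The chosen path to the source, followed by `d`, and the chosen path to the target have the same
  -- ends, so their difference is a cycle. The pairing gives twice the difference of path values,
  -- and torsion-freeness removes the factor two.
  have h1 : pathFlow (Γ.rootPath (Γ.src d) ++ [d]) - pathFlow (Γ.rootPath (Γ.tgt d)) ∈ Γ.H1 := by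
    change Γ.div _ = 0
    ext u
    rw [map_sub, Pi.sub_apply, div_pathFlow ((rootPath_spec _).append (isPath_single d)),
      div_pathFlow (rootPath_spec _), sub_self, Pi.zero_apply]
  have h2 := h _ h1
  rw [map_sub, pairVal_pathFlow, pairVal_pathFlow, ← smul_sub, pathVal_append, pathVal_single,
    smul_eq_zero_iff_right two_ne_zero] at h2
  rw [sub_eq_zero.1 (show _ = (0 : A) from h2) |>.symm]
  abel

/-- Summation by parts: the slope equation turns the pairing into a sum of values of `α` weighted by
the divisor of `g`, which is zero for a cycle. -/
theorem IsPL.pairVal_eq_zero {α : Γ.V → A} (h : IsPL s l α) {g : Γ.Flow} (hg : g ∈ Γ.H1) :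
    pairVal s l g = 0 := by
  classical
  have h1 : ∑ d, g.1 d • α (Γ.tgt d) = 0 := by
    rw [← Finset.sum_fiberwise (s := Finset.univ) (g := Γ.tgt)]
    refine Finset.sum_eq_zero fun v _ => ?_
    have hv : ∑ d with Γ.tgt d = v, g.1 d = 0 := congrFun hg v
    rw [Finset.sum_congr rfl (g := fun d => g.1 d • α v) fun d hd => by
      rw [(Finset.mem_filter.1 hd).2], ← Finset.sum_smul, hv, zero_smul]
  have h2 : ∑ d, g.1 d • α (Γ.src d) = - ∑ d, g.1 d • α (Γ.tgt d) := by
    rw [← Finset.sum_neg_distrib]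
    refine Fintype.sum_bijective Γ.rev (Function.Involutive.bijective Γ.rev_rev) _ _ fun d => ?_
    rw [g.2 d, tgt_rev, neg_smul, neg_neg]
  have h3 : ∀ d, (s.1 d * g.1 d) • l (Γ.edge d) = g.1 d • α (Γ.tgt d) - g.1 d • α (Γ.src d) := by
    intro d
    rw [← smul_sub, h d, mul_comm, mul_smul]
  rw [pairVal_apply, Finset.sum_congr rfl fun d _ => h3 d, Finset.sum_sub_distrib, h2, h1]
  simp

end PL

/-- The homological conditions are traded for a piecewise linear function, normalized to vanish at
the root along the chosen paths. All later arguments about these cones use this form. -/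
theorem mem_cone_iff (x : CombDiv) (l : x.Γ.Edge → ℝ) :
    l ∈ x.cone.cone ↔ (∀ e, 0 ≤ l e) ∧ IsPL x.s l fun v => x.Γ.pathSum x.s l (x.Γ.rootPath v) := by
  change ((∀ e, 0 ≤ l e) ∧ ∀ g ∈ x.Γ.H1, x.Γ.pairing x.s g l = 0) ↔ _
  refine and_congr_right fun _ => ⟨fun h => ?_, fun h g hg => ?_⟩
  · simp only [← pathVal_eq_pathSum]
    exact exists_isPL fun g hg => by rw [pairVal_eq_pairing, h g hg, mul_zero]
  · have := h.pairVal_eq_zero hg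
    rw [pairVal_eq_pairing] at this
    linarith

/-! ## Factoring and constructing contractions -/

namespace Contraction

theorem onV_eq_of_path (c : Contraction Γ Δ) {K : Γ.D → Prop} (hK : ∀ d ∈ Set.range c.onD, K d)
    {v w : Γ.V} (h : Relation.ReflTransGen (fun a b => ∃ d, ¬ K d ∧ Γ.src d = a ∧ Γ.tgt d = b) v w) :
    c.onV v = c.onV w := by
  induction h with
  | refl => rfl
  | tail _ h ih =>
    obtain ⟨d, hd, rfl, rfl⟩ := h
    rw [ih]
    exact c.collapse d fun h => hd (hK d h)

theorem onV_root (c : Contraction Γ Δ) : c.onV Γ.root = Δ.root := by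
  have h := c.onV_legs
  rw [root, root]
  simp only [← h, List.head_map]

section Factor

variable (c : Contraction Γ Δ) (c' : Contraction Γ Θ) (h : Set.range c'.onD ⊆ Set.range c.onD)

include h in
theorem onV_eq_of_range_subset {v w : Γ.V} (hv : c.onV v = c.onV w) : c'.onV v = c'.onV w :=
  c'.onV_eq_of_path h (c.fibre v w hv)

/-- The factorization of a contraction over another one which contracts fewer edges. -/
def factor : Contraction Δ Θ where
  onV x := c'.onV (c.onV_surj x).choose
  onD d := (h ⟨d, rfl⟩).choose
  onD_inj d d' hd := c'.onD_inj (by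
    rw [← (h ⟨d, rfl⟩).choose_spec, ← (h ⟨d', rfl⟩).choose_spec]
    exact congrArg c.onD hd)
  onD_rev d := c.onD_inj (by
    rw [c.onD_rev, (h ⟨d, rfl⟩).choose_spec, (h ⟨_, rfl⟩).choose_spec, c'.onD_rev])
  onV_src d := by
    rw [← c'.onV_src]
    refine onV_eq_of_range_subset c c' h ?_
    rw [(c.onV_surj _).choose_spec, ← c.onV_src, (h ⟨d, rfl⟩).choose_spec]
  onV_surj y := by
    obtain ⟨v, rfl⟩ := c'.onV_surj y
    exact ⟨c.onV v, onV_eq_of_range_subset c c' h (c.onV_surj _).choose_spec⟩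
  collapse d hd := by
    have h1 : c.onD d ∉ Set.range c'.onD := by
      rintro ⟨t, ht⟩
      exact hd ⟨t, c.onD_inj (by rw [(h ⟨t, rfl⟩).choose_spec, ht])⟩
    have h2 := c'.collapse _ h1
    refine (onV_eq_of_range_subset c c' h ?_).trans
      (h2.trans (onV_eq_of_range_subset c c' h ?_))
    · rw [(c.onV_surj _).choose_spec, c.onV_src]
    · rw [(c.onV_surj _).choose_spec, c.onV_tgt]
  fibre x y hxy := by
    have h1 := c'.fibre _ _ hxy
    rw [← (c.onV_surj x).choose_spec, ← (c.onV_surj y).choose_spec]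
    revert h1
    generalize (c.onV_surj x).choose = v
    generalize (c.onV_surj y).choose = w
    intro h1
    induction h1 with
    | refl => exact .refl
    | tail _ h2 ih =>
      obtain ⟨d, hd, rfl, rfl⟩ := h2
      -- An edge contracted by `c'` either survives in `Δ`, where the factor contracts it, or is
      -- already contracted by `c` and contributes no step.
      by_cases hc : d ∈ Set.range c.onD
      · obtain ⟨t, rfl⟩ := hc
        refine ih.tail ⟨t, ?_, (c.onV_src t).symm, (c.onV_tgt t).symm⟩
        rintro ⟨r, rfl⟩
        exact hd ⟨r, (h ⟨r, rfl⟩).choose_spec.symm⟩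
      · rw [← c.collapse d hc]
        exact ih
  onV_legs := by
    rw [← c.onV_legs, ← c'.onV_legs, List.map_map]
    exact List.map_congr_left fun v _ => onV_eq_of_range_subset c c' h (c.onV_surj _).choose_spec

theorem factor_onD (d : Θ.D) : c.onD ((factor c c' h).onD d) = c'.onD d := (h ⟨d, rfl⟩).choose_spec

theorem factor_onV (v : Γ.V) : (factor c c' h).onV (c.onV v) = c'.onV v :=
  onV_eq_of_range_subset c c' h (c.onV_surj _).choose_spec

theorem comp_factor : c.comp (factor c c' h) = c' :=
  Contraction.ext (funext (factor_onV c c' h)) (funext (factor_onD c c' h))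

end Factor

/-- Contractions are epimorphisms: they are surjective on vertices, and the identification of the
surviving edges is injective. -/
theorem comp_cancel {c : Contraction Γ Δ} {d d' : Contraction Δ Θ} (h : c.comp d = c.comp d') :
    d = d' := by
  refine Contraction.ext (funext fun x => ?_) (funext fun t => c.onD_inj ?_)
  · obtain ⟨v, rfl⟩ := c.onV_surj x
    exact congrFun (congrArg Contraction.onV h) v
  · exact congrFun (congrArg Contraction.onD h) t

end Contraction

section Contract

variable (Γ) (K : Γ.D → Prop) (hK : ∀ d, K (Γ.rev d) ↔ K d)

/-- Two vertices are joined by an edge which is not in `K`. -/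
def ContractRel (a b : Γ.V) : Prop := ∃ d, ¬ K d ∧ Γ.src d = a ∧ Γ.tgt d = b

include hK in
theorem contractRel_symm : Std.Symm (Γ.ContractRel K) := ⟨by
  rintro _ _ ⟨d, hd, rfl, rfl⟩
  exact ⟨Γ.rev d, by rwa [hK], rfl, Γ.tgt_rev d⟩⟩

-- The relation is symmetric because `K` does not depend on the orientation, so the generated
-- equivalence consists of paths of contracted edges.
include hK in
theorem mk_eq_iff {v w : Γ.V} : Quot.mk (Γ.ContractRel K) v = Quot.mk _ w ↔
    Relation.ReflTransGen (Γ.ContractRel K) v w := by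
  rw [Quot.eq]
  constructor
  · intro h
    have hs : Std.Symm (Γ.ContractRel K) := Γ.contractRel_symm K hK
    induction h with
    | rel x y h => exact .single h
    | refl => exact .refl
    | symm x y _ ih => exact Relation.ReflTransGen.stdSymm.symm _ _ ih
    | trans x y z _ _ h1 h2 => exact h1.trans h2
  · intro h
    induction h with
    | refl => exact .refl _
    | tail _ h ih => exact ih.trans _ _ _ (.rel _ _ h)

/-- The graph obtained by contracting the edges which are not in `K`. -/
def contract : Graph where
  V := Quot (Γ.ContractRel K)
  D := {d // K d}
  finV := Quot.finite _
  finD := Subtype.finite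
  rev d := ⟨Γ.rev d.1, (hK _).2 d.2⟩
  rev_rev d := Subtype.ext (Γ.rev_rev d.1)
  rev_ne d h := Γ.rev_ne d.1 (congrArg Subtype.val h)
  src d := Quot.mk _ (Γ.src d.1)
  connected v w := by
    obtain ⟨v, rfl⟩ := Quot.exists_rep v
    obtain ⟨w, rfl⟩ := Quot.exists_rep w
    induction Γ.connected v w with
    | refl => exact .refl
    | tail _ h ih =>
      obtain ⟨d, rfl, rfl⟩ := h
      by_cases hd : K d
      · exact ih.tail ⟨⟨d, hd⟩, rfl, rfl⟩
      · have : Quot.mk (Γ.ContractRel K) (Γ.src d) = Quot.mk _ (Γ.src (Γ.rev d)) :=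
          Quot.sound ⟨d, hd, rfl, rfl⟩
        rwa [← this]
  legs := Γ.legs.map (Quot.mk _)
  legs_ne := by simpa using Γ.legs_ne

/-- The contraction onto `contract`. -/
def contraction : Contraction Γ (Γ.contract K hK) where
  onV := Quot.mk _
  onD d := d.1
  onD_inj _ _ h := Subtype.ext h
  onD_rev _ := rfl
  onV_src _ := rfl
  onV_surj := Quot.exists_rep
  collapse d hd := Quot.sound ⟨d, fun h => hd ⟨⟨d, h⟩, rfl⟩, rfl, rfl⟩
  fibre v w h := by
    refine Relation.ReflTransGen.mono ?_ _ _ ((Γ.mk_eq_iff K hK).1 h)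
    rintro a b ⟨d, hd, h1, h2⟩
    exact ⟨d, fun ⟨t, ht⟩ => hd (ht ▸ t.2), h1, h2⟩
  onV_legs := rfl

theorem mem_range_contraction {d : Γ.D} : d ∈ Set.range (Γ.contraction K hK).onD ↔ K d :=
  ⟨fun ⟨t, ht⟩ => ht ▸ t.2, fun h => ⟨⟨d, h⟩, rfl⟩⟩

end Contract

end Graph

/-! ## Criteria for cones -/

theorem exists_basis_intLattice (ι : Type) [Finite ι] :
    ∃ (n : ℕ) (b : Module.Basis (Fin n) ℝ (ι → ℝ)),
      intLattice ι = AddSubgroup.closure (Set.range b) := by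
  classical
  cases nonempty_fintype ι
  refine ⟨Fintype.card ι, (Pi.basisFun ℝ ι).reindex (Fintype.equivFin ι), ?_⟩
  rw [Module.Basis.range_reindex]
  apply le_antisymm
  · intro x hx
    choose n hn using hx
    have : x = ∑ i, n i • (Pi.basisFun ℝ ι) i := by
      ext j
      rw [Finset.sum_apply, Finset.sum_eq_single j]
      · rw [Pi.smul_apply, Pi.basisFun_apply, Pi.single_eq_same, hn j, zsmul_eq_mul, mul_one]
      · intro i _ hi
        rw [Pi.smul_apply, Pi.basisFun_apply, Pi.single_eq_of_ne hi.symm, smul_zero]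
      · exact fun h => absurd (Finset.mem_univ j) h
    rw [this]
    exact sum_mem fun i _ => zsmul_mem (AddSubgroup.subset_closure (Set.mem_range_self i)) _
  · rw [AddSubgroup.closure_le]
    rintro _ ⟨i, rfl⟩ j
    rw [Pi.basisFun_apply]
    by_cases h : j = i
    · subst h
      exact ⟨1, by rw [Pi.single_eq_same, Int.cast_one]⟩
    · exact ⟨0, by rw [Pi.single_eq_of_ne h, Int.cast_zero]⟩

/-- Integral coordinates `e` identify the lattice with the standard one. As the cone lies in the
positive orthant for these coordinates, it is strictly convex. -/
theorem Cone.isRationalPolyhedral_of {C : Cone} {ι κ : Type} [Finite ι] [Finite κ]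
    (e : C.V ≃ₗ[ℝ] (ι → ℝ)) (he : ∀ x, x ∈ C.lattice ↔ e x ∈ intLattice ι)
    (F : κ → C.V →ₗ[ℝ] ℝ) (hF : ∀ k, ∀ x ∈ C.lattice, ∃ n : ℤ, F k x = n)
    (hC : ∀ x, x ∈ C.cone ↔ ∀ k, 0 ≤ F k x) (hpos : ∀ x ∈ C.cone, ∀ i, 0 ≤ e x i) :
    C.IsRationalPolyhedral where
  isLattice := by
    obtain ⟨n, b, hb⟩ := exists_basis_intLattice ι
    refine ⟨n, b.map e.symm, ?_⟩
    have h1 : C.lattice = (intLattice ι).comap e.toAddEquiv.toAddMonoidHom := by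
      ext x
      exact he x
    have h2 : Set.range (b.map e.symm) = e.symm.toAddEquiv.toAddMonoidHom '' Set.range b := by
      rw [← Set.range_comp]
      exact congrArg Set.range (funext fun i => b.map_apply _ i)
    rw [h1, h2, ← AddMonoidHom.map_closure, ← hb]
    ext x
    constructor
    · exact fun h => ⟨e x, h, e.symm_apply_apply x⟩
    · rintro ⟨y, hy, rfl⟩
      change e (e.symm y) ∈ intLattice ι
      rw [e.apply_symm_apply]
      exact hy
  polyhedral := by
    classical
    refine ⟨(Set.finite_range F).toFinset, ?_, fun x => ?_⟩
    · intro f hf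
      obtain ⟨k, rfl⟩ := (Set.Finite.mem_toFinset _).1 hf
      exact hF k
    · rw [hC x]
      simp
  strictlyConvex x hx hx' := by
    apply e.injective
    ext i
    have h1 := hpos x hx i
    have h2 := hpos _ hx' i
    rw [map_neg, Pi.neg_apply] at h2
    rw [map_zero, Pi.zero_apply]
    linarith

/-- If `a • x + y` lies in the common zero set of forms nonnegative on the cone, with `a > 0`, then
both summands of each form vanish there, so `x` lies in it too. -/
theorem Cone.isFaceInclusion_of {C D : Cone} {L : C.V →ₗ[ℝ] D.V} {hc hl} {κ : Type*}
    (hinj : Function.Injective L) (G : κ → D.V → ℝ)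
    (hadd : ∀ k x y, G k (x + y) = G k x + G k y) (hsmul : ∀ k (r : ℝ) x, G k (r • x) = r * G k x)
    (hG : ∀ k, ∀ x ∈ D.cone, 0 ≤ G k x)
    (himg : ∀ x ∈ D.cone, (∃ y ∈ C.cone, L y = x) ↔ ∀ k, G k x = 0)
    (hlat : ∀ y, L y ∈ D.lattice → y ∈ C.lattice) :
    Cone.IsFaceInclusion (Cone.homOfLinear (C := C) (D := D) L hc hl) := by
  have hmem : ∀ z : D.V, z ∈ (Submodule.map D.cone.subtype (LinearMap.range
      (Cone.Hom.toLin (Cone.homOfLinear (C := C) (D := D) L hc hl))) : PointedCone ℝ D.V) ↔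
      ∃ y ∈ C.cone, L y = z := by
    intro z
    constructor
    · rintro ⟨_, ⟨y, rfl⟩, rfl⟩
      exact ⟨y.1, y.2, rfl⟩
    · rintro ⟨y, hy, rfl⟩
      exact ⟨_, ⟨⟨y, hy⟩, rfl⟩, rfl⟩
  refine ⟨fun x y h => Subtype.ext (hinj (congrArg Subtype.val h)), ⟨?_, ?_⟩,
    fun x hx => hlat _ hx⟩
  · intro z hz
    obtain ⟨y, hy, rfl⟩ := (hmem z).1 hz
    exact hc y hy
  · intro x y a hx hy ha hxy
    have hxy' := (hmem _).1 hxy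
    have hz : a • x + y ∈ D.cone := by
      obtain ⟨w, hw, h⟩ := hxy'
      rw [← h]
      exact hc w hw
    rw [himg _ hz] at hxy'
    rw [hmem, himg x hx]
    intro k
    have h := hxy' k
    rw [hadd, hsmul] at h
    have h1 := hG k x hx
    have h2 := hG k y hy
    have h3 : a * G k x = 0 := by
      have := mul_nonneg ha.le h1
      linarith
    exact (mul_eq_zero.1 h3).resolve_left ha.ne'

/-! ## Morphisms from dual cones -/

/-- Coordinates of a morphism from the dual cone are evaluations at elements of the monoid. -/
theorem exists_coord {M : Mon} {D : Cone} (h : dualCone M ⟶ D) (κ : D.V →ₗ[ℝ] ℝ)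
    (hpos : ∀ x ∈ D.cone, 0 ≤ κ x) (hint : ∀ x ∈ D.lattice, ∃ n : ℤ, κ x = n) :
    ∃ m : M, ∀ (f : M →+ ℝ) (hf : ∀ m, 0 ≤ f m),
      κ (Cone.Hom.toLin h (⟨f, hf⟩ : (dualCone M).cone)) = f m := by
  classical
  -- The function is extended by the default value zero outside the dual cone; only its values on
  -- the cone enter.
  have key := Mon.exists_eq_eval (M := M) (fun f => if hf : ∀ m, 0 ≤ f m then
    κ (Cone.Hom.toLin h (⟨f, hf⟩ : (dualCone M).cone)) else 0)
  obtain ⟨m, hm⟩ := key (by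
    intro f g hf hg
    have hfg : ∀ m, 0 ≤ (f + g) m := fun m => add_nonneg (hf m) (hg m)
    rw [dif_pos hf, dif_pos hg, dif_pos hfg]
    have := congrArg κ (congrArg Subtype.val (map_add (Cone.Hom.toLin h)
      (⟨f, hf⟩ : (dualCone M).cone) ⟨g, hg⟩))
    exact this.trans (κ.map_add _ _)) (by
    intro r f hr hf
    have hrf : ∀ m, 0 ≤ (r • f) m := fun m => mul_nonneg hr (hf m)
    rw [dif_pos hf, dif_pos hrf]
    have := congrArg κ (congrArg Subtype.val (map_smul (Cone.Hom.toLin h)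
      (⟨r, hr⟩ : {r : ℝ // 0 ≤ r}) (⟨f, hf⟩ : (dualCone M).cone)))
    exact this.trans (κ.map_smul r _)) (by
    intro f hf
    rw [dif_pos hf]
    exact hpos _ (Cone.Hom.toLin h (⟨f, hf⟩ : (dualCone M).cone)).2) (by
    intro f hf
    obtain ⟨n, hn⟩ := hint _ (h.map_lattice (⟨f, hf.nonneg⟩ : (dualCone M).cone) hf.integral)
    exact ⟨n, by rw [dif_pos hf.nonneg]; exact hn⟩)
  refine ⟨m, fun f hf => ?_⟩
  have := hm f hf
  rwa [dif_pos hf] at this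

theorem dualHom_ext {M : Mon} {D : Cone} {h h' : dualCone M ⟶ D}
    (hh : ∀ f : (dualCone M).cone, (Cone.Hom.toLin h f : D.V) = Cone.Hom.toLin h' f) : h = h' :=
  Cone.Hom.ext (LinearMap.ext fun f => Subtype.ext (hh f))

/-- Evaluation at a family of elements of the monoid. -/
def evalLin {M : Mon} {ι : Type} (a : ι → M) : (M →+ ℝ) →ₗ[ℝ] (ι → ℝ) where
  toFun f i := f (a i)
  map_add' _ _ := rfl
  map_smul' _ _ := rfl

theorem evalLin_mem_intLattice {M : Mon} {ι : Type} (a : ι → M) {f : M →+ ℝ}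
    (hf : ∀ m, ∃ n : ℤ, f m = n) : evalLin a f ∈ intLattice ι := fun i => hf (a i)

/-- Integral points of the dual cone separate the elements of `M`. Compatibility of cone morphisms
with a contraction thereby becomes a condition on lengths in `M`. -/
theorem evalLin_eq_extendZero {M : Mon} {ι κ : Type} {j : ι → κ} (hj : Function.Injective j)
    (a : κ → M) (b : ι → M) :
    (∀ f : M →+ ℝ, (∀ m, 0 ≤ f m) → evalLin a f = extendZero j (evalLin b f)) ↔
      (∀ i, a (j i) = b i) ∧ ∀ k, k ∉ Set.range j → a k = 0 := by
  constructor
  · intro h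
    refine ⟨fun i => Mon.ext_of_dual fun f hf => ?_, fun k hk => Mon.ext_of_dual fun f hf => ?_⟩
    · have := congrFun (h f hf.nonneg) (j i)
      rwa [extendZero_apply hj] at this
    · have := congrFun (h f hf.nonneg) k
      rw [extendZero_apply' _ hk] at this
      rw [map_zero]
      exact this
  · rintro ⟨h1, h2⟩ f _
    ext k
    by_cases hk : k ∈ Set.range j
    · obtain ⟨i, rfl⟩ := hk
      rw [extendZero_apply hj]
      exact congrArg f (h1 i)
    · rw [extendZero_apply' _ hk]
      change f (a k) = 0
      rw [h2 k hk]
      exact map_zero f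

/-! ### Piecewise linear functions with values in `M^gp` and the linear forms cutting out the cone
of a flow. -/

namespace Graph

theorem IsPL.eval {Γ : Graph} {M : Mon} {s : Γ.Flow} {l : Γ.Edge → M} {α : Γ.V → Gp M}
    (h : IsPL s (fun e => toGp (l e)) α) (f : M →+ ℝ) :
    IsPL s (evalLin l f) fun v => gpEval f (α v) := by
  have := h.map (gpEval f)
  simp only [gpEval_toGp] at this
  exact this

/-- The real functions at different integral points need not be related: each is used only to show
that the pairing with a cycle vanishes at its point, and integral points detect zero in `M^gp`. -/
theorem exists_isPL_of_eval {Γ : Graph} {M : Mon} {s : Γ.Flow} {l : Γ.Edge → M}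
    (h : ∀ f : M →+ ℝ, IsIntegralPoint f → ∃ α, IsPL s (evalLin l f) α) :
    ∃ α : Γ.V → Gp M, IsPL s (fun e => toGp (l e)) α := by
  refine ⟨_, exists_isPL fun g hg => Mon.gp_ext fun f hf => ?_⟩
  obtain ⟨α, hα⟩ := h f hf
  rw [map_zero, ← hα.pairVal_eq_zero hg, pairVal_apply, pairVal_apply, map_sum]
  refine Finset.sum_congr rfl fun d _ => ?_
  rw [map_zsmul, gpEval_toGp]
  rfl

theorem pathSum_eq_of_isPL {Γ : Graph} {s : Γ.Flow} {l : Γ.Edge → ℝ} {α : Γ.V → ℝ}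
    (h : IsPL s l α) {p : List Γ.D} {v w : Γ.V} (hp : Γ.IsPath p v w) :
    Γ.pathSum s l p = α w - α v := by
  rw [← pathVal_eq_pathSum, h.pathVal hp]

theorem isPL_rootPath {Γ : Graph} {s : Γ.Flow} {l : Γ.Edge → ℝ} {α : Γ.V → ℝ}
    (h : IsPL s l α) : IsPL s l fun v => Γ.pathSum s l (Γ.rootPath v) := by
  simp only [pathSum_eq_of_isPL h (rootPath_spec _)]
  exact h.sub_const _

theorem mem_cone_of_isPL (x : CombDiv) {l : x.Γ.Edge → ℝ} (h0 : ∀ e, 0 ≤ l e) {α : x.Γ.V → ℝ}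
    (h : IsPL x.s l α) : l ∈ x.cone.cone := (mem_cone_iff x l).2 ⟨h0, isPL_rootPath h⟩

/-- The sum over a path as a linear function of the lengths. -/
def pathLin (Γ : Graph) (s : Γ.Flow) (p : List Γ.D) : (Γ.Edge → ℝ) →ₗ[ℝ] ℝ where
  toFun l := Γ.pathSum s l p
  map_add' l l' := Γ.pathSum_add s l l' p
  map_smul' r l := Γ.pathSum_smul s r l p

theorem pathSum_int (Γ : Graph) (s : Γ.Flow) {l : Γ.Edge → ℝ} (hl : l ∈ intLattice Γ.Edge)
    (p : List Γ.D) : ∃ n : ℤ, Γ.pathSum s l p = n := by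
  choose n hn using hl
  refine ⟨(p.map fun d => s.1 d * n (Γ.edge d)).sum, ?_⟩
  induction p with
  | nil => simp [pathSum]
  | cons d p ih =>
    rw [List.map_cons, List.sum_cons, Int.cast_add, ← ih]
    simp [pathSum, hn]

/-- The linear forms defining the cone of a flow: edge lengths and the failure of the function
given by chosen paths to be piecewise linear. -/
def coneForm (Γ : Graph) (s : Γ.Flow) : Γ.Edge ⊕ Γ.D ⊕ Γ.D → (Γ.Edge → ℝ) →ₗ[ℝ] ℝ
  | .inl e => LinearMap.proj e
  | .inr (.inl d) => Γ.pathLin s (Γ.rootPath (Γ.src d) ++ [d]) - Γ.pathLin s (Γ.rootPath (Γ.tgt d))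
  | .inr (.inr d) => Γ.pathLin s (Γ.rootPath (Γ.tgt d)) - Γ.pathLin s (Γ.rootPath (Γ.src d) ++ [d])

theorem coneForm_int (Γ : Graph) (s : Γ.Flow) {l : Γ.Edge → ℝ} (hl : l ∈ intLattice Γ.Edge)
    (k) : ∃ n : ℤ, Γ.coneForm s k l = n := by
  obtain e | d | d := k
  · exact hl e
  · obtain ⟨a, ha⟩ := Γ.pathSum_int s hl (Γ.rootPath (Γ.src d) ++ [d])
    obtain ⟨b, hb⟩ := Γ.pathSum_int s hl (Γ.rootPath (Γ.tgt d))
    refine ⟨a - b, ?_⟩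
    change Γ.pathSum s l _ - Γ.pathSum s l _ = _
    rw [ha, hb, Int.cast_sub]
  · obtain ⟨a, ha⟩ := Γ.pathSum_int s hl (Γ.rootPath (Γ.src d) ++ [d])
    obtain ⟨b, hb⟩ := Γ.pathSum_int s hl (Γ.rootPath (Γ.tgt d))
    refine ⟨b - a, ?_⟩
    change Γ.pathSum s l _ - Γ.pathSum s l _ = _
    rw [ha, hb, Int.cast_sub]

theorem mem_cone_iff_coneForm (x : CombDiv) (l : x.Γ.Edge → ℝ) :
    l ∈ x.cone.cone ↔ ∀ k, 0 ≤ x.Γ.coneForm x.s k l := by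
  have happ : ∀ d, x.Γ.pathSum x.s l (x.Γ.rootPath (x.Γ.src d) ++ [d]) =
      x.Γ.pathSum x.s l (x.Γ.rootPath (x.Γ.src d)) + x.s.1 d • l (x.Γ.edge d) := fun d => by
    rw [← pathVal_eq_pathSum, pathVal_append, pathVal_single, pathVal_eq_pathSum]
  rw [mem_cone_iff]
  constructor
  · rintro ⟨h0, h⟩ (e | d | d)
    · exact h0 e
    · change 0 ≤ x.Γ.pathSum _ _ _ - x.Γ.pathSum _ _ _
      rw [happ, ← h d]
      simp
    · change 0 ≤ x.Γ.pathSum _ _ _ - x.Γ.pathSum _ _ _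
      rw [happ, ← h d]
      simp
  · intro h
    refine ⟨fun e => h (.inl e), fun d => ?_⟩
    have h1 : 0 ≤ x.Γ.pathSum _ _ _ - x.Γ.pathSum _ _ _ := h (.inr (.inl d))
    have h2 : 0 ≤ x.Γ.pathSum _ _ _ - x.Γ.pathSum _ _ _ := h (.inr (.inr d))
    rw [happ] at h1 h2
    linarith

/-- A piecewise linear function for lengths extended by zero descends along the contraction. -/
theorem Contraction.exists_isPL {Γ Δ : Graph} (c : Contraction Γ Δ) {A : Type*} [AddCommGroup A]
    {s : Γ.Flow} {l : Γ.Edge → A} {l' : Δ.Edge → A} (h1 : ∀ e, l (c.onE e) = l' e)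
    (h2 : ∀ e, e ∉ Set.range c.onE → l e = 0) {α : Γ.V → A} (hα : IsPL s l α) :
    ∃ α' : Δ.V → A, IsPL (c.flow s) l' α' ∧ ∀ v, α' (c.onV v) = α v := by
  have hpath : ∀ v w, c.onV v = c.onV w → α v = α w := by
    intro v w h
    induction c.fibre v w h with
    | refl => rfl
    | tail hp hs ih =>
      obtain ⟨d, hd, rfl, rfl⟩ := hs
      have hcol := c.collapse d hd
      have := hα d
      rw [h2 _ fun h => hd (c.edge_mem_range.1 h), smul_zero, sub_eq_zero] at this
      rw [this]
      exact ih (h.trans hcol.symm)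
  refine ⟨fun x => α (c.onV_surj x).choose, fun d => ?_, fun v =>
    hpath _ _ (c.onV_surj _).choose_spec⟩
  have e1 : α (c.onV_surj (Δ.tgt d)).choose = α (Γ.tgt (c.onD d)) :=
    hpath _ _ (by rw [(c.onV_surj _).choose_spec, c.onV_tgt])
  have e2 : α (c.onV_surj (Δ.src d)).choose = α (Γ.src (c.onD d)) :=
    hpath _ _ (by rw [(c.onV_surj _).choose_spec, c.onV_src])
  change α _ - α _ = _
  rw [e1, e2, hα, ← c.onE_edge, h1]
  rfl

/-- Conversely, a piecewise linear function can be pulled back along a contraction. -/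
theorem Contraction.isPL_comp {Γ Δ : Graph} (c : Contraction Γ Δ) {A : Type*} [AddCommGroup A]
    {s : Γ.Flow} {l : Γ.Edge → A} {l' : Δ.Edge → A} (h1 : ∀ e, l (c.onE e) = l' e)
    (h2 : ∀ e, e ∉ Set.range c.onE → l e = 0) {α : Δ.V → A} (hα : IsPL (c.flow s) l' α) :
    IsPL s l fun v => α (c.onV v) := by
  intro d
  by_cases hd : d ∈ Set.range c.onD
  · obtain ⟨t, rfl⟩ := hd
    change α (c.onV _) - α (c.onV _) = _
    rw [c.onV_tgt, c.onV_src, hα t, ← h1]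
    rfl
  · change α (c.onV _) - α (c.onV _) = _
    rw [c.collapse d hd, sub_self, h2 _ fun h => hd (c.edge_mem_range.1 h), smul_zero]

end Graph

/-! ## Extension by zero -/

section ExtendZero

variable {ι κ : Type} {j : ι → κ} (hj : Function.Injective j)
include hj

theorem extendZero_injective : Function.Injective (extendZero j) := by
  intro l l' h
  ext i
  rw [← extendZero_apply hj l i, h, extendZero_apply hj]

theorem extendZero_restrict {l : κ → ℝ} (h : ∀ k, k ∉ Set.range j → l k = 0) :
    extendZero j (fun i => l (j i)) = l := by
  ext k
  by_cases hk : k ∈ Set.range j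
  · obtain ⟨i, rfl⟩ := hk
    exact extendZero_apply hj _ i
  · exact (extendZero_apply' _ hk).trans (h k hk).symm

theorem mem_intLattice_of_extendZero {l : ι → ℝ} (h : extendZero j l ∈ intLattice κ) :
    l ∈ intLattice ι := fun i => by
  rw [← extendZero_apply hj l i]
  exact h (j i)

end ExtendZero

/-! ## The stack of graphs with a piecewise linear function -/

namespace CombDiv

theorem isConeStackDiagram : IsConeStackDiagram CombDiv.cones := by
  refine ⟨fun i => ?_, fun {i j} f => ?_⟩
  · refine Cone.isRationalPolyhedral_of (C := i.unop.cone) (LinearEquiv.refl ℝ _)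
      (fun _ => Iff.rfl) (i.unop.Γ.coneForm i.unop.s) (fun k x hx => Graph.coneForm_int _ _ hx k)
      (Graph.mem_cone_iff_coneForm i.unop) fun x hx e => hx.1 e
  · let c : Graph.Contraction j.unop.Γ i.unop.Γ := CombDiv.Hom.c f.unop
    have hflow : c.flow j.unop.s = i.unop.s := CombDiv.Hom.flow f.unop
    refine Cone.isFaceInclusion_of (C := i.unop.cone) (D := j.unop.cone)
      (hc := CombDiv.lengths_mem f.unop)
      (hl := fun _ h => extendZero_int (Graph.Contraction.onE_inj _) h) ?_
      (fun (e : {e // e ∉ Set.range c.onE}) l => l e.1) (fun _ _ _ => rfl) (fun _ _ _ => rfl)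
      (fun e l hl => hl.1 e.1) (fun l hl => ?_)
      fun l hl => mem_intLattice_of_extendZero c.onE_inj hl
    · exact extendZero_injective c.onE_inj
    · constructor
      · rintro ⟨l', hl', rfl⟩ e
        exact extendZero_apply' l' e.2
      · intro h
        have h2 := ((Graph.mem_cone_iff _ _).1 hl).2
        -- If the contracted edges have length zero, the piecewise linear function is constant on
        -- the fibres of `c`. Its descent shows that the remaining lengths lie in the smaller cone.
        obtain ⟨α, hα, -⟩ := c.exists_isPL (l' := fun e => l (c.onE e)) (fun _ => rfl)
          (fun e he => h ⟨e, he⟩) h2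
        rw [hflow] at hα
        exact ⟨fun e => l (c.onE e), Graph.mem_cone_of_isPL _ (fun e => hl.1 _) hα,
          extendZero_restrict c.onE_inj fun e he => h ⟨e, he⟩⟩

variable {M N : Mon} (x : CombDiv)

/-- Lengths in a monoid for which there is a piecewise linear function with the given slopes. -/
def IsPoint (l : x.Γ.Edge → M) : Prop := ∃ α : x.Γ.V → Gp M, Graph.IsPL x.s (fun e => toGp (l e)) α

/-- The morphism of cones given by lengths in a monoid. -/
def pt (l : x.Γ.Edge → M) (hl : x.IsPoint l) : dualCone M ⟶ x.cone :=
  Cone.homOfLinear (C := dualCone M) (D := x.cone) (evalLin l)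
    (fun f hf => Graph.mem_cone_of_isPL x (fun e => hf (l e)) (hl.choose_spec.eval f))
    fun _ hf => evalLin_mem_intLattice l hf

/-- By `exists_coord` each coordinate is an element of `M`, and membership in the cone at integral
points yields the piecewise linear function over `M^gp`. -/
theorem exists_pt (h : dualCone M ⟶ x.cone) : ∃ l hl, h = x.pt l hl := by
  choose l hl using fun e : x.Γ.Edge => exists_coord h (LinearMap.proj (R := ℝ)
    (φ := fun _ : x.Γ.Edge => ℝ) e) (fun y hy => hy.1 e) fun y hy => hy e
  refine ⟨l, Graph.exists_isPL_of_eval fun f hf => ?_, ?_⟩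
  · have h1 := (Cone.Hom.toLin h (⟨f, hf.nonneg⟩ : (dualCone M).cone)).2
    have h2 : (Cone.Hom.toLin h (⟨f, hf.nonneg⟩ : (dualCone M).cone)).1 = evalLin l f :=
      funext fun e => hl e f hf.nonneg
    rw [h2] at h1
    exact ⟨_, ((Graph.mem_cone_iff x _).1 h1).2⟩
  · exact dualHom_ext fun f => funext fun e => hl e f.1 f.2

variable {x} {y : CombDiv}

/-- The dictionary between arrows of points and lengths: surviving edges keep their length,
contracted edges have length zero. -/
theorem pt_comp_eq_iff {l : x.Γ.Edge → M} {hl : x.IsPoint l} {l' : y.Γ.Edge → M}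
    {hl' : y.IsPoint l'} (c : x ⟶ y) :
    y.pt l' hl' ≫ CombDiv.cones.map c.op = x.pt l hl ↔
      (∀ e, l ((CombDiv.Hom.c c).onE e) = l' e) ∧
        ∀ e, e ∉ Set.range (CombDiv.Hom.c c).onE → l e = 0 := by
  rw [← evalLin_eq_extendZero (CombDiv.Hom.c c).onE_inj]
  constructor
  · intro h f hf
    exact (congrArg (fun k => (Cone.Hom.toLin k (⟨f, hf⟩ : (dualCone M).cone)).1) h).symm
  · exact fun h => dualHom_ext fun f => (h f.1 f.2).symm

theorem IsPoint.map {l : x.Γ.Edge → M} (hl : x.IsPoint l) (φ : M ⟶ N) :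
    x.IsPoint fun e => Mon.toHom φ (l e) := by
  obtain ⟨α, hα⟩ := hl
  refine ⟨fun v => gpMap (Mon.toHom φ) (α v), ?_⟩
  have := hα.map (gpMap (Mon.toHom φ))
  simp only [gpMap_toGp] at this
  exact this

theorem dualMap_comp_pt (φ : M ⟶ N) (l : x.Γ.Edge → M) (hl : x.IsPoint l) :
    dualMap φ ≫ x.pt l hl = x.pt _ (hl.map φ) := rfl

theorem hom_cancel {z : CombDiv} {c : x ⟶ y} {d d' : y ⟶ z} (h : c ≫ d = c ≫ d') : d = d' :=
  CombDiv.Hom.ext (Graph.Contraction.comp_cancel (congrArg CombDiv.Hom.c h))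

end CombDiv

theorem Graph.isPL_unique {Γ : Graph} {A : Type*} [AddCommGroup A] {s : Γ.Flow} {l : Γ.Edge → A}
    {α α' : Γ.V → A} (h : IsPL s l α) (h' : IsPL s l α') {v : Γ.V} (hv : α v = α' v) : α = α' := by
  ext w
  obtain ⟨p, hp⟩ := exists_isPath v w
  have := (h.pathVal hp).symm.trans (h'.pathVal hp)
  rw [hv] at this
  exact sub_left_injective this

namespace Graph.Contraction

variable {Γ Δ Θ : Graph} (c : Contraction Γ Δ) {A : Type*}

theorem forall_onE {B : Type*} {F : A → B} {l : Γ.Edge → A} {l' : Δ.Edge → B} :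
    (∀ e, F (l (c.onE e)) = l' e) ↔ ∀ d, F (l (Γ.edge (c.onD d))) = l' (Δ.edge d) := by
  constructor
  · exact fun h d => h (Δ.edge d)
  · intro h e
    obtain ⟨d, rfl⟩ := Δ.edge_surjective e
    exact h d

theorem forall_not_range_onE {P : Γ.Edge → Prop} :
    (∀ e, e ∉ Set.range c.onE → P e) ↔ ∀ d, d ∉ Set.range c.onD → P (Γ.edge d) := by
  constructor
  · exact fun h d hd => h _ fun h' => hd (c.edge_mem_range.1 h')
  · intro h e he
    obtain ⟨d, rfl⟩ := Γ.edge_surjective e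
    exact h d fun h' => he (c.edge_mem_range.2 h')

/-- A contraction which contracts exactly the edges of length zero factors over every contraction
of edges of length zero. -/
theorem exists_factor [Zero A] (c' : Contraction Γ Θ) {l₁ : Γ.Edge → A} {l : Δ.Edge → A}
    {l' : Θ.Edge → A} (hl' : ∀ e, l' e ≠ 0) (h1 : ∀ e, l₁ (c.onE e) = l e)
    (h2 : ∀ e, e ∉ Set.range c.onE → l₁ e = 0) (h1' : ∀ e, l₁ (c'.onE e) = l' e)
    (h2' : ∀ e, e ∉ Set.range c'.onE → l₁ e = 0) :
    ∃ d : Contraction Δ Θ, c.comp d = c' ∧ (∀ e, l (d.onE e) = l' e) ∧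
      ∀ e, e ∉ Set.range d.onE → l e = 0 := by
  have hr : Set.range c'.onD ⊆ Set.range c.onD := by
    rintro _ ⟨t, rfl⟩
    -- An edge surviving in `Θ` has nonzero length, so it cannot be among the edges contracted by
    -- `c`.
    by_contra ht
    exact hl' (Θ.edge t) ((h1' (Θ.edge t)).symm.trans (h2 _ fun h => ht (c.edge_mem_range.1 h)))
  have hcomp := comp_factor c c' hr
  have hE : ∀ e, c.onE ((factor c c' hr).onE e) = c'.onE e := fun e => by
    rw [← onE_comp, hcomp]
  refine ⟨factor c c' hr, hcomp, fun e => by rw [← h1, hE, h1'], fun e he => ?_⟩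
  rw [← h1, h2']
  rintro ⟨t, ht⟩
  exact he ⟨t, c.onE_inj (by rw [hE, ht])⟩

end Graph.Contraction

/-! ### Representability of the stack of piecewise linear functions. -/

namespace SigmaDiv

/-- Lengths are nonzero and `M^gp` is torsion-free, so a slope is determined by its equation. -/
theorem slope_ext (X : SigmaDiv) {d : X.Γ.D} {n n' : ℤ}
    (h : X.α (X.Γ.tgt d) - X.α (X.Γ.src d) = n • toGp (X.len (X.Γ.edge d)))
    (h' : X.α (X.Γ.tgt d) - X.α (X.Γ.src d) = n' • toGp (X.len (X.Γ.edge d))) : n = n' := by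
  rw [h, ← sub_eq_zero, ← sub_smul] at h'
  rcases smul_eq_zero.1 h' with h | h
  · exact sub_eq_zero.1 h
  · exact absurd ((Mon.toGp_eq_zero _).1 h) (X.len_ne _)

/-- The flow of slopes. -/
def s (X : SigmaDiv) : X.Γ.Flow :=
  ⟨fun d => (X.slope d).choose, fun d => by
    refine X.slope_ext (X.slope (X.Γ.rev d)).choose_spec ?_
    rw [X.Γ.edge_rev, X.Γ.tgt_rev, neg_smul, ← (X.slope d).choose_spec, neg_sub]
    rfl⟩

theorem isPL (X : SigmaDiv) : Graph.IsPL X.s (fun e => toGp (X.len e)) X.α :=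
  fun d => (X.slope d).choose_spec

theorem slope_unique (X : SigmaDiv) {d : X.Γ.D} {n : ℤ}
    (h : X.α (X.Γ.tgt d) - X.α (X.Γ.src d) = n • toGp (X.len (X.Γ.edge d))) : n = X.s.1 d :=
  X.slope_ext h (X.isPL d)

theorem s_eq_of_isPL (X : SigmaDiv) {s : X.Γ.Flow}
    (h : Graph.IsPL s (fun e => toGp (X.len e)) X.α) : s = X.s :=
  Subtype.ext (funext fun d => X.slope_unique (h d))

theorem gpLE_of_nonneg (X : SigmaDiv) {d : X.Γ.D} (h : 0 ≤ X.s.1 d) :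
    X.M.GpLE (X.α (X.Γ.src d)) (X.α (X.Γ.tgt d)) := by
  refine ⟨(X.s.1 d).toNat • X.len (X.Γ.edge d), ?_⟩
  rw [X.isPL d, map_nsmul, ← natCast_zsmul, Int.toNat_of_nonneg h]

theorem not_gpLE_of_pos (X : SigmaDiv) {d : X.Γ.D} (h : 0 < X.s.1 d) :
    ¬ X.M.GpLE (X.α (X.Γ.tgt d)) (X.α (X.Γ.src d)) := by
  intro h'
  have h1 := Mon.gpLE_antisymm (X.gpLE_of_nonneg h.le) h'
  have h2 := X.isPL d
  rw [h1, sub_self] at h2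
  rcases smul_eq_zero.1 h2.symm with h3 | h3
  · exact absurd h3 h.ne'
  · exact absurd ((Mon.toGp_eq_zero _).1 h3) (X.len_ne _)

/-- Values increase weakly along edges with `s ≥ 0` and strictly where `s > 0`. A closed path
through an edge of positive slope would contradict antisymmetry of the order on `M^gp`. -/
theorem acyclic (X : SigmaDiv) : X.Γ.Acyclic X.s := by
  intro d hd hp
  refine X.not_gpLE_of_pos hd ?_
  generalize X.Γ.src d = v at hp
  induction hp with
  | refl => exact X.M.gpLE_refl _
  | tail _ h ih =>
    obtain ⟨d', h0, rfl, rfl⟩ := h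
    exact Mon.gpLE_trans ih (X.gpLE_of_nonneg h0)

/-- The underlying graph with its flow. -/
def comb (X : SigmaDiv) : CombDiv := ⟨X.Γ, X.s, X.acyclic⟩

theorem isPoint (X : SigmaDiv) : X.comb.IsPoint X.len := ⟨X.α, X.isPL⟩

/-- The point of the cone given by the lengths. -/
def el (X : SigmaDiv) : dualCone X.M ⟶ X.comb.cone := X.comb.pt X.len X.isPoint

/-- Applying `φ` to the slope equation of a surviving edge gives an equation with the same integer,
and slopes on `Y` are unique. -/
theorem flow_eq {X Y : SigmaDiv} (f : SigmaDiv.Hom X Y) : f.c.flow X.s = Y.s := by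
  refine Y.s_eq_of_isPL fun d => ?_
  rw [← f.c.onV_tgt, ← f.c.onV_src, f.value, f.value, ← map_sub, X.isPL, map_zsmul, gpMap_toGp,
    f.len_onD]
  rfl

/-- The functor forgetting lengths and values. -/
def combFunctor : SigmaDiv ⥤ CombDiv where
  obj := comb
  map f := ⟨SigmaDiv.Hom.c f, flow_eq f⟩
  map_id _ := rfl
  map_comp _ _ := rfl

/-- The functor forgetting lengths and values, with the point of the cone given by the lengths. -/
def pointFunctor : PointFunctor CombDiv.cones SigmaDiv.proj where
  U := combFunctor
  el := el
  compat {X Y} f := by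
    refine Eq.trans (CombDiv.dualMap_comp_pt (x := X.comb) _ _ _)
      ((CombDiv.pt_comp_eq_iff (x := X.comb) (y := Y.comb) _).2 ⟨?_, ?_⟩).symm
    · exact (Graph.Contraction.forall_onE (F := Mon.toHom f.φ) (l := X.len) f.c).2 f.len_onD
    · exact f.c.forall_not_range_onE.2 f.len_contracted

/-- Compatibility with the values is automatic: the pullback of `Y.α` and the image of `X.α` have
the same slopes and lengths and both vanish at the root. -/
theorem exists_hom {X Y : SigmaDiv} (φ : X.M ⟶ Y.M) (c : X.Γ.Contraction Y.Γ)
    (hs : c.flow X.s = Y.s)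
    (h1 : ∀ e, Mon.toHom φ (X.len (c.onE e)) = Y.len e)
    (h2 : ∀ e, e ∉ Set.range c.onE → Mon.toHom φ (X.len e) = 0) :
    ∃ f : SigmaDiv.Hom X Y, f.φ = φ ∧ f.c = c := by
  refine ⟨⟨φ, c, fun d => h1 (Y.Γ.edge d), c.forall_not_range_onE.1 h2, fun v => ?_⟩, rfl, rfl⟩
  have e1 : Graph.IsPL X.s (fun e => toGp (Mon.toHom φ (X.len e)))
      fun v => gpMap (Mon.toHom φ) (X.α v) := by
    have := X.isPL.map (gpMap (Mon.toHom φ))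
    simp only [gpMap_toGp] at this
    exact this
  have e2 := c.isPL_comp (s := X.s) (l := fun e => toGp (Mon.toHom φ (X.len e)))
    (l' := fun e => toGp (Y.len e)) (fun e => by rw [h1]) (fun e he => by rw [h2 e he, map_zero])
    (α := Y.α) (by rw [hs]; exact Y.isPL)
  refine congrFun (Graph.isPL_unique e2 e1 (v := X.Γ.root) ?_) v
  rw [c.onV_root, Y.root, X.root, map_zero]

/-- The two functions have the same slopes and lengths on `Γ`, so they differ by a constant, which
does not affect the order. This makes the factored contraction monotone in the ordered case. -/
theorem gpLE_iff_of_contraction (X : SigmaDiv) {Γ : Graph} {s : Γ.Flow} (c : Γ.Contraction X.Γ)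
    (hs : c.flow s = X.s) {l : Γ.Edge → X.M} (h1 : ∀ e, l (c.onE e) = X.len e)
    (h2 : ∀ e, e ∉ Set.range c.onE → l e = 0) {α : Γ.V → Gp X.M}
    (hα : Graph.IsPL s (fun e => toGp (l e)) α) (v w : Γ.V) :
    X.M.GpLE (X.α (c.onV v)) (X.α (c.onV w)) ↔ X.M.GpLE (α v) (α w) := by
  have e := c.isPL_comp (s := s) (l := fun e => toGp (l e))
    (l' := fun e => toGp (X.len e)) (fun e => by rw [h1]) (fun e he => by rw [h2 e he, map_zero])
    (α := X.α) (by rw [hs]; exact X.isPL)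
  have h := congrFun (Graph.isPL_unique (e.sub_const (X.α (c.onV v))) (hα.sub_const (α v)) (v := v)
    (by rw [sub_self, sub_self])) w
  rw [Mon.GpLE, Mon.GpLE, h]

section Contract

variable {M : Mon} {Γ : Graph} {s : Γ.Flow} (l : Γ.Edge → M) {α : Γ.V → Gp M}
  (hα : Graph.IsPL s (fun e => toGp (l e)) α)

theorem contract_rev (d : Γ.D) : l (Γ.edge (Γ.rev d)) ≠ 0 ↔ l (Γ.edge d) ≠ 0 := by
  rw [Γ.edge_rev]

/-- The contraction of the edges of length zero. -/
def zeroContraction : Γ.Contraction (Γ.contract (fun d => l (Γ.edge d) ≠ 0) (contract_rev l)) :=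
  Γ.contraction _ _

theorem zeroContraction_onE {e : Γ.Edge} (he : e ∉ Set.range (zeroContraction l).onE) :
    l e = 0 := by
  revert e
  rw [Graph.Contraction.forall_not_range_onE (P := fun e => l e = 0)]
  intro d hd
  rw [zeroContraction, Γ.mem_range_contraction] at hd
  exact not_not.1 hd

theorem zeroContraction_onE_ne (e) : l ((zeroContraction l).onE e) ≠ 0 := by
  obtain ⟨d, rfl⟩ := Graph.edge_surjective _ e
  exact d.2

theorem exists_contract (hα : Graph.IsPL s (fun e => toGp (l e)) α) :
    ∃ α' : (Γ.contract (fun d => l (Γ.edge d) ≠ 0) (contract_rev l)).V → Gp M,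
    Graph.IsPL ((zeroContraction l).flow s) (fun e => toGp (l ((zeroContraction l).onE e))) α' ∧
      ∀ v, α' ((zeroContraction l).onV v) = α v :=
  (zeroContraction l).exists_isPL (fun _ => rfl)
    (fun e he => by rw [zeroContraction_onE l he, map_zero]) hα

/-- The tropical curve with a piecewise linear function obtained by contracting the edges of length
zero and normalizing the function. -/
def contract : SigmaDiv where
  M := M
  Γ := Γ.contract (fun d => l (Γ.edge d) ≠ 0) (contract_rev l)
  len e := l ((zeroContraction l).onE e)
  len_ne := zeroContraction_onE_ne l
  α v := (exists_contract l hα).choose v - (exists_contract l hα).choose (Graph.root _)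
  slope d := ⟨_, ((exists_contract l hα).choose_spec.1.sub_const _) d⟩
  root := sub_self _

theorem contract_s : (contract l hα).s = (zeroContraction l).flow s :=
  ((contract l hα).s_eq_of_isPL ((exists_contract l hα).choose_spec.1.sub_const _)).symm

theorem contract_α (v : Γ.V) : (contract l hα).α ((zeroContraction l).onV v) = α v - α Γ.root := by
  change (exists_contract l hα).choose _ - (exists_contract l hα).choose _ = _
  rw [← (zeroContraction l).onV_root, (exists_contract l hα).choose_spec.2,
    (exists_contract l hα).choose_spec.2]

end Contract

theorem exists_factor (X : SigmaDiv) {x y : CombDiv} (c : x ⟶ y) (d : x ⟶ X.comb)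
    {l₁ : x.Γ.Edge → X.M} {l : y.Γ.Edge → X.M}
    (h1 : ∀ e, l₁ ((CombDiv.Hom.c c).onE e) = l e)
    (h2 : ∀ e, e ∉ Set.range (CombDiv.Hom.c c).onE → l₁ e = 0)
    (h1' : ∀ e, l₁ ((CombDiv.Hom.c d).onE e) = X.len e)
    (h2' : ∀ e, e ∉ Set.range (CombDiv.Hom.c d).onE → l₁ e = 0) :
    ∃ d' : y ⟶ X.comb, c ≫ d' = d ∧ (∀ e, l ((CombDiv.Hom.c d').onE e) = X.len e) ∧
      ∀ e, e ∉ Set.range (CombDiv.Hom.c d').onE → l e = 0 := by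
  obtain ⟨k, hk, hk1, hk2⟩ := (CombDiv.Hom.c c).exists_factor (CombDiv.Hom.c d) X.len_ne
    h1 h2 h1' h2'
  refine ⟨⟨k, ?_⟩, CombDiv.Hom.ext hk, hk1, hk2⟩
  rw [← CombDiv.Hom.flow c]
  refine Eq.trans ?_ (CombDiv.Hom.flow d)
  rw [← hk]
  rfl

theorem isGood : pointFunctor.IsGood where
  full {X Y} φ c h := by
    change dualMap φ ≫ X.el = Y.el ≫ CombDiv.cones.map c.op at h
    have h' := (CombDiv.pt_comp_eq_iff (x := X.comb) (y := Y.comb) (hl := X.isPoint.map φ)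
      (hl' := Y.isPoint) c).1 h.symm
    obtain ⟨f, hf, hc⟩ := exists_hom (X := X) (Y := Y) φ (CombDiv.Hom.c c) (CombDiv.Hom.flow c)
      h'.1 h'.2
    exact ⟨f, hf, CombDiv.Hom.ext hc⟩
  faithful f g h1 h2 := SigmaDiv.Hom.ext h1 (congrArg CombDiv.Hom.c h2)
  -- The witness is the curve obtained by contracting all edges of length zero.
  surj M x h := by
    obtain ⟨l, ⟨α, hα⟩, rfl⟩ := x.exists_pt h
    refine ⟨contract l hα, Iso.refl M, ⟨zeroContraction l, (contract_s l hα).symm⟩, ?_⟩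
    refine Eq.trans ?_ (Category.id_comp _).symm
    exact ((CombDiv.pt_comp_eq_iff (x := x) (y := (contract l hα).comb)
      (hl := ⟨α, hα⟩) (hl' := (contract l hα).isPoint) _).2
      ⟨fun _ => rfl, fun e he => zeroContraction_onE l he⟩).symm
  factor X {x y} c d h hc := by
    obtain ⟨l, hl, rfl⟩ := y.exists_pt h
    obtain ⟨l₁, hl₁, h₁⟩ := x.exists_pt (y.pt l hl ≫ CombDiv.cones.map c.op)
    have e1 := (CombDiv.pt_comp_eq_iff c).1 h₁
    have e2 := (CombDiv.pt_comp_eq_iff (y := X.comb) (hl' := X.isPoint) d).1 (hc.symm.trans h₁)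
    obtain ⟨d', hd, hd1, hd2⟩ := X.exists_factor c d e1.1 e1.2 e2.1 e2.2
    refine ⟨d', ⟨hd, (CombDiv.pt_comp_eq_iff (x := y) (y := X.comb)
      (hl' := X.isPoint) d').2 ⟨hd1, hd2⟩⟩, ?_⟩
    rintro d'' ⟨h1, -⟩
    -- Uniqueness holds because contractions are epimorphisms.
    exact CombDiv.hom_cancel (h1.trans hd.symm)

end SigmaDiv

/-! ## The stack of graphs with a piecewise linear function with ordered values -/

namespace CombOrd

theorem exists_min (x : CombOrd) : ∃ v₀, ∀ u, x.le v₀ u := by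
  have : IsTrans x.base.Γ.V (flip x.le) := ⟨fun u v w h h' => x.le_trans _ _ _ h' h⟩
  have hd : Directed (flip x.le) (fun v : x.base.Γ.V => v) := fun v w => by
    rcases x.le_total v w with h | h
    · exact ⟨v, (x.le_total v v).elim (fun h => h) fun h => h, h⟩
    · exact ⟨w, h, (x.le_total w w).elim (fun h => h) fun h => h⟩
  have : Nonempty x.base.Γ.V := ⟨x.base.Γ.root⟩
  exact hd.finite_le fun v => v

/-- The inequalities say that the piecewise linear function is monotone. -/
theorem inequalities_iff (x : CombOrd) {l : x.base.Γ.Edge → ℝ} {α : x.base.Γ.V → ℝ}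
    (h : Graph.IsPL x.base.s l α) : x.Inequalities l ↔ ∀ v w, x.le v w → α v ≤ α w := by
  constructor
  · intro hi v w hvw
    obtain ⟨v₀, hv₀⟩ := x.exists_min
    obtain ⟨p, hp⟩ := Graph.exists_isPath v₀ v
    obtain ⟨q, hq⟩ := Graph.exists_isPath v₀ w
    have := hi v₀ hv₀ v w p q hp hq hvw
    rw [Graph.pathSum_eq_of_isPL h hp, Graph.pathSum_eq_of_isPL h hq] at this
    linarith
  · intro hm v₀ _ w w' p q hp hq hw
    rw [Graph.pathSum_eq_of_isPL h hp, Graph.pathSum_eq_of_isPL h hq]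
    linarith [hm w w' hw]

theorem mem_cone_iff (x : CombOrd) (l : x.base.Γ.Edge → ℝ) :
    l ∈ x.cone.cone ↔ l ∈ x.base.cone.cone ∧ ∀ v w, x.le v w →
      x.base.Γ.pathSum x.base.s l (x.base.Γ.rootPath v) ≤
        x.base.Γ.pathSum x.base.s l (x.base.Γ.rootPath w) :=
  and_congr_right fun h => x.inequalities_iff ((Graph.mem_cone_iff _ _).1 h).2

theorem mem_cone_of_isPL (x : CombOrd) {l : x.base.Γ.Edge → ℝ} (h0 : ∀ e, 0 ≤ l e)
    {α : x.base.Γ.V → ℝ} (h : Graph.IsPL x.base.s l α) (hm : ∀ v w, x.le v w → α v ≤ α w) :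
    l ∈ x.cone.cone := ⟨Graph.mem_cone_of_isPL _ h0 h, (x.inequalities_iff h).2 hm⟩

theorem isConeStackDiagram : IsConeStackDiagram CombOrd.cones := by
  refine ⟨fun i => ?_, fun {i j} f => ?_⟩
  · let x := i.unop
    refine Cone.isRationalPolyhedral_of (C := x.cone)
      (κ := (x.base.Γ.Edge ⊕ x.base.Γ.D ⊕ x.base.Γ.D) ⊕
        {p : x.base.Γ.V × x.base.Γ.V // x.le p.1 p.2}) (LinearEquiv.refl ℝ _)
      (fun _ => Iff.rfl) (Sum.elim (x.base.Γ.coneForm x.base.s) fun p =>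
        x.base.Γ.pathLin x.base.s (x.base.Γ.rootPath p.1.2) -
          x.base.Γ.pathLin x.base.s (x.base.Γ.rootPath p.1.1)) ?_ ?_ fun l hl e => hl.1.1 e
    · rintro (k | p) l hl
      · exact Graph.coneForm_int _ _ hl k
      · obtain ⟨a, ha⟩ := x.base.Γ.pathSum_int x.base.s hl (x.base.Γ.rootPath p.1.2)
        obtain ⟨b, hb⟩ := x.base.Γ.pathSum_int x.base.s hl (x.base.Γ.rootPath p.1.1)
        refine ⟨a - b, ?_⟩
        change x.base.Γ.pathSum x.base.s l _ - x.base.Γ.pathSum x.base.s l _ = _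
        rw [ha, hb, Int.cast_sub]
    · intro l
      refine (x.mem_cone_iff l).trans
        ((and_congr_left' (Graph.mem_cone_iff_coneForm x.base l)).trans ?_)
      constructor
      · rintro ⟨h1, h2⟩ (k | p)
        · exact h1 k
        · exact sub_nonneg.2 (h2 _ _ p.2)
      · exact fun h => ⟨fun k => h (.inl k), fun v w hvw =>
          sub_nonneg.1 (h (.inr ⟨(v, w), hvw⟩))⟩
  · let x : CombOrd := j.unop
    let y : CombOrd := i.unop
    let c : Graph.Contraction x.base.Γ y.base.Γ := CombDiv.Hom.c (CombOrd.Hom.base f.unop)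
    have hflow : c.flow x.base.s = y.base.s := CombDiv.Hom.flow (CombOrd.Hom.base f.unop)
    refine Cone.isFaceInclusion_of (C := y.cone) (D := x.cone)
      (hc := CombOrd.lengths_mem f.unop)
      (hl := fun _ h => extendZero_int (Graph.Contraction.onE_inj _) h)
      -- Besides the lengths of contracted edges, the face is cut out by one form for each pair
      -- ordered by `x` whose images are ordered the other way by `y`. Such images are tied, so the
      -- difference of values has to vanish.
      (κ := {e // e ∉ Set.range c.onE} ⊕
        {p : x.base.Γ.V × x.base.Γ.V // x.le p.1 p.2 ∧ y.le (c.onV p.2) (c.onV p.1)})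
      (extendZero_injective c.onE_inj)
      (Sum.elim (fun e l => l e.1) fun p l =>
        x.base.Γ.pathSum x.base.s l (x.base.Γ.rootPath p.1.2) -
          x.base.Γ.pathSum x.base.s l (x.base.Γ.rootPath p.1.1)) ?_ ?_ ?_ (fun l hl => ?_)
      fun l hl => mem_intLattice_of_extendZero c.onE_inj hl
    · rintro (e | p) l l'
      · rfl
      · have := fun p => x.base.Γ.pathSum_add x.base.s l l' p
        simp only [Sum.elim_inr]
        erw [this, this]
        ring
    · rintro (e | p) r l
      · rfl
      · have := fun p => x.base.Γ.pathSum_smul x.base.s r l p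
        simp only [Sum.elim_inr]
        erw [this, this]
        ring
    · rintro (e | p) l hl
      · exact hl.1.1 e.1
      · exact sub_nonneg.2 (((x.mem_cone_iff l).1 hl).2 _ _ p.2.1)
    · have hl' := (Graph.mem_cone_iff _ _).1 hl.1
      have hm := ((x.mem_cone_iff l).1 hl).2
      constructor
      · rintro ⟨l', h, rfl⟩ (e | p)
        · exact extendZero_apply' l' e.2
        · obtain ⟨α, hα, hαc⟩ := c.exists_isPL (l' := l')
            (fun e => extendZero_apply c.onE_inj l' e) (fun e he => extendZero_apply' l' he) hl'.2
          rw [hflow] at hα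
          have h1 := (y.inequalities_iff hα).1 h.2 _ _ p.2.2
          rw [hαc, hαc] at h1
          exact sub_eq_zero.2 (le_antisymm h1 (hm _ _ p.2.1))
      · intro h
        obtain ⟨α, hα, hαc⟩ := c.exists_isPL (l' := fun e => l (c.onE e)) (fun _ => rfl)
          (fun e he => h (.inl ⟨e, he⟩)) hl'.2
        rw [hflow] at hα
        refine ⟨fun e => l (c.onE e), y.mem_cone_of_isPL (fun e => hl'.1 _) hα fun v w hvw => ?_,
          extendZero_restrict c.onE_inj fun e he => h (.inl ⟨e, he⟩)⟩
        obtain ⟨v, rfl⟩ := c.onV_surj v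
        obtain ⟨w, rfl⟩ := c.onV_surj w
        rw [hαc, hαc]
        -- If `x` orders the pair oppositely to `y`, the pair is one of those whose form vanishes,
        -- and the two values agree.
        rcases x.le_total v w with h' | h'
        · exact hm _ _ h'
        · exact (sub_eq_zero.1 (h (.inr ⟨(w, v), h', hvw⟩))).le

variable {M N : Mon} (x : CombOrd)

/-- Lengths in a monoid for which there is a piecewise linear function with the given slopes and
ordering. -/
def IsPoint (l : x.base.Γ.Edge → M) : Prop := ∃ α : x.base.Γ.V → Gp M,
  Graph.IsPL x.base.s (fun e => toGp (l e)) α ∧ ∀ v w, x.le v w → M.GpLE (α v) (α w)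

theorem _root_.TropModuli.Mon.GpLE.eval {x y : Gp M} (h : M.GpLE x y) {f : M →+ ℝ}
    (hf : ∀ m, 0 ≤ f m) : gpEval f x ≤ gpEval f y := by
  obtain ⟨m, hm⟩ := h
  have := hf m
  rw [← gpEval_toGp, hm, map_sub] at this
  exact sub_nonneg.1 this

theorem _root_.TropModuli.Mon.GpLE.map {x y : Gp M} (h : M.GpLE x y) (φ : M ⟶ N) :
    N.GpLE (gpMap (Mon.toHom φ) x) (gpMap (Mon.toHom φ) y) := by
  obtain ⟨m, hm⟩ := h
  exact ⟨Mon.toHom φ m, by rw [← map_sub, ← hm, gpMap_toGp]⟩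

/-- The morphism of cones given by lengths in a monoid. -/
def pt (l : x.base.Γ.Edge → M) (hl : x.IsPoint l) : dualCone M ⟶ x.cone :=
  Cone.homOfLinear (C := dualCone M) (D := x.cone) (evalLin l)
    (fun f hf => x.mem_cone_of_isPL (fun e => hf (l e)) (hl.choose_spec.1.eval f)
      fun v w hvw => (hl.choose_spec.2 v w hvw).eval hf)
    fun _ hf => evalLin_mem_intLattice l hf

theorem exists_pt (h : dualCone M ⟶ x.cone) : ∃ l hl, h = x.pt l hl := by
  choose l hl using fun e : x.base.Γ.Edge => exists_coord h (LinearMap.proj (R := ℝ)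
    (φ := fun _ : x.base.Γ.Edge => ℝ) e) (fun y hy => hy.1.1 e) fun y hy => hy e
  have hmem : ∀ f : M →+ ℝ, (∀ m, 0 ≤ f m) → evalLin l f ∈ x.cone.cone := fun f hf => by
    have h2 : (Cone.Hom.toLin h (⟨f, hf⟩ : (dualCone M).cone)).1 = evalLin l f :=
      funext fun e => hl e f hf
    rw [← h2]
    exact (Cone.Hom.toLin h (⟨f, hf⟩ : (dualCone M).cone)).2
  obtain ⟨α, hα⟩ := Graph.exists_isPL_of_eval (Γ := x.base.Γ) (s := x.base.s) (l := l)
    fun f hf => ⟨_, ((Graph.mem_cone_iff x.base _).1 (hmem f hf.nonneg).1).2⟩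
  refine ⟨l, ⟨α, hα, fun v w hvw => Mon.mem_range_toGp _ fun f hf => ?_⟩,
    dualHom_ext fun f => funext fun e => hl e f.1 f.2⟩
  rw [map_sub]
  exact sub_nonneg.2 ((x.inequalities_iff (hα.eval f)).1 (hmem f hf.nonneg).2 v w hvw)

variable {x} {y : CombOrd}

theorem pt_comp_eq_iff {l : x.base.Γ.Edge → M} {hl : x.IsPoint l} {l' : y.base.Γ.Edge → M}
    {hl' : y.IsPoint l'} (c : x ⟶ y) :
    y.pt l' hl' ≫ CombOrd.cones.map c.op = x.pt l hl ↔
      (∀ e, l ((CombDiv.Hom.c (CombOrd.Hom.base c)).onE e) = l' e) ∧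
        ∀ e, e ∉ Set.range (CombDiv.Hom.c (CombOrd.Hom.base c)).onE → l e = 0 := by
  rw [← evalLin_eq_extendZero (CombDiv.Hom.c (CombOrd.Hom.base c)).onE_inj]
  constructor
  · intro h f hf
    exact (congrArg (fun k => (Cone.Hom.toLin k (⟨f, hf⟩ : (dualCone M).cone)).1) h).symm
  · exact fun h => dualHom_ext fun f => (h f.1 f.2).symm

theorem IsPoint.map {l : x.base.Γ.Edge → M} (hl : x.IsPoint l) (φ : M ⟶ N) :
    x.IsPoint fun e => Mon.toHom φ (l e) := by
  obtain ⟨α, hα, hm⟩ := hl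
  refine ⟨fun v => gpMap (Mon.toHom φ) (α v), ?_, fun v w hvw => (hm v w hvw).map φ⟩
  have := hα.map (gpMap (Mon.toHom φ))
  simp only [gpMap_toGp] at this
  exact this

theorem dualMap_comp_pt (φ : M ⟶ N) (l : x.base.Γ.Edge → M) (hl : x.IsPoint l) :
    dualMap φ ≫ x.pt l hl = x.pt _ (hl.map φ) := rfl

end CombOrd

/-! ### Representability of the stack of functions with ordered values. -/

namespace SigmaOrd

/-- The underlying graph with its flow and ordering. -/
def comb (X : SigmaOrd) : CombOrd where
  base := X.obj.comb
  le v w := X.obj.M.GpLE (X.obj.α v) (X.obj.α w)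
  le_trans _ _ _ h h' := Mon.gpLE_trans h h'
  le_total := X.property
  flow_pos _ h := ⟨X.obj.gpLE_of_nonneg h.le, X.obj.not_gpLE_of_pos h⟩
  flow_zero _ h := X.obj.gpLE_of_nonneg h.ge

theorem isPoint (X : SigmaOrd) : X.comb.IsPoint X.obj.len :=
  ⟨X.obj.α, X.obj.isPL, fun _ _ h => h⟩

/-- The point of the cone given by the lengths. -/
def el (X : SigmaOrd) : dualCone X.obj.M ⟶ X.comb.cone := X.comb.pt X.obj.len X.isPoint

theorem mono {X Y : SigmaDiv} (f : SigmaDiv.Hom X Y) {v w : X.Γ.V}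
    (h : X.M.GpLE (X.α v) (X.α w)) : Y.M.GpLE (Y.α (f.c.onV v)) (Y.α (f.c.onV w)) := by
  rw [f.value, f.value]
  exact h.map f.φ

/-- The functor forgetting lengths and values. -/
def combFunctor : SigmaOrd ⥤ CombOrd where
  obj := comb
  map f := ⟨SigmaDiv.combFunctor.map f.hom, fun _ _ h => mono f.hom h⟩
  map_id _ := rfl
  map_comp _ _ := rfl

/-- The functor forgetting lengths and values, with the point of the cone given by the lengths. -/
def pointFunctor : PointFunctor CombOrd.cones SigmaOrd.proj where
  U := combFunctor
  el := el
  compat {X Y} f := by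
    refine Eq.trans (CombOrd.dualMap_comp_pt (x := X.comb) _ _ _)
      ((CombOrd.pt_comp_eq_iff (x := X.comb) (y := Y.comb) _).2 ⟨?_, ?_⟩).symm
    · exact (Graph.Contraction.forall_onE (F := Mon.toHom (SigmaDiv.Hom.φ f.hom))
        (l := X.obj.len) (SigmaDiv.Hom.c f.hom)).2 (SigmaDiv.Hom.len_onD f.hom)
    · exact (SigmaDiv.Hom.c f.hom).forall_not_range_onE.2 (SigmaDiv.Hom.len_contracted f.hom)

theorem isGood : pointFunctor.IsGood where
  full {X Y} φ c h := by
    change dualMap φ ≫ X.el = Y.el ≫ CombOrd.cones.map c.op at h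
    have h' := (CombOrd.pt_comp_eq_iff (x := X.comb) (y := Y.comb) (hl := X.isPoint.map φ)
      (hl' := Y.isPoint) c).1 h.symm
    obtain ⟨f, hf, hc⟩ := SigmaDiv.exists_hom (X := X.obj) (Y := Y.obj) φ
      (CombDiv.Hom.c (CombOrd.Hom.base c)) (CombDiv.Hom.flow (CombOrd.Hom.base c)) h'.1 h'.2
    exact ⟨⟨f⟩, hf, CombOrd.Hom.ext (CombDiv.Hom.ext hc)⟩
  faithful f g h1 h2 := ObjectProperty.hom_ext _ (SigmaDiv.Hom.ext h1
    (congrArg (fun k => CombDiv.Hom.c (CombOrd.Hom.base k)) h2))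
  surj M x h := by
    obtain ⟨l, ⟨α, hα, hm⟩, rfl⟩ := x.exists_pt h
    have hle : ∀ v w, x.le v w → M.GpLE
        ((SigmaDiv.contract l hα).α ((SigmaDiv.zeroContraction l).onV v))
        ((SigmaDiv.contract l hα).α ((SigmaDiv.zeroContraction l).onV w)) := fun v w hvw => by
      rw [SigmaDiv.contract_α, SigmaDiv.contract_α, Mon.GpLE, sub_sub_sub_cancel_right]
      exact hm v w hvw
    let X : SigmaOrd := ⟨SigmaDiv.contract l hα, fun v w => by
      obtain ⟨v, rfl⟩ := (SigmaDiv.zeroContraction l).onV_surj v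
      obtain ⟨w, rfl⟩ := (SigmaDiv.zeroContraction l).onV_surj w
      exact (x.le_total v w).imp (hle v w) (hle w v)⟩
    refine ⟨X, Iso.refl M,
      ⟨⟨SigmaDiv.zeroContraction l, (SigmaDiv.contract_s l hα).symm⟩, hle⟩, ?_⟩
    refine Eq.trans ?_ (Category.id_comp _).symm
    exact ((CombOrd.pt_comp_eq_iff (x := x) (y := X.comb)
      (hl := ⟨α, hα, hm⟩) (hl' := X.isPoint) _).2
      ⟨fun _ => rfl, fun e he => SigmaDiv.zeroContraction_onE l he⟩).symm
  factor X {x y} c d h hc := by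
    obtain ⟨l, hl, rfl⟩ := y.exists_pt h
    obtain ⟨l₁, hl₁, h₁⟩ := x.exists_pt (y.pt l hl ≫ CombOrd.cones.map c.op)
    have e1 := (CombOrd.pt_comp_eq_iff c).1 h₁
    have e2 := (CombOrd.pt_comp_eq_iff (y := X.comb) (hl' := X.isPoint) d).1 (hc.symm.trans h₁)
    obtain ⟨b, hb, hb1, hb2⟩ := X.obj.exists_factor (CombOrd.Hom.base c) (CombOrd.Hom.base d)
      e1.1 e1.2 e2.1 e2.2
    obtain ⟨α, hα, hm⟩ := hl
    -- The factorization of the underlying contraction respects the ordering, since the order on `X`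
    -- is the order of values of the piecewise linear function on `y`.
    let d' : y ⟶ X.comb := ⟨b, fun v w hvw =>
      (X.obj.gpLE_iff_of_contraction (CombDiv.Hom.c b) (CombDiv.Hom.flow b) hb1 hb2 hα v w).2
        (hm v w hvw)⟩
    refine ⟨d', ⟨CombOrd.Hom.ext hb, (CombOrd.pt_comp_eq_iff (x := y) (y := X.comb)
      (hl' := X.isPoint) d').2 ⟨hb1, hb2⟩⟩, ?_⟩
    rintro d'' ⟨h1, -⟩
    exact CombOrd.Hom.ext (CombDiv.hom_cancel
      ((congrArg CombOrd.Hom.base h1).trans hb.symm))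

end SigmaOrd

/-! ## Contractions of lines -/

namespace LineContraction

variable {k m n : ℕ} (q : LineContraction k m)

/-- A function which takes the same value at the end points of contracted edges. -/
theorem desc_eq_of_le {A : Type*} {g : Fin (k + 1) → A} {a b : Fin (k + 1)} (hab : a ≤ b)
    (h : ∀ i : Fin k, a ≤ i.castSucc → i.succ ≤ b → g i.castSucc = g i.succ) : g a = g b := by
  induction b using Fin.induction with
  | zero => rw [le_antisymm hab (Fin.zero_le a)]
  | succ j ih =>
    rcases hab.eq_or_lt with rfl | hlt
    · rfl
    · have ha : a ≤ j.castSucc := Fin.le_castSucc_iff.2 hlt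
      rw [ih ha fun i h1 h2 => h i h1 (h2.trans Fin.castSucc_lt_succ.le), h j ha le_rfl]

theorem not_mem_range_of_eq {i : Fin k} (h : q.onV i.castSucc = q.onV i.succ) :
    i ∉ Set.range q.onE := by
  rintro ⟨j, rfl⟩
  rw [q.onV_castSucc, q.onV_succ] at h
  exact Fin.castSucc_lt_succ.ne h

theorem desc_eq {A : Type*} {g : Fin (k + 1) → A}
    (h : ∀ i, i ∉ Set.range q.onE → g i.castSucc = g i.succ) {a b : Fin (k + 1)}
    (hab : q.onV a = q.onV b) : g a = g b := by
  wlog hle : a ≤ b generalizing a b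
  · exact (this hab.symm (le_of_not_ge hle)).symm
  refine desc_eq_of_le hle fun i h1 h2 => h i (q.not_mem_range_of_eq (le_antisymm ?_ ?_))
  · exact q.onV_mono Fin.castSucc_lt_succ.le
  · exact (q.onV_mono h2).trans (hab.symm.le.trans (q.onV_mono h1))

theorem exists_desc {A : Type*} {g : Fin (k + 1) → A}
    (h : ∀ i, i ∉ Set.range q.onE → g i.castSucc = g i.succ) :
    ∃ g' : Fin (m + 1) → A, ∀ a, g' (q.onV a) = g a :=
  ⟨fun x => g (q.onV_surj x).choose, fun a => q.desc_eq h (q.onV_surj (q.onV a)).choose_spec⟩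

theorem eq_onE {i : Fin k} {j : Fin m} (h1 : q.onV i.castSucc = j.castSucc)
    (h2 : q.onV i.succ = j.succ) : q.onE j = i := by
  by_cases hi : i ∈ Set.range q.onE
  · obtain ⟨t, rfl⟩ := hi
    rw [q.onV_castSucc] at h1
    rw [Fin.castSucc_injective m h1]
  · rw [q.collapse i hi, h2] at h1
    exact absurd h1.symm Fin.castSucc_lt_succ.ne

theorem onV_succ_le (i : Fin k) : (q.onV i.succ : ℕ) ≤ q.onV i.castSucc + 1 := by
  by_cases hi : i ∈ Set.range q.onE
  · obtain ⟨t, rfl⟩ := hi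
    rw [q.onV_castSucc, q.onV_succ]
    simp
  · rw [q.collapse i hi]
    omega

/-- The factorization of a contraction over another one which contracts fewer edges. -/
theorem exists_factor (q' : LineContraction k n) (h : Set.range q'.onE ⊆ Set.range q.onE) :
    ∃ r : LineContraction m n, q.comp r = q' := by
  obtain ⟨g, hg⟩ := q.exists_desc (g := q'.onV) fun i hi => q'.collapse i fun h' => hi (h h')
  choose t ht using fun j => h ⟨j, rfl⟩
  refine ⟨⟨g, t, fun a b hab => ?_, fun y => ?_, fun j => ?_, fun j => ?_, fun i hi => ?_⟩, ?_⟩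
  · obtain ⟨a, rfl⟩ := q.onV_surj a
    obtain ⟨b, rfl⟩ := q.onV_surj b
    rcases le_total a b with h' | h'
    · rw [hg, hg]
      exact q'.onV_mono h'
    · rw [le_antisymm hab (q.onV_mono h')]
  · obtain ⟨a, rfl⟩ := q'.onV_surj y
    exact ⟨_, hg a⟩
  · rw [← q.onV_castSucc, hg, ht, q'.onV_castSucc]
  · rw [← q.onV_succ, hg, ht, q'.onV_succ]
  · rw [← q.onV_castSucc, ← q.onV_succ, hg, hg]
    refine q'.collapse _ ?_
    rintro ⟨j, hj⟩
    exact hi ⟨j, q.onE_inj (by rw [ht, hj])⟩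
  · exact LineContraction.ext (funext hg) (funext ht)

theorem comp_cancel {q : LineContraction k m} {r r' : LineContraction m n}
    (h : q.comp r = q.comp r') : r = r' := by
  refine LineContraction.ext (funext fun x => ?_) (funext fun t => q.onE_inj ?_)
  · obtain ⟨v, rfl⟩ := q.onV_surj x
    exact congrFun (congrArg LineContraction.onV h) v
  · exact congrFun (congrArg LineContraction.onE h) t

open Classical in
/-- The contraction of the edges which are not in a given set. -/
theorem exists_range_eq (K : Fin k → Prop) :
    ∃ (m : ℕ) (q : LineContraction k m), ∀ i, i ∈ Set.range q.onE ↔ K i := by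
  let S : Finset (Fin k) := Finset.univ.filter K
  let e : Fin S.card ↪o Fin k := S.orderEmbOfFin rfl
  have he : ∀ i, i ∈ Set.range e ↔ K i := fun i => by
    rw [Finset.range_orderEmbOfFin]
    simp [S]
  -- A vertex of the line is sent to the number of kept edges to its left.
  let f : Fin (k + 1) → ℕ := fun j => (S.filter fun i => i.castSucc < j).card
  have hf : ∀ j, f j < S.card + 1 := fun j => Nat.lt_succ_of_le (Finset.card_filter_le _ _)
  have h1 : ∀ j, f (e j).castSucc = j := fun j => by
    have : (S.filter fun i => i.castSucc < (e j).castSucc) = (Finset.Iio j).map e.toEmbedding := by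
      ext i
      simp only [Finset.mem_filter, Finset.mem_map, Finset.mem_Iio, Fin.castSucc_lt_castSucc_iff]
      constructor
      · rintro ⟨hi, hlt⟩
        obtain ⟨t, rfl⟩ := (he i).2 (Finset.mem_filter.1 hi).2
        exact ⟨t, e.lt_iff_lt.1 hlt, rfl⟩
      · rintro ⟨t, hlt, rfl⟩
        exact ⟨S.orderEmbOfFin_mem rfl t, e.lt_iff_lt.2 hlt⟩
    change Finset.card _ = _
    rw [this, Finset.card_map, Fin.card_Iio]
  have h2 : ∀ j, f (e j).succ = j + 1 := fun j => by
    have : (S.filter fun i => i.castSucc < (e j).succ) = (Finset.Iic j).map e.toEmbedding := by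
      ext i
      simp only [Finset.mem_filter, Finset.mem_map, Finset.mem_Iic, Fin.castSucc_lt_succ_iff]
      constructor
      · rintro ⟨hi, hlt⟩
        obtain ⟨t, rfl⟩ := (he i).2 (Finset.mem_filter.1 hi).2
        exact ⟨t, e.le_iff_le.1 hlt, rfl⟩
      · rintro ⟨t, hlt, rfl⟩
        exact ⟨S.orderEmbOfFin_mem rfl t, e.le_iff_le.2 hlt⟩
    change Finset.card _ = _
    rw [this, Finset.card_map, Fin.card_Iic]
  refine ⟨S.card, ⟨fun j => ⟨f j, hf j⟩, e, fun a b hab => ?_, fun y => ?_, fun j => Fin.ext (h1 j),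
    fun j => Fin.ext (h2 j), fun i hi => Fin.ext ?_⟩, he⟩
  · exact Finset.card_le_card (Finset.monotone_filter_right S fun i _ h => lt_of_lt_of_le h hab)
  · induction y using Fin.lastCases with
    | last =>
      refine ⟨Fin.last k, Fin.ext ?_⟩
      change (S.filter fun i => i.castSucc < Fin.last k).card = S.card
      rw [Finset.filter_true_of_mem fun i _ => Fin.castSucc_lt_last i]
    | cast j => exact ⟨_, Fin.ext (h1 j)⟩
  · change (S.filter fun t => t.castSucc < i.castSucc).card =
      (S.filter fun t => t.castSucc < i.succ).card
    congr 1
    refine Finset.filter_congr fun t ht => ?_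
    rw [Fin.castSucc_lt_castSucc_iff, Fin.castSucc_lt_succ_iff]
    refine ⟨le_of_lt, fun h => lt_of_le_of_ne h ?_⟩
    rintro rfl
    exact hi ((he t).2 (Finset.mem_filter.1 ht).2)

end LineContraction

/-! ## Subdivisions -/

namespace Subdivision

variable {Γ' Γ : Graph} (S : Subdivision Γ' Γ)

theorem exists_piece (d : Γ.D) : ∃ d', Γ'.src d' = S.ι (Γ.src d) ∧ S.π d' = d := by
  obtain ⟨d', h1, h2⟩ := (S.star (Γ.src d)).surjOn (show d ∈ {t | Γ.src t = Γ.src d} from rfl)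
  exact ⟨d', h1, h2⟩

theorem src_π {d : Γ'.D} {v : Γ.V} (h : Γ'.src d = S.ι v) : Γ.src (S.π d) = v :=
  (S.star v).mapsTo h

theorem tgt_π {d : Γ'.D} {v : Γ.V} (h : Γ'.tgt d = S.ι v) : Γ.tgt (S.π d) = v := by
  have := S.src_π (d := Γ'.rev d) h
  rwa [S.π_rev] at this

-- Local balance of the pieces of `d` at a vertex. Pieces of `Γ.rev d` leaving `v` are the reverses
-- of pieces of `d` arriving there. At an exceptional vertex the counts agree; at a vertex of `Γ`
-- the star condition leaves only the contributions of the two ends of `d`.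
open Classical in
theorem card_src (v : Γ'.V) (d : Γ.D) :
    ((Finset.univ.filter fun t => S.π t = d ∧ Γ'.src t = v).card : ℤ) +
        (if v = S.ι (Γ.tgt d) then 1 else 0) =
      (Finset.univ.filter fun t => S.π t = Γ.rev d ∧ Γ'.src t = v).card +
        (if v = S.ι (Γ.src d) then 1 else 0) := by
  by_cases hv : v ∈ Set.range S.ι
  · obtain ⟨v, rfl⟩ := hv
    have key : ∀ d, ((Finset.univ.filter fun t => S.π t = d ∧ Γ'.src t = S.ι v).card : ℤ) =
        if v = Γ.src d then 1 else 0 := by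
      intro d
      split_ifs with h
      · obtain ⟨d', h1, h2⟩ := S.exists_piece d
        rw [← h] at h1
        have : (Finset.univ.filter fun t => S.π t = d ∧ Γ'.src t = S.ι v) = {d'} := by
          ext t
          simp only [Finset.mem_filter, Finset.mem_univ, true_and, Finset.mem_singleton]
          exact ⟨fun ht => (S.star v).injOn ht.2 h1 (ht.1.trans h2.symm),
            fun ht => ht ▸ ⟨h2, h1⟩⟩
        rw [this, Finset.card_singleton, Nat.cast_one]
      · rw [Finset.filter_false_of_mem, Finset.card_empty, Nat.cast_zero]
        rintro t - ⟨rfl, ht⟩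
        exact h (S.src_π ht).symm
    rw [key, key]
    simp only [S.ι_inj.eq_iff]
    rw [add_comm]
    rfl
  · rw [if_neg fun h => hv ⟨_, h.symm⟩, if_neg fun h => hv ⟨_, h.symm⟩]
    obtain ⟨d₁, d₂, hne, hs, hπ⟩ := S.exceptional v hv
    have hm : ∀ t, Γ'.src t = v ↔ t = d₁ ∨ t = d₂ := fun t => by
      have : t ∈ {d | Γ'.src d = v} ↔ t ∈ ({d₁, d₂} : Set Γ'.D) := by rw [hs]
      exact this
    have key : ∀ d, (Finset.univ.filter fun t => S.π t = d ∧ Γ'.src t = v).card =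
        (if S.π d₁ = d then 1 else 0) + if S.π d₂ = d then 1 else 0 := by
      intro d
      have : (Finset.univ.filter fun t => S.π t = d ∧ Γ'.src t = v) =
          ({d₁, d₂} : Finset Γ'.D).filter fun t => S.π t = d := by
        ext t
        simp only [Finset.mem_filter, Finset.mem_univ, true_and, Finset.mem_insert,
          Finset.mem_singleton, hm, and_comm]
      rw [this, Finset.card_filter, Finset.sum_pair hne]
    have h1 : S.π d₁ = Γ.rev d ↔ S.π d₂ = d := by
      rw [hπ]
      exact ⟨fun h => by rw [h, Γ.rev_rev], fun h => by rw [← h, Γ.rev_rev]⟩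
    have h2 : S.π d₂ = Γ.rev d ↔ S.π d₁ = d := by
      rw [hπ]
      exact ⟨fun h => by rw [← Γ.rev_rev (S.π d₁), h, Γ.rev_rev], fun h => by rw [h]⟩
    rw [key, key, if_congr h1 rfl rfl, if_congr h2 rfl rfl]
    push_cast
    ring

open Classical in
/-- The differences of a function along the pieces of an edge add up to its difference along
the edge. -/
theorem sum_pieces {A : Type*} [AddCommGroup A] (f : Γ'.V → A) (d : Γ.D) :
    ∑ t with S.π t = d, (f (Γ'.tgt t) - f (Γ'.src t)) =
      f (S.ι (Γ.tgt d)) - f (S.ι (Γ.src d)) := by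
  -- Regrouping by vertices reduces telescoping to the local count `card_src`, so the pieces need
  -- not be arranged into a path.
  have h1 : ∀ d, ∑ t with S.π t = d, f (Γ'.src t) =
      ∑ v, ((Finset.univ.filter fun t => S.π t = d ∧ Γ'.src t = v).card : ℤ) • f v := by
    intro d
    rw [← Finset.sum_fiberwise (s := Finset.univ.filter fun t => S.π t = d) (g := Γ'.src)]
    refine Finset.sum_congr rfl fun v _ => ?_
    rw [Finset.filter_filter, natCast_zsmul, ← Finset.sum_const]
    exact Finset.sum_congr rfl fun t ht => by rw [(Finset.mem_filter.1 ht).2.2]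
  have h2 : ∑ t with S.π t = d, f (Γ'.tgt t) = ∑ t with S.π t = Γ.rev d, f (Γ'.src t) := by
    refine Finset.sum_bij' (fun t _ => Γ'.rev t) (fun t _ => Γ'.rev t) ?_ ?_
      (fun t _ => Γ'.rev_rev t) (fun t _ => Γ'.rev_rev t) fun t _ => rfl
    · intro t ht
      simp only [Finset.mem_filter, Finset.mem_univ, true_and] at ht ⊢
      rw [S.π_rev, ht]
    · intro t ht
      simp only [Finset.mem_filter, Finset.mem_univ, true_and] at ht ⊢
      rw [S.π_rev, ht, Γ.rev_rev]
  have h3 : ∀ w, f w = ∑ v, (if v = w then (1 : ℤ) else 0) • f v := fun w => by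
    simp [ite_smul]
  rw [Finset.sum_sub_distrib, h2, h1, h1, h3 (S.ι (Γ.tgt d)), h3 (S.ι (Γ.src d)),
    ← Finset.sum_sub_distrib, ← Finset.sum_sub_distrib]
  refine Finset.sum_congr rfl fun v _ => ?_
  rw [← sub_smul, ← sub_smul]
  congr 1
  have := S.card_src v d
  linarith

end Subdivision

/-! ## The cones of equidimensional lifts -/

namespace EquidimLift

variable {Γ Δ : Graph}

theorem exists_cell (A : EquidimLift Γ) {d : A.Γ'.D}
    (h : A.β (A.Γ'.src d) < A.β (A.Γ'.tgt d)) :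
    ∃ i : Fin A.k, A.β (A.Γ'.src d) = i.castSucc ∧ A.β (A.Γ'.tgt d) = i.succ := by
  have h1 := A.cell d
  have h2 := (A.β (A.Γ'.tgt d)).2
  have h3 : (A.β (A.Γ'.src d) : ℕ) < A.β (A.Γ'.tgt d) := h
  refine ⟨⟨A.β (A.Γ'.src d), by omega⟩, Fin.ext rfl, Fin.ext ?_⟩
  change (A.β (A.Γ'.tgt d) : ℕ) = A.β (A.Γ'.src d) + 1
  omega

open Classical in
/-- The lengths of the pieces of an edge which is not contracted. -/
theorem Hom.sum_pieces {c : Graph.Contraction Γ Δ} {A : EquidimLift Γ} {B : EquidimLift Δ}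
    (f : EquidimLift.Hom c A B) {N : Type*} [AddCommMonoid N] {l : A.Γ'.Edge → N}
    {l' : B.Γ'.Edge → N} (h1 : ∀ e, l (f.c'.onE e) = l' e)
    (h2 : ∀ e, e ∉ Set.range f.c'.onE → l e = 0) (d : Δ.D) :
    ∑ t with A.sub.π t = c.onD d, l (A.Γ'.edge t) = ∑ t with B.sub.π t = d, l' (B.Γ'.edge t) := by
  symm
  refine Finset.sum_of_injOn f.c'.onD f.c'.onD_inj.injOn ?_ ?_ ?_
  · intro t ht
    simp only [Finset.coe_filter, Finset.mem_univ, true_and, Set.mem_ofPred_eq] at ht ⊢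
    rw [f.π_onD, ht]
  · intro t ht hn
    refine h2 _ fun hr => hn ?_
    obtain ⟨u, rfl⟩ := f.c'.edge_mem_range.1 hr
    simp only [Finset.mem_filter, Finset.mem_univ, true_and] at ht
    rw [f.π_onD] at ht
    exact ⟨u, by simpa using c.onD_inj ht, rfl⟩
  · intro t _
    rw [← h1]
    rfl

open Classical in
/-- The lengths of the pieces of a contracted edge. -/
theorem Hom.sum_pieces_eq_zero {c : Graph.Contraction Γ Δ} {A : EquidimLift Γ} {B : EquidimLift Δ}
    (f : EquidimLift.Hom c A B) {N : Type*} [AddCommMonoid N] {l : A.Γ'.Edge → N}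
    (h2 : ∀ e, e ∉ Set.range f.c'.onE → l e = 0) {d : Γ.D} (hd : d ∉ Set.range c.onD) :
    ∑ t with A.sub.π t = d, l (A.Γ'.edge t) = 0 := by
  refine Finset.sum_eq_zero fun t ht => h2 _ fun hr => hd ?_
  obtain ⟨u, rfl⟩ := f.c'.edge_mem_range.1 hr
  exact ⟨B.sub.π u, by rw [← f.π_onD, (Finset.mem_filter.1 ht).2]⟩

end EquidimLift

namespace CombRub

theorem hom_ext {x y : CombRub} {f g : x ⟶ y} (h1 : CombRub.Hom.base f = CombRub.Hom.base g)
    (h2 : (CombRub.Hom.lift f).c' = (CombRub.Hom.lift g).c')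
    (h3 : (CombRub.Hom.lift f).q = (CombRub.Hom.lift g).q) : f = g := by
  obtain ⟨fb, fl⟩ := f
  obtain ⟨gb, gl⟩ := g
  obtain rfl : fb = gb := h1
  obtain rfl : fl = gl := EquidimLift.Hom.ext h2 h3
  rfl

/-- The linear forms given by the equations. -/
def eqForm (x : CombRub) (p : x.lift.Γ'.D × Fin x.lift.k) :
    (x.lift.Γ'.Edge → ℝ) × (Fin x.lift.k → ℝ) →ₗ[ℝ] ℝ :=
  ((x.lift.sub.flow x.base.s).1 p.1 : ℝ) •
      (LinearMap.proj (x.lift.Γ'.edge p.1) ∘ₗ LinearMap.fst ℝ _ _) -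
    LinearMap.proj p.2 ∘ₗ LinearMap.snd ℝ _ _

theorem eqForm_apply (x : CombRub) (p) (l) : x.eqForm p l =
    ((x.lift.sub.flow x.base.s).1 p.1 : ℝ) * l.1 (x.lift.Γ'.edge p.1) - l.2 p.2 := rfl

theorem eqForm_int (x : CombRub) (p) {l : (x.lift.Γ'.Edge → ℝ) × (Fin x.lift.k → ℝ)}
    (hl : l ∈ (intLattice x.lift.Γ'.Edge).prod (intLattice (Fin x.lift.k))) :
    ∃ n : ℤ, x.eqForm p l = n := by
  obtain ⟨a, ha⟩ := hl.1 (x.lift.Γ'.edge p.1)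
  obtain ⟨b, hb⟩ := hl.2 p.2
  refine ⟨(x.lift.sub.flow x.base.s).1 p.1 * a - b, ?_⟩
  rw [eqForm_apply]
  push_cast
  rw [← ha, ← hb]

theorem isConeStackDiagram : IsConeStackDiagram CombRub.cones := by
  refine ⟨fun i => ?_, fun {i j} f => ?_⟩
  · let x := i.unop
    let P : Type := {p : x.lift.Γ'.D × Fin x.lift.k //
      x.lift.β (x.lift.Γ'.src p.1) = p.2.castSucc ∧ x.lift.β (x.lift.Γ'.tgt p.1) = p.2.succ}
    let F : (x.lift.Γ'.Edge ⊕ Fin x.lift.k) ⊕ P ⊕ P →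
        (x.lift.Γ'.Edge → ℝ) × (Fin x.lift.k → ℝ) →ₗ[ℝ] ℝ :=
      Sum.elim (Sum.elim (fun e => LinearMap.proj e ∘ₗ LinearMap.fst ℝ _ _)
        fun i => LinearMap.proj i ∘ₗ LinearMap.snd ℝ _ _)
        (Sum.elim (fun p => x.eqForm p.1) fun p => - x.eqForm p.1)
    refine Cone.isRationalPolyhedral_of (C := x.cone)
      (LinearEquiv.sumArrowLequivProdArrow x.lift.Γ'.Edge (Fin x.lift.k) ℝ ℝ).symm
      (fun l => ?_) F ?_ (fun l => ?_) ?_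
    · constructor
      · rintro h (e | i)
        · exact h.1 e
        · exact h.2 i
      · exact fun h => ⟨fun e => h (.inl e), fun i => h (.inr i)⟩
    · rintro ((e | i) | (p | p)) l hl
      · exact hl.1 e
      · exact hl.2 i
      · exact x.eqForm_int _ hl
      · obtain ⟨n, hn⟩ := x.eqForm_int p.1 hl
        exact ⟨-n, by rw [Int.cast_neg, ← hn]; rfl⟩
    · constructor
      · rintro ⟨h1, h2, h3⟩ ((e | i) | (p | p))
        · exact h1 e
        · exact h2 i
        · exact (sub_eq_zero.2 (h3 p.1.1 p.1.2 p.2.1 p.2.2)).ge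
        · exact neg_nonneg.2 (sub_eq_zero.2 (h3 p.1.1 p.1.2 p.2.1 p.2.2)).le
      · intro h
        refine ⟨fun e => h (.inl (.inl e)), fun i => h (.inl (.inr i)), fun d i h1 h2 => ?_⟩
        have h3 : 0 ≤ x.eqForm (d, i) l := h (.inr (.inl ⟨(d, i), h1, h2⟩))
        have h4 : 0 ≤ - x.eqForm (d, i) l := h (.inr (.inr ⟨(d, i), h1, h2⟩))
        exact sub_eq_zero.1 (le_antisymm (neg_nonneg.1 h4) h3)
    · rintro l hl (e | i)
      · exact hl.1 e
      · exact hl.2.1 i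
  · let x : CombRub := j.unop
    let y : CombRub := i.unop
    let g : CombRub.Hom x y := f.unop
    refine Cone.isFaceInclusion_of (C := y.cone) (D := x.cone)
      (hc := CombRub.lengths_mem f.unop)
      (hl := fun _ h => ⟨extendZero_int (Graph.Contraction.onE_inj _) h.1,
        extendZero_int (LineContraction.onE_inj _) h.2⟩)
      (κ := {e // e ∉ Set.range g.lift.c'.onE} ⊕ {i // i ∉ Set.range g.lift.q.onE})
      (fun l l' h => Prod.ext (extendZero_injective g.lift.c'.onE_inj (congrArg Prod.fst h))
        (extendZero_injective g.lift.q.onE_inj (congrArg Prod.snd h)))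
      (Sum.elim (fun e l => l.1 e.1) fun i l => l.2 i.1) ?_ ?_ ?_ (fun l hl => ?_)
      fun l hl => ⟨mem_intLattice_of_extendZero g.lift.c'.onE_inj hl.1,
        mem_intLattice_of_extendZero g.lift.q.onE_inj hl.2⟩
    · rintro (e | i) l l' <;> rfl
    · rintro (e | i) r l <;> rfl
    · rintro (e | i) l hl
      · exact hl.1 e.1
      · exact hl.2.1 i.1
    · constructor
      · rintro ⟨l', h, rfl⟩ (e | i)
        · exact extendZero_apply' l'.1 e.2
        · exact extendZero_apply' l'.2 i.2
      · intro h
        refine ⟨(fun e => l.1 (g.lift.c'.onE e), fun i => l.2 (g.lift.q.onE i)),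
          ⟨fun e => hl.1 _, fun i => hl.2.1 _, fun d i h1 h2 => ?_⟩,
          Prod.ext (extendZero_restrict g.lift.c'.onE_inj fun e he => h (.inl ⟨e, he⟩))
            (extendZero_restrict g.lift.q.onE_inj fun e he => h (.inr ⟨e, he⟩))⟩
        rw [← g.lift.c'.onV_src, g.lift.β_onV] at h1
        rw [← g.lift.c'.onV_tgt, g.lift.β_onV] at h2
        -- The contraction of lines is monotone, so an edge climbing one level in `y` climbs in `x`
        -- as well. Its equation in `x` is then the required one.
        have hlt : x.lift.β (x.lift.Γ'.src (g.lift.c'.onD d)) <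
            x.lift.β (x.lift.Γ'.tgt (g.lift.c'.onD d)) := by
          refine lt_of_not_ge fun hle => ?_
          have := g.lift.q.onV_mono hle
          rw [h1, h2] at this
          exact absurd Fin.castSucc_lt_succ this.not_gt
        obtain ⟨t, e1, e2⟩ := x.lift.exists_cell hlt
        rw [e1] at h1
        rw [e2] at h2
        have := hl.2.2 _ _ e1 e2
        rw [← g.lift.q.eq_onE h1 h2] at this
        refine Eq.trans ?_ this
        have hs : (x.lift.sub.flow x.base.s).1 (g.lift.c'.onD d) =
            (y.lift.sub.flow y.base.s).1 d := by
          rw [← g.base.flow]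
          exact congrArg x.base.s.1 (g.lift.π_onD d)
        rw [hs]
        rfl

variable {M N : Mon} (x : CombRub)

/-- Lengths in a monoid which satisfy the equations. -/
def IsPoint (l : x.lift.Γ'.Edge → M) (m : Fin x.lift.k → M) : Prop :=
  ∀ (d : x.lift.Γ'.D) (i : Fin x.lift.k), x.lift.β (x.lift.Γ'.src d) = i.castSucc →
    x.lift.β (x.lift.Γ'.tgt d) = i.succ →
    (x.lift.sub.flow x.base.s).1 d • toGp (l (x.lift.Γ'.edge d)) = toGp (m i)

variable {x} in
theorem IsPoint.eval {l : x.lift.Γ'.Edge → M} {m : Fin x.lift.k → M} (hl : x.IsPoint l m)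
    (f : M →+ ℝ) : x.Equations (evalLin l f, evalLin m f) := by
  intro d i h1 h2
  have := congrArg (gpEval f) (hl d i h1 h2)
  rw [map_zsmul, gpEval_toGp, gpEval_toGp, zsmul_eq_mul] at this
  exact this

/-- The morphism of cones given by lengths in a monoid. -/
def pt (l : x.lift.Γ'.Edge → M) (m : Fin x.lift.k → M) (hl : x.IsPoint l m) :
    dualCone M ⟶ x.cone :=
  Cone.homOfLinear (C := dualCone M) (D := x.cone) ((evalLin l).prod (evalLin m))
    (fun f hf => ⟨fun e => hf (l e), fun i => hf (m i), hl.eval f⟩)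
    fun _ hf => ⟨evalLin_mem_intLattice l hf, evalLin_mem_intLattice m hf⟩

theorem exists_pt (h : dualCone M ⟶ x.cone) : ∃ l m hl, h = x.pt l m hl := by
  choose l hl using fun e : x.lift.Γ'.Edge => exists_coord h ((LinearMap.proj (R := ℝ)
    (φ := fun _ : x.lift.Γ'.Edge => ℝ) e) ∘ₗ LinearMap.fst ℝ _ (Fin x.lift.k → ℝ))
    (fun y hy => hy.1 e) fun y hy => hy.1 e
  choose m hm using fun i : Fin x.lift.k => exists_coord h ((LinearMap.proj (R := ℝ)
    (φ := fun _ : Fin x.lift.k => ℝ) i) ∘ₗ LinearMap.snd ℝ (x.lift.Γ'.Edge → ℝ) _)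
    (fun y hy => hy.2.1 i) fun y hy => hy.2 i
  refine ⟨l, m, fun d i h1 h2 => Mon.gp_ext fun f hf => ?_,
    dualHom_ext fun f => Prod.ext (funext fun e => hl e f.1 f.2) (funext fun i => hm i f.1 f.2)⟩
  have := (Cone.Hom.toLin h (⟨f, hf.nonneg⟩ : (dualCone M).cone)).2.2.2 d i h1 h2
  rw [map_zsmul, gpEval_toGp, gpEval_toGp, zsmul_eq_mul, ← hl _ f hf.nonneg, ← hm _ f hf.nonneg]
  exact this

variable {x} {y : CombRub}

theorem pt_comp_eq_iff {l : x.lift.Γ'.Edge → M} {m : Fin x.lift.k → M} {hl : x.IsPoint l m}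
    {l' : y.lift.Γ'.Edge → M} {m' : Fin y.lift.k → M} {hl' : y.IsPoint l' m'} (c : x ⟶ y) :
    y.pt l' m' hl' ≫ CombRub.cones.map c.op = x.pt l m hl ↔
      ((∀ e, l ((CombRub.Hom.lift c).c'.onE e) = l' e) ∧
        ∀ e, e ∉ Set.range (CombRub.Hom.lift c).c'.onE → l e = 0) ∧
      (∀ i, m ((CombRub.Hom.lift c).q.onE i) = m' i) ∧
        ∀ i, i ∉ Set.range (CombRub.Hom.lift c).q.onE → m i = 0 := by
  rw [← evalLin_eq_extendZero (CombRub.Hom.lift c).c'.onE_inj,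
    ← evalLin_eq_extendZero (CombRub.Hom.lift c).q.onE_inj]
  constructor
  · intro h
    have key := fun (f : M →+ ℝ) (hf : ∀ m, 0 ≤ f m) =>
      (congrArg (fun k => (Cone.Hom.toLin k (⟨f, hf⟩ : (dualCone M).cone)).1) h).symm
    exact ⟨fun f hf => congrArg Prod.fst (key f hf), fun f hf => congrArg Prod.snd (key f hf)⟩
  · exact fun h => dualHom_ext fun f => (Prod.ext (h.1 f.1 f.2) (h.2 f.1 f.2)).symm

theorem IsPoint.map {l : x.lift.Γ'.Edge → M} {m : Fin x.lift.k → M} (hl : x.IsPoint l m)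
    (φ : M ⟶ N) : x.IsPoint (fun e => Mon.toHom φ (l e)) fun i => Mon.toHom φ (m i) := by
  intro d i h1 h2
  rw [← gpMap_toGp, ← gpMap_toGp, ← map_zsmul, hl d i h1 h2]

theorem dualMap_comp_pt (φ : M ⟶ N) (l : x.lift.Γ'.Edge → M) (m : Fin x.lift.k → M)
    (hl : x.IsPoint l m) : dualMap φ ≫ x.pt l m hl = x.pt _ _ (hl.map φ) := rfl

end CombRub

/-! ## Positions on a line -/

section Line

variable {M : Mon} {k : ℕ} {γ : Fin (k + 1) → Gp M} {m : Fin k → M}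
  (hγ : ∀ i, γ i.succ - γ i.castSucc = toGp (m i))
include hγ

theorem gpLE_of_le {i j : Fin (k + 1)} (h : i ≤ j) : M.GpLE (γ i) (γ j) := by
  induction j using Fin.induction with
  | zero => rw [le_antisymm h (Fin.zero_le i)]; exact M.gpLE_refl _
  | succ j ih =>
    rcases h.eq_or_lt with rfl | hlt
    · exact M.gpLE_refl _
    · exact Mon.gpLE_trans (ih (Fin.le_castSucc_iff.2 hlt)) ⟨m j, (hγ j).symm⟩

/-- Positions increase along the line, so everything between two vertices at equal positions is
squeezed to a single position. -/
theorem eq_zero_of_position_eq {i : Fin k} {a b : Fin (k + 1)} (h : γ a = γ b)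
    (ha : a ≤ i.castSucc) (hb : i.succ ≤ b) : m i = 0 := by
  have h1 := gpLE_of_le hγ hb
  have h2 := gpLE_of_le hγ ha
  have h3 := gpLE_of_le hγ (Fin.castSucc_lt_succ (i := i)).le
  rw [← h] at h1
  have h4 := Mon.gpLE_antisymm h3 (Mon.gpLE_trans h1 h2)
  have h5 := hγ i
  rw [h4, sub_self] at h5
  exact (Mon.toGp_eq_zero _).1 h5.symm

theorem position_injective (hm : ∀ i, m i ≠ 0) : Function.Injective γ := by
  intro a b h
  wlog hle : a ≤ b generalizing a b
  · exact (this h.symm (le_of_not_ge hle)).symm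
  by_contra hne
  have hlt := lt_of_le_of_ne hle hne
  have hak : (a : ℕ) < k := by
    have := b.2
    have : (a : ℕ) < b := hlt
    omega
  refine hm ⟨a, hak⟩ (eq_zero_of_position_eq hγ h ?_ ?_)
  · exact le_of_eq (Fin.ext rfl)
  · exact Nat.succ_le_of_lt hlt

end Line

/-! ## The stack of equidimensional lifts -/

namespace CombRub

/-- A contraction of the subdivisions, compatible with contractions `c` and `d` of graphs with
lifts from a common source, is part of a morphism of graphs with lifts. -/
theorem exists_factor {x y z : CombRub} (c : x ⟶ y) (d : x ⟶ z)
    (k : y.lift.Γ'.Contraction z.lift.Γ')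
    (hk : (CombRub.Hom.lift c).c'.comp k = (CombRub.Hom.lift d).c')
    (r : LineContraction y.lift.k z.lift.k)
    (hr : (CombRub.Hom.lift c).q.comp r = (CombRub.Hom.lift d).q) :
    ∃ e : y ⟶ z, c ≫ e = d ∧ (CombRub.Hom.lift e).c' = k ∧ (CombRub.Hom.lift e).q = r := by
  obtain ⟨⟨cb, cs⟩, cl⟩ := c
  obtain ⟨⟨db, ds⟩, dl⟩ := d
  change cl.c'.comp k = dl.c' at hk
  change cl.q.comp r = dl.q at hr
  have hkD : ∀ t, cl.c'.onD (k.onD t) = dl.c'.onD t := fun t =>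
    congrFun (congrArg Graph.Contraction.onD hk) t
  have hkV : ∀ v, k.onV (cl.c'.onV v) = dl.c'.onV v := fun v =>
    congrFun (congrArg Graph.Contraction.onV hk) v
  have hrV : ∀ v, r.onV (cl.q.onV v) = dl.q.onV v := fun v =>
    congrFun (congrArg LineContraction.onV hr) v
  -- Every edge of the graph of `z` has a piece. Its survival in the subdivision of `y` forces the
  -- edge to survive there, so the contraction of the underlying graphs is determined by that of the
  -- subdivisions.
  have hb : Set.range db.onD ⊆ Set.range cb.onD := by
    rintro _ ⟨t, rfl⟩
    obtain ⟨t', -, ht'⟩ := z.lift.sub.exists_piece t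
    exact ⟨y.lift.sub.π (k.onD t'), by rw [← cl.π_onD, hkD, dl.π_onD, ht']⟩
  have hcomp := Graph.Contraction.comp_factor cb db hb
  have hfV := Graph.Contraction.factor_onV cb db hb
  have hfD := Graph.Contraction.factor_onD cb db hb
  let b : y.base ⟶ z.base := ⟨Graph.Contraction.factor cb db hb, by
    rw [← cs, ← ds]
    exact congrArg (fun t : x.base.Γ.Contraction z.base.Γ => t.flow x.base.s) hcomp⟩
  refine ⟨⟨b, ⟨k, r, fun v => ?_, fun t => ?_, fun v => ?_⟩⟩,
    hom_ext (CombDiv.Hom.ext hcomp) hk hr, rfl, rfl⟩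
  · obtain ⟨v, rfl⟩ := cb.onV_surj v
    change _ = z.lift.sub.ι ((Graph.Contraction.factor cb db hb).onV _)
    rw [hfV, ← cl.onV_ι, hkV, dl.onV_ι]
  · apply cb.onD_inj
    change _ = cb.onD ((Graph.Contraction.factor cb db hb).onD _)
    rw [hfD, ← cl.π_onD, hkD, dl.π_onD]
  · obtain ⟨v, rfl⟩ := cl.c'.onV_surj v
    rw [hkV, dl.β_onV, cl.β_onV, hrV]

end CombRub

/-! ### From tropical curves with an equidimensional lift to points of cones. -/

namespace SigmaRub

theorem s_eq (X : SigmaRub) (d : X.lift.Γ'.D) :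
    X.γ (X.lift.β (X.lift.Γ'.tgt d)) - X.γ (X.lift.β (X.lift.Γ'.src d)) =
      (X.lift.sub.flow X.base.s).1 d • toGp (X.len' (X.lift.Γ'.edge d)) :=
  X.slope d _ (X.base.isPL _)

theorem γ_injective (X : SigmaRub) : Function.Injective X.γ :=
  position_injective X.γ_step X.lenX_ne

/-- The underlying graph with its flow and equidimensional lift. -/
def comb (X : SigmaRub) : CombRub where
  base := X.base.comb
  lift := X.lift
  flow_pos d hd := by
    refine lt_of_not_ge fun hle => ?_
    have h1 := X.s_eq d
    change 0 < (X.lift.sub.flow X.base.s).1 d at hd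
    have h2 : X.base.M.GpLE (X.γ (X.lift.β (X.lift.Γ'.src d)))
        (X.γ (X.lift.β (X.lift.Γ'.tgt d))) := by
      refine ⟨((X.lift.sub.flow X.base.s).1 d).toNat • X.len' (X.lift.Γ'.edge d), ?_⟩
      rw [h1, map_nsmul, ← natCast_zsmul, Int.toNat_of_nonneg hd.le]
    rw [Mon.gpLE_antisymm h2 (gpLE_of_le X.γ_step hle), sub_self] at h1
    rcases smul_eq_zero.1 h1.symm with h3 | h3
    · exact hd.ne' h3
    · exact X.len'_ne _ ((Mon.toGp_eq_zero _).1 h3)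
  flow_zero d hd := by
    have h1 := X.s_eq d
    change (X.lift.sub.flow X.base.s).1 d = 0 at hd
    rw [hd, zero_smul, sub_eq_zero] at h1
    exact (X.γ_injective h1).symm

theorem isPoint (X : SigmaRub) : X.comb.IsPoint X.len' X.lenX := by
  intro (d : X.lift.Γ'.D) (i : Fin X.lift.k) (h1 : X.lift.β (X.lift.Γ'.src d) = i.castSucc)
    (h2 : X.lift.β (X.lift.Γ'.tgt d) = i.succ)
  have h := X.s_eq d
  rw [h1, h2, X.γ_step] at h
  exact h.symm

/-- The point of the cone given by the lengths. -/
def el (X : SigmaRub) : dualCone X.base.M ⟶ X.comb.cone := X.comb.pt X.len' X.lenX X.isPoint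

/-- The functor forgetting lengths and values. -/
def combFunctor : SigmaRub ⥤ CombRub where
  obj := comb
  map f := ⟨SigmaDiv.combFunctor.map (SigmaRub.Hom.base f), SigmaRub.Hom.lift f⟩
  map_id _ := rfl
  map_comp _ _ := rfl

/-- The functor forgetting lengths and values, with the point of the cone given by the lengths. -/
def pointFunctor : PointFunctor CombRub.cones SigmaRub.proj where
  U := combFunctor
  el := el
  compat {X Y} f := by
    let g : SigmaRub.Hom X Y := f
    refine Eq.trans (CombRub.dualMap_comp_pt (x := X.comb) _ _ _ _)
      ((CombRub.pt_comp_eq_iff (x := X.comb) (y := Y.comb)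
        (hl := X.isPoint.map g.base.φ) (hl' := Y.isPoint) (combFunctor.map f)).2
        ⟨⟨?_, ?_⟩, g.lenX_onE, g.lenX_contracted⟩).symm
    · exact (Graph.Contraction.forall_onE (F := Mon.toHom (SigmaDiv.Hom.φ g.base))
        (l := X.len') g.lift.c').2 g.len'_onD
    · exact g.lift.c'.forall_not_range_onE.2 g.len'_contracted

theorem hom_ext {X Y : SigmaRub} {f g : X ⟶ Y}
    (h1 : SigmaRub.Hom.base f = SigmaRub.Hom.base g)
    (h2 : (SigmaRub.Hom.lift f).c' = (SigmaRub.Hom.lift g).c')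
    (h3 : (SigmaRub.Hom.lift f).q = (SigmaRub.Hom.lift g).q) : f = g := by
  obtain ⟨fb, fl⟩ := f
  obtain ⟨gb, gl⟩ := g
  obtain rfl : fb = gb := h1
  obtain rfl : fl = gl := EquidimLift.Hom.ext h2 h3
  rfl

-- Lengths on the subdivision and the line suffice: those on the graph are obtained by summing over
-- pieces, and the values then agree by normalization at the root.
open Classical in
theorem exists_hom {X Y : SigmaRub} (φ : X.base.M ⟶ Y.base.M)
    (cb : X.base.Γ.Contraction Y.base.Γ) (cs : cb.flow X.base.s = Y.base.s)
    (cl : EquidimLift.Hom cb X.lift Y.lift)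
    (h1 : ∀ e, Mon.toHom φ (X.len' (cl.c'.onE e)) = Y.len' e)
    (h2 : ∀ e, e ∉ Set.range cl.c'.onE → Mon.toHom φ (X.len' e) = 0)
    (h3 : ∀ i, Mon.toHom φ (X.lenX (cl.q.onE i)) = Y.lenX i)
    (h4 : ∀ i, i ∉ Set.range cl.q.onE → Mon.toHom φ (X.lenX i) = 0) :
    ∃ f : X ⟶ Y, SigmaRub.proj.map f = φ ∧ combFunctor.map f = ⟨⟨cb, cs⟩, cl⟩ := by
  have hlen : ∀ d, Mon.toHom φ (X.base.len (X.base.Γ.edge (cb.onD d))) =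
      Y.base.len (Y.base.Γ.edge d) := by
    intro d
    rw [← X.len'_sum, ← Y.len'_sum, map_sum]
    exact cl.sum_pieces (l := fun e => Mon.toHom φ (X.len' e)) h1 h2 d
  have hlen0 : ∀ d, d ∉ Set.range cb.onD → Mon.toHom φ (X.base.len (X.base.Γ.edge d)) = 0 := by
    intro d hd
    rw [← X.len'_sum, map_sum]
    exact cl.sum_pieces_eq_zero (l := fun e => Mon.toHom φ (X.len' e)) h2 hd
  obtain ⟨⟨φ', c', g1, g2, hv⟩, hφ, hc⟩ := SigmaDiv.exists_hom (X := X.base) (Y := Y.base) φ cb cs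
    ((Graph.Contraction.forall_onE (F := Mon.toHom φ) (l := X.base.len) cb).2 hlen)
    (cb.forall_not_range_onE.2 hlen0)
  subst hφ
  subst hc
  refine ⟨⟨⟨φ', c', g1, g2, hv⟩, cl, fun d => h1 (Y.lift.Γ'.edge d),
    cl.c'.forall_not_range_onE.1 h2, h3, h4, fun i => ?_⟩, rfl, rfl⟩
  -- By stability every vertex of the line lies under a vertex of the graph, so its position is a
  -- value of the piecewise linear function.
  obtain ⟨v, rfl⟩ := X.lift.stable i
  exact (congrArg Y.γ (cl.β_onV _).symm).trans
    ((congrArg (fun t => Y.γ (Y.lift.β t)) (cl.onV_ι v)).trans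
      ((Y.value _).trans ((hv v).trans (congrArg (gpMap _) (X.value v).symm))))

theorem pointFunctor_full {X Y : SigmaRub} (φ : X.base.M ⟶ Y.base.M) (c : X.comb ⟶ Y.comb)
    (h : dualMap φ ≫ X.el = Y.el ≫ CombRub.cones.map c.op) :
    ∃ f : X ⟶ Y, SigmaRub.proj.map f = φ ∧ combFunctor.map f = c := by
  have h' := (CombRub.pt_comp_eq_iff (x := X.comb) (y := Y.comb) (hl := X.isPoint.map φ)
    (hl' := Y.isPoint) c).1 h.symm
  exact exists_hom φ (CombDiv.Hom.c (CombRub.Hom.base c)) (CombDiv.Hom.flow (CombRub.Hom.base c))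
    (CombRub.Hom.lift c) h'.1.1 h'.1.2 h'.2.1 h'.2.2

theorem pointFunctor_factor (X : SigmaRub) {x y : CombRub} (c : x ⟶ y) (d : x ⟶ X.comb)
    (h : dualCone X.base.M ⟶ y.cone)
    (hc : h ≫ CombRub.cones.map c.op = X.el ≫ CombRub.cones.map d.op) :
    ∃! d' : y ⟶ X.comb, c ≫ d' = d ∧ X.el ≫ CombRub.cones.map d'.op = h := by
  obtain ⟨l, m, hl, rfl⟩ := y.exists_pt h
  obtain ⟨l₁, m₁, hl₁, h₁⟩ := x.exists_pt (y.pt l m hl ≫ CombRub.cones.map c.op)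
  obtain ⟨⟨e1, e2⟩, e3, e4⟩ := (CombRub.pt_comp_eq_iff c).1 h₁
  obtain ⟨⟨f1, f2⟩, f3, f4⟩ := (CombRub.pt_comp_eq_iff (y := X.comb) (hl' := X.isPoint) d).1
    (hc.symm.trans h₁)
  obtain ⟨k, hk, hk1, hk2⟩ := (CombRub.Hom.lift c).c'.exists_factor (CombRub.Hom.lift d).c'
    X.len'_ne e1 e2 f1 f2
  have hq : Set.range (CombRub.Hom.lift d).q.onE ⊆ Set.range (CombRub.Hom.lift c).q.onE := by
    rintro _ ⟨t, rfl⟩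
    by_contra ht
    exact X.lenX_ne t ((f3 t).symm.trans (e4 _ ht))
  obtain ⟨r, hr⟩ := (CombRub.Hom.lift c).q.exists_factor _ hq
  have hrE : ∀ t, (CombRub.Hom.lift c).q.onE (r.onE t) = (CombRub.Hom.lift d).q.onE t := fun t =>
    congrFun (congrArg LineContraction.onE hr) t
  obtain ⟨b, hb, rfl, rfl⟩ := CombRub.exists_factor c d k hk r hr
  refine ⟨b, ⟨hb, (CombRub.pt_comp_eq_iff (x := y) (y := X.comb) (hl' := X.isPoint) b).2
    ⟨⟨hk1, hk2⟩, fun t => ?_, fun t ht => ?_⟩⟩, ?_⟩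
  · rw [← e3, hrE, f3]
  · rw [← e3, f4]
    rintro ⟨u, hu⟩
    exact ht ⟨u, (CombRub.Hom.lift c).q.onE_inj ((hrE u).trans hu)⟩
  · rintro b' ⟨h', -⟩
    have h'' := h'.trans hb.symm
    exact CombRub.hom_ext (CombDiv.hom_cancel (congrArg CombRub.Hom.base h''))
      (Graph.Contraction.comp_cancel (congrArg (fun t => (CombRub.Hom.lift t).c') h''))
      (LineContraction.comp_cancel (congrArg (fun t => (CombRub.Hom.lift t).q) h''))

theorem pointFunctor_faithful {X Y : SigmaRub} {f g : X ⟶ Y}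
    (h1 : SigmaRub.proj.map f = SigmaRub.proj.map g)
    (h2 : combFunctor.map f = combFunctor.map g) : f = g :=
  hom_ext (SigmaDiv.Hom.ext h1 (congrArg (fun t => CombDiv.Hom.c (CombRub.Hom.base t)) h2))
    (congrArg (fun t => (CombRub.Hom.lift t).c') h2)
    (congrArg (fun t => (CombRub.Hom.lift t).q) h2)

end SigmaRub

/-! ## Contracting the edges of length zero of an equidimensional lift -/

theorem Mon.eq_zero_of_sum_eq_zero {M : Mon} {ι : Type*} {s : Finset ι} {f : ι → M}
    (h : ∑ i ∈ s, f i = 0) {i : ι} (hi : i ∈ s) : f i = 0 := by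
  classical
  rw [← Finset.add_sum_erase s f hi] at h
  exact M.sharp _ _ h

theorem Mon.eq_zero_of_smul_eq_zero {M : Mon} {n : ℤ} {a : M} (hn : n ≠ 0)
    (h : n • toGp a = (0 : Gp M)) : a = 0 :=
  (Mon.toGp_eq_zero M).1 ((smul_eq_zero.1 h).resolve_left hn)

namespace SigmaDiv

variable {M : Mon} {Γ : Graph} {l : Γ.Edge → M}

theorem zeroContraction_mem_range {d : Γ.D} :
    d ∈ Set.range (zeroContraction l).onD ↔ l (Γ.edge d) ≠ 0 :=
  Γ.mem_range_contraction _ _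

theorem zeroContraction_collapse {d : Γ.D} (h : l (Γ.edge d) = 0) :
    (zeroContraction l).onV (Γ.src d) = (zeroContraction l).onV (Γ.tgt d) :=
  (zeroContraction l).collapse d fun h' => zeroContraction_mem_range.1 h' h

/-- An induction principle for the vertices merged by the contraction: they are connected by edges
of length zero, so it suffices that `T` propagates along those. -/
theorem mem_of_zeroContraction_eq {T : Γ.V → Prop}
    (hT : ∀ d, l (Γ.edge d) = 0 → T (Γ.src d) → T (Γ.tgt d)) {v w : Γ.V}
    (h : (zeroContraction l).onV v = (zeroContraction l).onV w) (hv : T v) : T w := by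
  induction (zeroContraction l).fibre v w h with
  | refl => exact hv
  | tail _ hs ih =>
    obtain ⟨d, hd, rfl, rfl⟩ := hs
    rw [zeroContraction_mem_range, not_not] at hd
    exact hT d hd (ih (h.trans (zeroContraction_collapse hd).symm))

end SigmaDiv

open SigmaDiv

namespace CombRub

variable (x : CombRub)

theorem flow_apply (d : x.lift.Γ'.D) :
    (x.lift.sub.flow x.base.s).1 d = x.base.s.1 (x.lift.sub.π d) := rfl

variable {x}

theorem exists_level {d : x.lift.Γ'.D} (h : 0 < x.base.s.1 (x.lift.sub.π d)) :
    ∃ i : Fin x.lift.k, x.lift.β (x.lift.Γ'.src d) = i.castSucc ∧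
      x.lift.β (x.lift.Γ'.tgt d) = i.succ :=
  x.lift.exists_cell (x.flow_pos d h)

theorem s_rev (d : x.lift.Γ'.D) : x.base.s.1 (x.lift.sub.π (x.lift.Γ'.rev d)) =
    - x.base.s.1 (x.lift.sub.π d) := (x.lift.sub.flow x.base.s).2 d

theorem eq_of_s_eq_zero {t t' : x.lift.Γ'.D} (h : x.lift.sub.π t = x.lift.sub.π t')
    (hs : x.base.s.1 (x.lift.sub.π t) = 0) : t = t' :=
  x.lift.minimal t t' h (x.flow_zero t hs)

/-- An edge of slope zero is not subdivided, by minimality, so its only piece starts at a vertex of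
the graph. -/
theorem s_ne_zero_of_exceptional {t : x.lift.Γ'.D}
    (h : x.lift.Γ'.src t ∉ Set.range x.lift.sub.ι) : x.base.s.1 (x.lift.sub.π t) ≠ 0 := by
  intro hs
  obtain ⟨t', h1, h2⟩ := x.lift.sub.exists_piece (x.lift.sub.π t)
  rw [← eq_of_s_eq_zero h2.symm hs] at h1
  exact h ⟨_, h1.symm⟩

/-- Pieces of an edge of positive slope are determined by their level, and lie between the levels
of the end points of the edge. -/
theorem piece_level {t : x.lift.Γ'.D} (hs : 0 < x.base.s.1 (x.lift.sub.π t)) :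
    x.lift.β (x.lift.sub.ι (x.base.Γ.src (x.lift.sub.π t))) ≤ x.lift.β (x.lift.Γ'.src t) ∧
    x.lift.β (x.lift.Γ'.tgt t) ≤ x.lift.β (x.lift.sub.ι (x.base.Γ.tgt (x.lift.sub.π t))) ∧
    ∀ t', x.lift.sub.π t' = x.lift.sub.π t →
      x.lift.β (x.lift.Γ'.src t') = x.lift.β (x.lift.Γ'.src t) → t' = t := by
  classical
  obtain ⟨i, h1, h2⟩ := exists_level hs
  -- Telescoping the indicator of lying above level `i` counts the pieces that cross from `i` to `i
  -- + 1`. The total is at most one and `t` contributes, so `t` is the only one and the ends of the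
  -- edge lie on the two sides.
  have key := x.lift.sub.sum_pieces (fun v => if i.castSucc < x.lift.β v then (1 : ℤ) else 0)
    (x.lift.sub.π t)
  have hterm : ∀ t' ∈ Finset.univ.filter fun t' => x.lift.sub.π t' = x.lift.sub.π t,
      ((if i.castSucc < x.lift.β (x.lift.Γ'.tgt t') then (1 : ℤ) else 0) -
        if i.castSucc < x.lift.β (x.lift.Γ'.src t') then 1 else 0) =
      if x.lift.β (x.lift.Γ'.src t') = i.castSucc then 1 else 0 := by
    intro t' ht'
    rw [Finset.mem_filter] at ht'
    obtain ⟨j, e1, e2⟩ := exists_level (x := x) (d := t') (by rw [ht'.2]; exact hs)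
    simp only [e1, e2, Fin.castSucc_lt_succ_iff, Fin.castSucc_lt_castSucc_iff, Fin.castSucc_inj]
    rcases lt_trichotomy i j with h | h | h
    · rw [if_pos h.le, if_pos h, if_neg h.ne', sub_self]
    · rw [if_pos h.le, if_neg (lt_irrefl i |> fun h' => h ▸ h'), if_pos h.symm, sub_zero]
    · rw [if_neg h.not_ge, if_neg h.not_gt, if_neg h.ne, sub_self]
  rw [Finset.sum_congr rfl hterm, Finset.sum_ite, Finset.sum_const_zero, add_zero,
    Finset.sum_const, nsmul_eq_mul, mul_one, Finset.filter_filter] at key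
  have hmem : t ∈ Finset.univ.filter fun t' => x.lift.sub.π t' = x.lift.sub.π t ∧
      x.lift.β (x.lift.Γ'.src t') = i.castSucc := by simp [h1]
  have hcard := Finset.card_pos.2 ⟨t, hmem⟩
  have hc : (Finset.univ.filter fun t' => x.lift.sub.π t' = x.lift.sub.π t ∧
      x.lift.β (x.lift.Γ'.src t') = i.castSucc).card ≤ 1 ∧
      i.castSucc < x.lift.β (x.lift.sub.ι (x.base.Γ.tgt (x.lift.sub.π t))) ∧
      ¬ i.castSucc < x.lift.β (x.lift.sub.ι (x.base.Γ.src (x.lift.sub.π t))) := by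
    split_ifs at key with e1 e2 e2
    · omega
    · exact ⟨by omega, e1, e2⟩
    · omega
    · omega
  refine ⟨by rw [h1]; exact not_lt.1 hc.2.2, by rw [h2]; exact Fin.castSucc_lt_iff_succ_le.1 hc.2.1,
    fun t' ht' hb => ?_⟩
  exact Finset.card_le_one.1 hc.1 _ (by simp [ht', hb, h1]) _ hmem

theorem π_eq_or_eq_rev {t t' : x.lift.Γ'.D} (h : x.lift.Γ'.src t ∉ Set.range x.lift.sub.ι)
    (ht : x.lift.Γ'.src t' = x.lift.Γ'.src t) : x.lift.sub.π t' = x.lift.sub.π t ∨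
      x.lift.sub.π t' = x.base.Γ.rev (x.lift.sub.π t) := by
  obtain ⟨d₁, d₂, -, hs, hπ⟩ := x.lift.sub.exceptional _ h
  have hm : ∀ u, x.lift.Γ'.src u = x.lift.Γ'.src t → u = d₁ ∨ u = d₂ := fun u hu => by
    have : u ∈ ({d₁, d₂} : Set x.lift.Γ'.D) := by rw [← hs]; exact hu
    exact this
  rcases hm t rfl with rfl | rfl <;> rcases hm t' ht with rfl | rfl
  · exact .inl rfl
  · exact .inr hπ
  · exact .inr (by rw [hπ, x.base.Γ.rev_rev])
  · exact .inl rfl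

theorem exists_π_eq_rev {t : x.lift.Γ'.D} (h : x.lift.Γ'.src t ∉ Set.range x.lift.sub.ι) :
    ∃ t', x.lift.Γ'.src t' = x.lift.Γ'.src t ∧
      x.lift.sub.π t' = x.base.Γ.rev (x.lift.sub.π t) := by
  obtain ⟨d₁, d₂, -, hs, hπ⟩ := x.lift.sub.exceptional _ h
  have hm : ∀ u, x.lift.Γ'.src u = x.lift.Γ'.src t ↔ u = d₁ ∨ u = d₂ := fun u => by
    have : u ∈ {d | x.lift.Γ'.src d = x.lift.Γ'.src t} ↔ u ∈ ({d₁, d₂} : Set x.lift.Γ'.D) := by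
      rw [hs]
    exact this
  rcases (hm t).1 rfl with rfl | rfl
  · exact ⟨d₂, (hm _).2 (.inr rfl), hπ⟩
  · exact ⟨d₁, (hm _).2 (.inl rfl), by rw [hπ, x.base.Γ.rev_rev]⟩

/-- The other piece of the same edge at an exceptional vertex. -/
theorem exists_next {t : x.lift.Γ'.D} (h : x.lift.Γ'.tgt t ∉ Set.range x.lift.sub.ι) :
    ∃ t', x.lift.Γ'.src t' = x.lift.Γ'.tgt t ∧ x.lift.sub.π t' = x.lift.sub.π t := by
  obtain ⟨t', h1, h2⟩ := exists_π_eq_rev (x := x) (t := x.lift.Γ'.rev t) h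
  exact ⟨t', h1, by rw [h2, x.lift.sub.π_rev, x.base.Γ.rev_rev]⟩

variable {M : Mon}

/-- The positions of the vertices of a line with given edge lengths. -/
def position {k : ℕ} (m : Fin k → M) : Fin (k + 1) → Gp M :=
  Fin.induction 0 fun i a => a + toGp (m i)

theorem position_step {k : ℕ} (m : Fin k → M) (i : Fin k) :
    position m i.succ - position m i.castSucc = toGp (m i) := by
  have : position m i.succ = position m i.castSucc + toGp (m i) := Fin.induction_succ _ _ _
  rw [this, add_sub_cancel_left]

open Classical in
/-- The lengths of edges, as sums of the lengths of their pieces. -/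
def edgeLen (l : x.lift.Γ'.Edge → M) : x.base.Γ.Edge → M :=
  Quot.lift (fun d => ∑ t with x.lift.sub.π t = d, l (x.lift.Γ'.edge t)) fun d d' h => by
    subst h
    refine Finset.sum_bij' (fun t _ => x.lift.Γ'.rev t) (fun t _ => x.lift.Γ'.rev t) ?_ ?_
      (fun t _ => x.lift.Γ'.rev_rev t) (fun t _ => x.lift.Γ'.rev_rev t)
      fun t _ => by rw [x.lift.Γ'.edge_rev]
    · intro t ht
      simp only [Finset.mem_filter, Finset.mem_univ, true_and] at ht ⊢
      rw [x.lift.sub.π_rev, ht]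
    · intro t ht
      simp only [Finset.mem_filter, Finset.mem_univ, true_and] at ht ⊢
      rw [x.lift.sub.π_rev, ht, x.base.Γ.rev_rev]

open Classical in
theorem edgeLen_edge (l : x.lift.Γ'.Edge → M) (d : x.base.Γ.D) : edgeLen l (x.base.Γ.edge d) =
    ∑ t with x.lift.sub.π t = d, l (x.lift.Γ'.edge t) := rfl

theorem eq_zero_of_edgeLen {l : x.lift.Γ'.Edge → M} {t : x.lift.Γ'.D}
    (h : edgeLen l (x.base.Γ.edge (x.lift.sub.π t)) = 0) : l (x.lift.Γ'.edge t) = 0 := by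
  classical
  rw [edgeLen_edge] at h
  exact Mon.eq_zero_of_sum_eq_zero h (by simp)

theorem edgeLen_of_s_eq_zero (l : x.lift.Γ'.Edge → M) {t : x.lift.Γ'.D}
    (h : x.base.s.1 (x.lift.sub.π t) = 0) :
    edgeLen l (x.base.Γ.edge (x.lift.sub.π t)) = l (x.lift.Γ'.edge t) := by
  classical
  rw [edgeLen_edge, Finset.sum_eq_single t]
  · intro t' ht' hne
    exact absurd (eq_of_s_eq_zero (Finset.mem_filter.1 ht').2.symm h).symm hne
  · simp

/-- By sharpness all pieces of an edge of length zero have length zero. Telescoping the indicator of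
the class of the start then places the end in the same class. -/
theorem onV_ι_eq {l : x.lift.Γ'.Edge → M} {d : x.base.Γ.D}
    (h : edgeLen l (x.base.Γ.edge d) = 0) :
    (zeroContraction l).onV (x.lift.sub.ι (x.base.Γ.src d)) =
      (zeroContraction l).onV (x.lift.sub.ι (x.base.Γ.tgt d)) := by
  classical
  have key := x.lift.sub.sum_pieces (fun v => if (zeroContraction l).onV v =
    (zeroContraction l).onV (x.lift.sub.ι (x.base.Γ.src d)) then (1 : ℤ) else 0) d
  rw [Finset.sum_eq_zero, if_pos rfl] at key
  · by_contra hne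
    rw [if_neg fun h' => hne h'.symm] at key
    omega
  · intro t ht
    rw [Finset.mem_filter] at ht
    have : l (x.lift.Γ'.edge t) = 0 := eq_zero_of_edgeLen (by rw [ht.2]; exact h)
    rw [zeroContraction_collapse this, sub_self]

section Point

variable {l : x.lift.Γ'.Edge → M} {m : Fin x.lift.k → M} (hl : x.IsPoint l m)
include hl

/-- The equations concern ascending pieces only. Descending ones are reversed, and pieces of slope
zero stay at one level. -/
theorem position_sub (d : x.lift.Γ'.D) :
    position m (x.lift.β (x.lift.Γ'.tgt d)) - position m (x.lift.β (x.lift.Γ'.src d)) =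
      x.base.s.1 (x.lift.sub.π d) • toGp (l (x.lift.Γ'.edge d)) := by
  have hpos : ∀ d, 0 < x.base.s.1 (x.lift.sub.π d) →
      position m (x.lift.β (x.lift.Γ'.tgt d)) - position m (x.lift.β (x.lift.Γ'.src d)) =
        x.base.s.1 (x.lift.sub.π d) • toGp (l (x.lift.Γ'.edge d)) := by
    intro d hd
    obtain ⟨i, h1, h2⟩ := exists_level hd
    rw [h1, h2, position_step]
    exact (hl d i h1 h2).symm
  rcases lt_trichotomy (x.base.s.1 (x.lift.sub.π d)) 0 with h | h | h
  · have := hpos (x.lift.Γ'.rev d) (by rw [s_rev]; exact neg_pos.2 h)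
    rw [s_rev, x.lift.Γ'.edge_rev, x.lift.Γ'.tgt_rev, neg_smul] at this
    rw [← neg_inj, ← this, neg_sub]
    rfl
  · rw [h, zero_smul, x.flow_zero d h, sub_self]
  · exact hpos d h

/-- Summing `position_sub` over the pieces of an edge recovers, from the line alone, the piecewise
linear function on the graph. -/
theorem isPL_edgeLen : Graph.IsPL x.base.s (fun e => toGp (edgeLen l e))
    fun v => position m (x.lift.β (x.lift.sub.ι v)) := by
  classical
  intro d
  change position m _ - position m _ = _ • toGp (edgeLen l _)
  rw [← x.lift.sub.sum_pieces (fun v => position m (x.lift.β v)), edgeLen_edge, map_sum,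
    Finset.smul_sum]
  refine Finset.sum_congr rfl fun t ht => ?_
  rw [position_sub hl t, (Finset.mem_filter.1 ht).2]

theorem position_tgt {t : x.lift.Γ'.D} (h : l (x.lift.Γ'.edge t) = 0) :
    position m (x.lift.β (x.lift.Γ'.tgt t)) = position m (x.lift.β (x.lift.Γ'.src t)) := by
  have := position_sub hl t
  rwa [h, map_zero, smul_zero, sub_eq_zero] at this

theorem position_eq {u v : x.lift.Γ'.V}
    (h : (zeroContraction l).onV u = (zeroContraction l).onV v) :
    position m (x.lift.β v) = position m (x.lift.β u) :=
  mem_of_zeroContraction_eq (T := fun w => position m (x.lift.β w) = position m (x.lift.β u))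
    (fun _ hd h' => (position_tgt hl hd).trans h') h rfl

theorem eq_zero_of_position_eq {t : x.lift.Γ'.D} (hs : x.base.s.1 (x.lift.sub.π t) ≠ 0)
    (h : position m (x.lift.β (x.lift.Γ'.tgt t)) = position m (x.lift.β (x.lift.Γ'.src t))) :
    l (x.lift.Γ'.edge t) = 0 := by
  have := position_sub hl t
  rw [h, sub_self] at this
  exact Mon.eq_zero_of_smul_eq_zero hs this.symm

theorem edgeLen_eq_zero {d : x.base.Γ.D} (hs : x.base.s.1 d ≠ 0)
    (h : position m (x.lift.β (x.lift.sub.ι (x.base.Γ.tgt d))) =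
      position m (x.lift.β (x.lift.sub.ι (x.base.Γ.src d)))) :
    edgeLen l (x.base.Γ.edge d) = 0 := by
  have : position m _ - position m _ = _ • toGp (edgeLen l _) := isPL_edgeLen hl d
  rw [h, sub_self] at this
  exact Mon.eq_zero_of_smul_eq_zero hs this.symm

omit hl in
/-- The position is constant on an initial part of an edge whose end has the position of the start
of the edge. -/
theorem position_src_eq {t : x.lift.Γ'.D} (hs : x.base.s.1 (x.lift.sub.π t) ≠ 0)
    (h : position m (x.lift.β (x.lift.Γ'.tgt t)) =
      position m (x.lift.β (x.lift.sub.ι (x.base.Γ.src (x.lift.sub.π t))))) :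
    position m (x.lift.β (x.lift.Γ'.tgt t)) = position m (x.lift.β (x.lift.Γ'.src t)) := by
  have hγ := position_step m
  rcases hs.lt_or_gt with hs | hs
  · have hs' : 0 < x.base.s.1 (x.lift.sub.π (x.lift.Γ'.rev t)) := by
      rw [s_rev]; exact neg_pos.2 hs
    have h1 := (piece_level hs').2.1
    have h2 := x.flow_pos _ hs'
    have e : x.base.Γ.tgt (x.lift.sub.π (x.lift.Γ'.rev t)) = x.base.Γ.src (x.lift.sub.π t) := by
      rw [x.lift.sub.π_rev, x.base.Γ.tgt_rev]
    rw [e, x.lift.Γ'.tgt_rev] at h1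
    rw [x.lift.Γ'.tgt_rev] at h2
    have g1 := gpLE_of_le hγ h1
    have g2 := gpLE_of_le hγ h2.le
    rw [← h] at g1
    exact Mon.gpLE_antisymm g2 g1
  · have h1 := (piece_level hs).1
    have g1 := gpLE_of_le hγ h1
    have g2 := gpLE_of_le hγ (x.flow_pos _ hs).le
    rw [← h] at g1
    exact Mon.gpLE_antisymm g1 g2

theorem m_eq_zero_iff {t : x.lift.Γ'.D} (hs : 0 < x.base.s.1 (x.lift.sub.π t)) {i : Fin x.lift.k}
    (h1 : x.lift.β (x.lift.Γ'.src t) = i.castSucc) (h2 : x.lift.β (x.lift.Γ'.tgt t) = i.succ) :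
    m i = 0 ↔ l (x.lift.Γ'.edge t) = 0 := by
  have := hl t i h1 h2
  constructor
  · intro h
    rw [h, map_zero] at this
    exact Mon.eq_zero_of_smul_eq_zero hs.ne' this
  · intro h
    rw [h, map_zero, smul_zero] at this
    exact (Mon.toGp_eq_zero M).1 this.symm

/-- Two pieces of nonzero length of the same edge which start at the same position are equal. -/
theorem piece_unique {t t' : x.lift.Γ'.D} (hπ : x.lift.sub.π t = x.lift.sub.π t')
    (h : l (x.lift.Γ'.edge t) ≠ 0) (h' : l (x.lift.Γ'.edge t') ≠ 0)
    (hp : position m (x.lift.β (x.lift.Γ'.src t)) = position m (x.lift.β (x.lift.Γ'.src t'))) :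
    t = t' := by
  by_cases hs0 : x.base.s.1 (x.lift.sub.π t) = 0
  · exact eq_of_s_eq_zero hπ hs0
  have hγ := position_step m
  rcases lt_or_gt_of_ne hs0 with hs | hs
  · have hs1 : 0 < x.base.s.1 (x.lift.sub.π (x.lift.Γ'.rev t)) := by
      rw [s_rev]; exact neg_pos.2 hs
    have hs2 : 0 < x.base.s.1 (x.lift.sub.π (x.lift.Γ'.rev t')) := by
      rw [s_rev, ← hπ]; exact neg_pos.2 hs
    obtain ⟨i, h1, h2⟩ := exists_level hs1
    obtain ⟨j, h3, h4⟩ := exists_level hs2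
    have hi := mt (m_eq_zero_iff hl hs1 h1 h2).1 (by rwa [x.lift.Γ'.edge_rev])
    have hj := mt (m_eq_zero_iff hl hs2 h3 h4).1 (by rwa [x.lift.Γ'.edge_rev])
    rw [x.lift.Γ'.tgt_rev] at h2 h4
    rw [h2, h4] at hp
    -- Of two different levels with the same upper position, the higher one would lie between equal
    -- positions and have length zero.
    have hij : i = j := by
      rcases lt_trichotomy i j with hlt | rfl | hlt
      · exact absurd (TropModuli.eq_zero_of_position_eq hγ hp
          (Fin.succ_le_castSucc_iff.2 hlt) le_rfl) hj
      · rfl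
      · exact absurd (TropModuli.eq_zero_of_position_eq hγ hp.symm
          (Fin.succ_le_castSucc_iff.2 hlt) le_rfl) hi
    have := (piece_level hs2).2.2 (x.lift.Γ'.rev t)
      (by rw [x.lift.sub.π_rev, x.lift.sub.π_rev, hπ]) (by rw [h1, h3, hij])
    rw [← x.lift.Γ'.rev_rev t, this, x.lift.Γ'.rev_rev]
  · have hs2 : 0 < x.base.s.1 (x.lift.sub.π t') := by rwa [← hπ]
    obtain ⟨i, h1, h2⟩ := exists_level hs
    obtain ⟨j, h3, h4⟩ := exists_level hs2
    have hi := mt (m_eq_zero_iff hl hs h1 h2).1 h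
    have hj := mt (m_eq_zero_iff hl hs2 h3 h4).1 h'
    rw [h1, h3] at hp
    have hij : i = j := by
      rcases lt_trichotomy i j with hlt | rfl | hlt
      · exact absurd (TropModuli.eq_zero_of_position_eq hγ hp le_rfl
          (Fin.succ_le_castSucc_iff.2 hlt)) hi
      · rfl
      · exact absurd (TropModuli.eq_zero_of_position_eq hγ hp.symm le_rfl
          (Fin.succ_le_castSucc_iff.2 hlt)) hj
    exact (piece_level hs2).2.2 t hπ (by rw [h1, h3, hij])

variable (l m) in
omit hl in
/-- The vertices of the subdivision which lie over a vertex after contracting edges of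
length zero. -/
def Near (v : x.base.Γ.V) (u : x.lift.Γ'.V) : Prop :=
  (∃ w, u = x.lift.sub.ι w ∧
    (zeroContraction (edgeLen l)).onV w = (zeroContraction (edgeLen l)).onV v) ∨
  (u ∉ Set.range x.lift.sub.ι ∧ ∃ t, x.lift.Γ'.src t = u ∧
    position m (x.lift.β u) =
      position m (x.lift.β (x.lift.sub.ι (x.base.Γ.src (x.lift.sub.π t)))) ∧
    (zeroContraction (edgeLen l)).onV (x.base.Γ.src (x.lift.sub.π t)) =
      (zeroContraction (edgeLen l)).onV v)

/-- The position does not change along `d`. If `d` ends at a vertex of the graph, then it has run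
back to the start of the edge, or the whole edge has slope zero and is undivided, or its ends have
equal position. In the last two cases the edge has length zero and is contracted. If `d` ends at an
exceptional vertex, that vertex lies on the same edge. -/
theorem Near.tgt {v : x.base.Γ.V} {d : x.lift.Γ'.D} (hd : l (x.lift.Γ'.edge d) = 0)
    (h : Near l m v (x.lift.Γ'.src d)) : Near l m v (x.lift.Γ'.tgt d) := by
  have hp := position_tgt hl hd
  by_cases ht : x.lift.Γ'.tgt d ∈ Set.range x.lift.sub.ι
  · obtain ⟨w', hw'⟩ := ht
    refine .inl ⟨w', hw'.symm, ?_⟩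
    have hw2 := x.lift.sub.tgt_π hw'.symm
    have collapse : edgeLen l (x.base.Γ.edge (x.lift.sub.π d)) = 0 →
        (zeroContraction (edgeLen l)).onV w' =
          (zeroContraction (edgeLen l)).onV (x.base.Γ.src (x.lift.sub.π d)) := fun h0 => by
      rw [← hw2, zeroContraction_collapse h0]
    rcases h with ⟨w, hw, hwv⟩ | ⟨hu, t, ht, hpt, hv⟩
    · have hw1 := x.lift.sub.src_π hw
      rw [← hwv, ← hw1]
      refine collapse ?_
      by_cases hs : x.base.s.1 (x.lift.sub.π d) = 0
      · rw [edgeLen_of_s_eq_zero l hs, hd]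
      · refine edgeLen_eq_zero hl hs ?_
        rw [hw1, hw2, hw', ← hw, hp]
    · rcases π_eq_or_eq_rev (x := x) (t := t) (t' := d) (by rwa [ht]) ht.symm with e | e
      · rw [← hv, ← e]
        refine collapse (edgeLen_eq_zero hl ?_ ?_)
        · exact s_ne_zero_of_exceptional hu
        · rw [hw2, hw', hp, hpt, e]
      · rw [← hv, ← hw2, e, x.base.Γ.tgt_rev]
  · refine .inr ⟨ht, ?_⟩
    obtain ⟨t', ht', hπ'⟩ := exists_next ht
    rcases h with ⟨w, hw, hwv⟩ | ⟨hu, t, hts, hpt, hv⟩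
    · have hw1 := x.lift.sub.src_π hw
      exact ⟨t', ht', by rw [hp, hπ', hw1, hw], by rw [hπ', hw1, hwv]⟩
    · rcases π_eq_or_eq_rev (x := x) (t := t) (t' := d) (by rwa [hts]) hts.symm with e | e
      · exact ⟨t', ht', by rw [hp, hπ', e, hpt], by rw [hπ', e, hv]⟩
      · have e' : x.lift.sub.π (x.lift.Γ'.rev d) = x.lift.sub.π t := by
          rw [x.lift.sub.π_rev, e, x.base.Γ.rev_rev]
        exact ⟨x.lift.Γ'.rev d, rfl, by rw [hp, e', hpt], by rw [e', hv]⟩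

theorem near_of_onV_eq {v : x.base.Γ.V} {u : x.lift.Γ'.V}
    (h : (zeroContraction l).onV u = (zeroContraction l).onV (x.lift.sub.ι v)) :
    Near l m v u :=
  mem_of_zeroContraction_eq (T := Near l m v) (fun _ hd h' => h'.tgt hl hd) h.symm
    (.inl ⟨v, rfl, rfl⟩)

/-- Vertices of the graph merged in the subdivision are already merged in the graph. This is the
injectivity of `contractι`. -/
theorem onV_eq_of_onV_ι_eq {v w : x.base.Γ.V}
    (h : (zeroContraction l).onV (x.lift.sub.ι w) =
      (zeroContraction l).onV (x.lift.sub.ι v)) :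
    (zeroContraction (edgeLen l)).onV w = (zeroContraction (edgeLen l)).onV v := by
  rcases near_of_onV_eq hl h with ⟨w', hw, hwv⟩ | ⟨hu, -⟩
  · rwa [x.lift.sub.ι_inj hw]
  · exact absurd ⟨w, rfl⟩ hu

/-- If `t` starts at an exceptional vertex merged with `v` but points back along the edge, then it
lies on the initial part of constant position and has length zero. Hence a surviving `t` points away
from `v`. -/
theorem onV_src_π {v : x.base.Γ.V} {t : x.lift.Γ'.D} (ht : l (x.lift.Γ'.edge t) ≠ 0)
    (h : (zeroContraction l).onV (x.lift.Γ'.src t) =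
      (zeroContraction l).onV (x.lift.sub.ι v)) :
    (zeroContraction (edgeLen l)).onV (x.base.Γ.src (x.lift.sub.π t)) =
      (zeroContraction (edgeLen l)).onV v := by
  rcases near_of_onV_eq hl h with ⟨w, hw, hwv⟩ | ⟨hu, t', ht', hp, hv⟩
  · rw [x.lift.sub.src_π hw, hwv]
  · rcases π_eq_or_eq_rev (x := x) (t := t') (t' := t) (by rwa [ht']) ht'.symm with e | e
    · rw [e, hv]
    · have hs := s_ne_zero_of_exceptional hu
      have e' : x.lift.sub.π (x.lift.Γ'.rev t) = x.lift.sub.π t' := by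
        rw [x.lift.sub.π_rev, e, x.base.Γ.rev_rev]
      have hs' : x.base.s.1 (x.lift.sub.π (x.lift.Γ'.rev t)) ≠ 0 := by
        rw [s_rev]; exact neg_ne_zero.2 hs
      have h1 := position_src_eq (m := m) hs' (by rw [e', x.lift.Γ'.tgt_rev, hp])
      have h2 := eq_zero_of_position_eq hl hs' h1
      rw [x.lift.Γ'.edge_rev] at h2
      exact absurd h2 ht

theorem piece_unique_of_onV {t t' : x.lift.Γ'.D} (hπ : x.lift.sub.π t = x.lift.sub.π t')
    (h : l (x.lift.Γ'.edge t) ≠ 0) (h' : l (x.lift.Γ'.edge t') ≠ 0)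
    (hv : (zeroContraction l).onV (x.lift.Γ'.src t) =
      (zeroContraction l).onV (x.lift.Γ'.src t')) : t = t' :=
  piece_unique hl hπ h h' (position_eq hl hv.symm)

/-- If the ends of `d` lie in different classes, telescoping the indicator of the class of the start
yields a piece leaving it. If they are merged, the slope is zero and the edge is its own single
piece. -/
theorem exists_piece_of_edgeLen {d : x.base.Γ.D} (hd : edgeLen l (x.base.Γ.edge d) ≠ 0) :
    ∃ t, x.lift.sub.π t = d ∧ l (x.lift.Γ'.edge t) ≠ 0 ∧
      (zeroContraction l).onV (x.lift.Γ'.src t) =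
        (zeroContraction l).onV (x.lift.sub.ι (x.base.Γ.src d)) := by
  classical
  by_cases h : (zeroContraction l).onV (x.lift.sub.ι (x.base.Γ.tgt d)) =
      (zeroContraction l).onV (x.lift.sub.ι (x.base.Γ.src d))
  · have hs : x.base.s.1 d = 0 := by
      by_contra hs
      exact hd (edgeLen_eq_zero hl hs (position_eq hl h.symm))
    obtain ⟨t, h1, rfl⟩ := x.lift.sub.exists_piece d
    exact ⟨t, rfl, by rwa [← edgeLen_of_s_eq_zero l hs], by rw [h1]⟩
  · have key := x.lift.sub.sum_pieces (fun v => if (zeroContraction l).onV v =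
      (zeroContraction l).onV (x.lift.sub.ι (x.base.Γ.src d)) then (1 : ℤ) else 0) d
    rw [if_pos rfl, if_neg h] at key
    obtain ⟨t, ht, hlt⟩ := Finset.exists_lt_of_sum_lt (s := Finset.univ.filter fun t =>
      x.lift.sub.π t = d) (g := fun _ => (0 : ℤ)) (by rw [key, Finset.sum_const_zero]; norm_num)
    refine ⟨t, (Finset.mem_filter.1 ht).2, fun h0 => ?_, ?_⟩
    · rw [zeroContraction_collapse h0, sub_self] at hlt
      exact lt_irrefl _ hlt
    · by_contra hne
      rw [if_neg hne] at hlt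
      split_ifs at hlt <;> omega

omit hl in
/-- A class of vertices which does not contain vertices of the graph lies on one edge. -/
theorem exists_piece_of_exceptional {u : x.lift.Γ'.V}
    (hu : ∀ v, (zeroContraction l).onV (x.lift.sub.ι v) ≠ (zeroContraction l).onV u)
    {t₀ : x.lift.Γ'.D} (ht₀ : x.lift.Γ'.src t₀ = u) {v : x.lift.Γ'.V}
    (hv : (zeroContraction l).onV u = (zeroContraction l).onV v) :
    ∃ t, x.lift.Γ'.src t = v ∧ x.lift.sub.π t = x.lift.sub.π t₀ := by
  refine (mem_of_zeroContraction_eq (l := l) (T := fun v =>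
    (zeroContraction l).onV u = (zeroContraction l).onV v ∧
      ∃ t, x.lift.Γ'.src t = v ∧ x.lift.sub.π t = x.lift.sub.π t₀) ?_ hv ⟨rfl, t₀, ht₀, rfl⟩).2
  rintro e he ⟨h1, t, h2, h3⟩
  have h4 := h1.trans (zeroContraction_collapse he)
  refine ⟨h4, ?_⟩
  have e1 : x.lift.Γ'.src t ∉ Set.range x.lift.sub.ι := by
    rintro ⟨w, hw⟩
    exact hu w (by rw [hw, h2, h1])
  have e2 : x.lift.Γ'.tgt e ∉ Set.range x.lift.sub.ι := by
    rintro ⟨w, hw⟩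
    exact hu w (by rw [hw, h4])
  rcases π_eq_or_eq_rev e1 h2.symm with h | h
  · obtain ⟨t', ht', hπ⟩ := exists_next e2
    exact ⟨t', ht', by rw [hπ, h, h3]⟩
  · exact ⟨x.lift.Γ'.rev e, rfl, by rw [x.lift.sub.π_rev, h, x.base.Γ.rev_rev, h3]⟩

-- Multiplying the level by the slope gives a quantity that increases along every piece, whatever
-- the sign of the slope; it serves to find the farthest vertex of a class.
omit hl in
theorem s_mul_lt {t : x.lift.Γ'.D} (hs : x.base.s.1 (x.lift.sub.π t) ≠ 0) :
    x.base.s.1 (x.lift.sub.π t) * ((x.lift.β (x.lift.Γ'.src t) : ℕ) : ℤ) <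
      x.base.s.1 (x.lift.sub.π t) * ((x.lift.β (x.lift.Γ'.tgt t) : ℕ) : ℤ) := by
  rcases hs.lt_or_gt with h | h
  · have h1 : x.lift.β (x.lift.Γ'.tgt t) < x.lift.β (x.lift.Γ'.src t) := by
      have := x.flow_pos (x.lift.Γ'.rev t) (by rw [flow_apply, s_rev]; exact neg_pos.2 h)
      rwa [x.lift.Γ'.tgt_rev] at this
    exact mul_lt_mul_of_neg_left (Int.ofNat_lt.2 h1) h
  · exact mul_lt_mul_of_pos_left (Int.ofNat_lt.2 (x.flow_pos t h)) h

-- Among the vertices merged with `u`, the one farthest along the direction of `t₀` has an outgoing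
-- piece in that direction. Were its length zero, its end would be merged with `u` and lie farther.
omit hl in
theorem exists_piece_ne_zero_of_exceptional {u : x.lift.Γ'.V}
    (hu : ∀ v, (zeroContraction l).onV (x.lift.sub.ι v) ≠ (zeroContraction l).onV u)
    {t₀ : x.lift.Γ'.D} (ht₀ : x.lift.Γ'.src t₀ = u) :
    ∃ t, x.lift.sub.π t = x.lift.sub.π t₀ ∧ l (x.lift.Γ'.edge t) ≠ 0 ∧
      (zeroContraction l).onV (x.lift.Γ'.src t) = (zeroContraction l).onV u := by
  classical
  have hs : x.base.s.1 (x.lift.sub.π t₀) ≠ 0 := s_ne_zero_of_exceptional (by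
    rintro ⟨w, hw⟩
    exact hu w (by rw [hw, ht₀]))
  obtain ⟨v, hv, hmax⟩ := Finset.exists_max_image
    (Finset.univ.filter fun v => (zeroContraction l).onV u = (zeroContraction l).onV v)
    (fun v => x.base.s.1 (x.lift.sub.π t₀) * ((x.lift.β v : ℕ) : ℤ)) ⟨u, by simp⟩
  rw [Finset.mem_filter] at hv
  obtain ⟨t, rfl, hπ⟩ := exists_piece_of_exceptional hu ht₀ hv.2
  refine ⟨t, hπ, fun h0 => ?_, hv.2.symm⟩
  have h1 := hmax (x.lift.Γ'.tgt t) (by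
    rw [Finset.mem_filter]
    exact ⟨Finset.mem_univ _, hv.2.trans (zeroContraction_collapse h0)⟩)
  rw [← hπ] at h1 hs
  exact absurd (s_mul_lt hs) h1.not_gt

end Point

end CombRub

/-! ### The contracted subdivision and lift, and the resulting tropical object. -/

namespace CombRub

section Contract

variable {x : CombRub} {M : Mon} {l : x.lift.Γ'.Edge → M} {m : Fin x.lift.k → M}
  (hl : x.IsPoint l m)

variable (l) in
/-- The inclusion of vertices after contracting the edges of length zero. -/
def contractι :
    (x.base.Γ.contract (fun d => edgeLen l (x.base.Γ.edge d) ≠ 0) (contract_rev (edgeLen l))).V →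
      (x.lift.Γ'.contract (fun d => l (x.lift.Γ'.edge d) ≠ 0) (contract_rev l)).V :=
  Quot.lift (fun v => (zeroContraction l).onV (x.lift.sub.ι v)) (by
    rintro _ _ ⟨d, hd, rfl, rfl⟩
    exact onV_ι_eq (not_not.1 hd))

/-- The subdivision obtained by contracting the edges of length zero. -/
def contractSub : Subdivision
    (x.lift.Γ'.contract (fun d => l (x.lift.Γ'.edge d) ≠ 0) (contract_rev l))
    (x.base.Γ.contract (fun d => edgeLen l (x.base.Γ.edge d) ≠ 0) (contract_rev (edgeLen l))) where
  ι := contractι l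
  ι_inj := by
    rintro ⟨v⟩ ⟨w⟩ h
    exact onV_eq_of_onV_ι_eq hl h
  π d := ⟨x.lift.sub.π d.1, fun h => d.2 (eq_zero_of_edgeLen h)⟩
  π_rev d := Subtype.ext (x.lift.sub.π_rev d.1)
  star := by
    rintro ⟨v⟩
    refine ⟨fun t ht => onV_src_π hl t.2 ht, fun t ht t' ht' hπ => ?_, fun d hd => ?_⟩
    · exact Subtype.ext (piece_unique_of_onV hl (congrArg Subtype.val hπ) t.2 t'.2
        ((show _ = _ from ht).trans (show _ = _ from ht').symm))
    · obtain ⟨t, h1, h2, h3⟩ := exists_piece_of_edgeLen hl d.2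
      refine ⟨⟨t, h2⟩, h3.trans (congrArg (contractι l) (show _ = _ from hd)),
        Subtype.ext h1⟩
  exceptional := by
    rintro ⟨u⟩ hv
    have hu : ∀ v, (zeroContraction l).onV (x.lift.sub.ι v) ≠ (zeroContraction l).onV u :=
      fun v hv' => hv ⟨Quot.mk _ v, hv'⟩
    have hu' : u ∉ Set.range x.lift.sub.ι := by
      rintro ⟨v, rfl⟩
      exact hu v rfl
    obtain ⟨t₀, _, _, hs, _⟩ := x.lift.sub.exceptional u hu'
    have ht₀ : x.lift.Γ'.src t₀ = u := by
      have : t₀ ∈ {d | x.lift.Γ'.src d = u} := by rw [hs]; exact .inl rfl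
      exact this
    obtain ⟨t₀', ht₀', hπ⟩ := exists_π_eq_rev (x := x) (t := t₀) (by rwa [ht₀])
    rw [ht₀] at ht₀'
    -- One surviving piece leaves the class of `u` in each direction of its edge. Any other
    -- surviving piece leaving the class runs in one of these directions and coincides with the
    -- piece found by `piece_unique_of_onV`.
    obtain ⟨t₁, h1, h2, h3⟩ := exists_piece_ne_zero_of_exceptional hu ht₀
    obtain ⟨t₂, h4, h5, h6⟩ := exists_piece_ne_zero_of_exceptional hu ht₀'
    rw [hπ] at h4
    refine ⟨⟨t₁, h2⟩, ⟨t₂, h5⟩, fun h => ?_, ?_, Subtype.ext ?_⟩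
    · have h' : t₁ = t₂ := congrArg Subtype.val h
      rw [← h', h1] at h4
      exact x.base.Γ.rev_ne _ h4.symm
    · ext t
      constructor
      · intro ht
        have ht' : (zeroContraction l).onV (x.lift.Γ'.src t.1) = (zeroContraction l).onV u := ht
        obtain ⟨t', e1, e2⟩ := exists_piece_of_exceptional hu ht₀ ht'.symm
        have hex : x.lift.Γ'.src t' ∉ Set.range x.lift.sub.ι := by
          rintro ⟨v, hv⟩
          exact hu v (by rw [hv, e1, ht'])
        rcases π_eq_or_eq_rev hex e1.symm with h | h
        · exact .inl (Subtype.ext (piece_unique_of_onV hl (by rw [h, e2, h1]) t.2 h2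
            (ht'.trans h3.symm)))
        · exact .inr (Subtype.ext (piece_unique_of_onV hl (by rw [h, e2, h4]) t.2 h5
            (ht'.trans h6.symm)))
      · rintro (rfl | rfl)
        · exact h3
        · exact h6
    · exact h4.trans (congrArg x.base.Γ.rev h1.symm)
  legs := by
    refine (List.map_map).trans ?_
    change _ = x.lift.Γ'.legs.map (zeroContraction l).onV
    rw [← x.lift.sub.legs, List.map_map]
    rfl

variable {n : ℕ} (q : LineContraction x.lift.k n) (hq : ∀ i, i ∈ Set.range q.onE ↔ m i ≠ 0)

include hq in
theorem onV_castSucc_eq_iff (i : Fin x.lift.k) :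
    q.onV i.castSucc = q.onV i.succ ↔ m i = 0 := by
  constructor
  · intro h
    by_contra hm
    exact q.not_mem_range_of_eq h ((hq i).2 hm)
  · exact fun h => q.collapse i fun h' => (hq i).1 h' h

-- The contracted level map must be constant on pieces of length zero to descend, and on surviving
-- pieces only when the slope is zero, which gives minimality.
include hl hq in
theorem onV_β_eq_iff (t : x.lift.Γ'.D) :
    q.onV (x.lift.β (x.lift.Γ'.src t)) = q.onV (x.lift.β (x.lift.Γ'.tgt t)) ↔
      l (x.lift.Γ'.edge t) = 0 ∨ x.base.s.1 (x.lift.sub.π t) = 0 := by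
  have hpos : ∀ t, 0 < x.base.s.1 (x.lift.sub.π t) →
      (q.onV (x.lift.β (x.lift.Γ'.src t)) = q.onV (x.lift.β (x.lift.Γ'.tgt t)) ↔
        l (x.lift.Γ'.edge t) = 0) := by
    intro t hs
    obtain ⟨i, h1, h2⟩ := exists_level hs
    rw [← m_eq_zero_iff hl hs h1 h2, h1, h2, onV_castSucc_eq_iff q hq]
  rcases lt_trichotomy (x.base.s.1 (x.lift.sub.π t)) 0 with hs | hs | hs
  · have := hpos (x.lift.Γ'.rev t) (by rw [s_rev]; exact neg_pos.2 hs)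
    rw [x.lift.Γ'.tgt_rev, x.lift.Γ'.edge_rev] at this
    rw [or_iff_left hs.ne, ← this]
    exact eq_comm
  · rw [x.flow_zero t hs]
    exact ⟨fun _ => .inr hs, fun _ => rfl⟩
  · rw [or_iff_left hs.ne', hpos t hs]

/-- The equidimensional lift obtained by contracting the edges of length zero. -/
def contractLift : EquidimLift (x.base.Γ.contract (fun d => edgeLen l (x.base.Γ.edge d) ≠ 0)
    (contract_rev (edgeLen l))) where
  Γ' := x.lift.Γ'.contract (fun d => l (x.lift.Γ'.edge d) ≠ 0) (contract_rev l)
  sub := contractSub hl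
  k := n
  β := Quot.lift (fun v => q.onV (x.lift.β v)) (by
    rintro _ _ ⟨d, hd, rfl, rfl⟩
    exact (onV_β_eq_iff hl q hq d).2 (.inl (not_not.1 hd)))
  cell := by
    rintro ⟨t, ht⟩
    change (q.onV (x.lift.β (x.lift.Γ'.tgt t)) : ℕ) ≤ q.onV (x.lift.β (x.lift.Γ'.src t)) + 1
    rcases lt_or_ge (x.lift.β (x.lift.Γ'.src t)) (x.lift.β (x.lift.Γ'.tgt t)) with h | h
    · obtain ⟨i, h1, h2⟩ := x.lift.exists_cell h
      rw [h1, h2]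
      exact q.onV_succ_le i
    · exact Nat.le_succ_of_le (q.onV_mono h)
  stable i := by
    obtain ⟨j, rfl⟩ := q.onV_surj i
    obtain ⟨v, rfl⟩ := x.lift.stable j
    exact ⟨Quot.mk _ v, rfl⟩
  minimal t t' hπ hβ := Subtype.ext (eq_of_s_eq_zero (congrArg Subtype.val hπ)
    (((onV_β_eq_iff hl q hq t.1).1 hβ).resolve_left t.2))

include hq in
theorem exists_position : ∃ γ : Fin (n + 1) → Gp M, (∀ a, γ (q.onV a) = position m a) ∧
    ∀ i, γ i.succ - γ i.castSucc = toGp (m (q.onE i)) := by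
  obtain ⟨γ, hγ⟩ := q.exists_desc (g := position m) fun i hi => by
    rw [hq, not_not] at hi
    have := position_step m i
    rw [hi, map_zero, sub_eq_zero] at this
    exact this.symm
  refine ⟨γ, hγ, fun i => ?_⟩
  rw [← position_step, ← q.onV_succ, ← q.onV_castSucc, hγ, hγ]

open Classical in
/-- The tropical curve with an equidimensional lift obtained by contracting the edges of
length zero. -/
def contractRub : SigmaRub where
  base := SigmaDiv.contract (edgeLen l) (isPL_edgeLen hl)
  lift := contractLift hl q hq
  len' e := l ((zeroContraction l).onE e)
  len'_ne := zeroContraction_onE_ne l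
  len'_sum d := by
    change ∑ t with (contractSub hl).π t = d, l (x.lift.Γ'.edge t.1) =
      ∑ t with x.lift.sub.π t = d.1, l (x.lift.Γ'.edge t)
    -- The pieces lost in the contraction have length zero and do not change the sum.
    refine Finset.sum_of_injOn Subtype.val Subtype.val_injective.injOn ?_ ?_ fun _ _ => rfl
    · intro t ht
      have ht' := (Finset.mem_filter.1 (Finset.mem_coe.1 ht)).2
      exact Finset.mem_coe.2 (Finset.mem_filter.2 ⟨Finset.mem_univ _, congrArg Subtype.val ht'⟩)
    · intro t ht hn
      by_contra h0
      exact hn ⟨⟨t, h0⟩, Finset.mem_coe.2 (Finset.mem_filter.2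
        ⟨Finset.mem_univ _, Subtype.ext (Finset.mem_filter.1 ht).2⟩), rfl⟩
  -- `position` starts at zero at the bottom of the line. Subtracting the position of the root
  -- matches the normalization of the piecewise linear function.
  γ i := (exists_position q hq).choose i - position m (x.lift.β (x.lift.sub.ι x.base.Γ.root))
  lenX i := m (q.onE i)
  lenX_ne i := (hq _).1 ⟨i, rfl⟩
  γ_step i := (sub_sub_sub_cancel_right _ _ _).trans ((exists_position q hq).choose_spec.2 i)
  value := by
    rintro ⟨v⟩
    refine Eq.trans ?_ (contract_α (edgeLen l) (isPL_edgeLen hl) v).symm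
    exact congrArg (· - _) ((exists_position q hq).choose_spec.1 (x.lift.β (x.lift.sub.ι v)))
  slope t k hk := by
    have h1 := SigmaDiv.slope_unique _ hk
    rw [contract_s] at h1
    have h2 : k = x.base.s.1 (x.lift.sub.π t.1) := h1
    have h3 := position_sub hl t.1
    rw [← h2, ← (exists_position q hq).choose_spec.1, ← (exists_position q hq).choose_spec.1] at h3
    exact (sub_sub_sub_cancel_right _ _ _).trans h3

/-- The contraction of the edges of length zero. -/
def contractRubHom : x ⟶ (contractRub hl q hq).comb where
  base := ⟨zeroContraction (edgeLen l), (contract_s (edgeLen l) (isPL_edgeLen hl)).symm⟩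
  lift :=
    { c' := zeroContraction l
      q := q
      onV_ι := fun _ => rfl
      π_onD := fun _ => rfl
      β_onV := fun _ => rfl }

end Contract

end CombRub

/-! ### Representability of the stack of equidimensional lifts. -/

namespace SigmaRub

theorem isGood : pointFunctor.IsGood where
  full φ c h := pointFunctor_full φ c h
  faithful _ _ h1 h2 := pointFunctor_faithful h1 h2
  surj M x h := by
    obtain ⟨l, m, hl, rfl⟩ := x.exists_pt h
    -- The line is contracted along exactly its edges of length zero, in parallel with the
    -- subdivision.
    obtain ⟨n, q, hq⟩ := LineContraction.exists_range_eq fun i => m i ≠ 0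
    let X := CombRub.contractRub hl q hq
    refine ⟨X, Iso.refl M, CombRub.contractRubHom hl q hq, ?_⟩
    refine Eq.trans ?_ (Category.id_comp _).symm
    exact ((CombRub.pt_comp_eq_iff (x := x) (y := X.comb) (hl := hl) (hl' := X.isPoint) _).2
      ⟨⟨fun _ => rfl, fun e he => zeroContraction_onE l he⟩, fun _ => rfl,
        fun i hi => not_not.1 fun h => hi ((hq i).2 h)⟩).symm
  factor X {_ _} c d h hc := pointFunctor_factor X c d h hc

end SigmaRub

end TropModuli

end

theorem mainTheorem7 :
    (TropModuli.IsConeStackDiagram TropModuli.CombDiv.cones ∧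
      TropModuli.Represents TropModuli.CombDiv.cones TropModuli.SigmaDiv.proj) ∧
    (TropModuli.IsConeStackDiagram TropModuli.CombOrd.cones ∧
      TropModuli.Represents TropModuli.CombOrd.cones TropModuli.SigmaOrd.proj) ∧
    (TropModuli.IsConeStackDiagram TropModuli.CombRub.cones ∧
      TropModuli.Represents TropModuli.CombRub.cones TropModuli.SigmaRub.proj) := by
  refine ⟨⟨TropModuli.CombDiv.isConeStackDiagram, TropModuli.SigmaDiv.isGood.represents⟩,
    ⟨TropModuli.CombOrd.isConeStackDiagram, TropModuli.SigmaOrd.isGood.represents⟩,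
    ⟨TropModuli.CombRub.isConeStackDiagram, TropModuli.SigmaRub.isGood.represents⟩⟩
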